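/- Conventions. $D$ is a finite nonempty domain. A $k$-ary operation $g:D^k\to D$ ($k\ge 1$) is a near-unanimity operation if $g(x,y,\dots,y)=g(y,x,y,\dots,y)=\dots=g(y,\dots,y,x)=y$ for all $x,y\in D$; $\mathrm{Inv}(g)$ is the set of relations on $D$ that have $g$ as a polymorphism. For a (nondeterministic) finite automaton $\mathcal A$ over $D$ with nonempty state set $S$ and transition table $\Delta\subseteq S\times D\times S$, put $|\mathcal A|=|S|+|\Delta|$ and $R_m=\mathcal L(\mathcal A)\cap D^m$ ($m\ge 1$); write $\mathcal A\in\mathcal K_g$ if $g$ is a polymorphism of every $R_m$. An AutCSP instance $I=(V,D,\mathcal C,\mathcal A)$ consists of a finite set $V$ of variables, a finite set $\mathcal C$ of nonempty tuples $\mathbf s$ of variables, and a finite automaton $\mathcal A$ over $D$; a solution is a map $\psi:V\to D$ with $\psi(\mathbf s)\in R_{|\mathbf s|}$ for all $\mathbf s\in\mathcal C$. Let $|\mathcal C|=\sum_{\mathbf s\in\mathcal C}|\mathbf s|$. The instance is represented by $V$, $D$, the list of the tuples in $\mathcal C$ and the table of $\mathcal A$. Algorithms are programs of a unit-cost random access machine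 with addition and truncated subtraction (and without multiplication). Statement. Let $k\ge 1$. (a) There are an algorithm and a constant $c$, depending only on $k$, such that for every finite nonempty $D$, every $k$-ary near-unanimity operation $g$ on $D$ and every AutCSP instance $I=(V,D,\mathcal C,\mathcal A)$ with $\mathcal A\in\mathcal K_g$, the algorithm on input $I$ builds, in at most $c\,(|\mathcal C|^{k}\,|\mathcal A|\,|D|^{k-1}+1)$ steps, a CSP instance $I'=(V,D,\{\langle\mathbf u,P_{\mathbf u}\rangle\})$ with exactly one constraint for each tuple $\mathbf u$ of $k-1$ (not necessarily distinct) variables occurring in $\mathcal C$, where each $P_{\mathbf u}\subseteq D^{k-1}$ is given by the explicit list of its tuples, such that each $P_{\mathbf u}$ belongs to $\mathrm{Inv}(g)$, and a map $\psi:V\to D$ is a solution of $I$ if and only if it is a solution of $I'$. (b) There are an algorithm and a polynomial $Q$, depending only on $k$, such that for all $D$, $g$ and $I$ as in (a), the algorithm on input $I$ decides whether $I$ has a solution, in at most $Q(|V|+|\mathcal C|+|\mathcal A|+|D|)$ steps. In particular, for each fixed near-unanimity operation $g$ (and so fixed $D$), satisfiability of AutCSP instances with $\mathcal A\in\mathcal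 K_g$ is decidable in time polynomial in the size $|V|+|\mathcal C|+|\mathcal A|$ of the instance. -/

import Mathlib

/-! ## Relations, operations, constraint satisfaction problems

Finite sets of variables, domains and state sets of size `n` are taken to be `Fin n`. -/

/-- The operation `f : D^t → D` is a polymorphism of the `m`-ary relation `R` on `D`. -/
def IsPolymorphism {D : Type*} {t m : ℕ} (f : (Fin t → D) → D) (R : Set (Fin m → D)) : Prop :=
  ∀ x : Fin t → Fin m → D, (∀ i, x i ∈ R) → (fun j => f (fun i => x i j)) ∈ R

/-- `Inv(g)`, in arity `m`: the `m`-ary relations that have `g` as a polymorphism. -/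
def InvRel {D : Type*} {t : ℕ} (g : (Fin t → D) → D) (m : ℕ) : Set (Set (Fin m → D)) :=
  {R | IsPolymorphism g R}

/-- `g(x,y,…,y) = g(y,x,y,…,y) = … = g(y,…,y,x) = y` for all `x, y`. -/
def IsNearUnanimity {D : Type*} {k : ℕ} (g : (Fin k → D) → D) : Prop :=
  ∀ (i : Fin k) (x y : D), g (Function.update (fun _ => y) i x) = y

/-- A constraint over the variables `Fin n` and the domain `Fin d`: a scope and a relation. -/
structure CSPConstraint (n d : ℕ) where
  arity : ℕ
  scope : Fin arity → Fin n
  rel : Set (Fin arity → Fin d)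

/-- The assignment `ψ` is a solution of the CSP instance with the set `C` of constraints. -/
def IsSolution {n d : ℕ} (ψ : Fin n → Fin d) (C : Set (CSPConstraint n d)) : Prop :=
  ∀ c ∈ C, (fun j => ψ (c.scope j)) ∈ c.rel

/-! ## Automata and automatic CSP instances -/

/-- A nondeterministic finite automaton over the alphabet `Fin d`, with state set `Fin numStates`.
The transition table, a finite set, is presented by a list of its elements. -/
structure FinAutomaton (d : ℕ) where
  numStates : ℕ
  numStates_pos : 0 < numStates
  isStart : Fin numStates → Bool
  isAccept : Fin numStates → Bool
  trans : List (Fin numStates × Fin d × Fin numStates)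
  trans_nodup : trans.Nodup

namespace FinAutomaton

variable {d : ℕ}

def toNFA (A : FinAutomaton d) : NFA (Fin d) (Fin A.numStates) where
  step s a := {s' | (s, a, s') ∈ A.trans}
  start := {s | A.isStart s = true}
  accept := {s | A.isAccept s = true}

/-- `|A|`, the number of states plus the number of transitions. -/
def size (A : FinAutomaton d) : ℕ := A.numStates + A.trans.length

/-- `R_m`, the set of the words of length `m` that `A` accepts, as an `m`-ary relation. -/
def rel (A : FinAutomaton d) (m : ℕ) : Set (Fin m → Fin d) :=
  {r | List.ofFn r ∈ A.toNFA.accepts}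

/-- The class `K_f` of the automata `A` such that `f` is a polymorphism of
`Γ_A = {R_1, R_2, …}`. -/
def classK {t : ℕ} (f : (Fin t → Fin d) → Fin d) : Set (FinAutomaton d) :=
  {A | ∀ m, 1 ≤ m → IsPolymorphism f (A.rel m)}

end FinAutomaton

/-- An automatic CSP instance over the domain `Fin d`. The variables are `Fin numVars`. The finite
set of constraints, each a nonempty tuple of variables, is presented by a list of its elements. -/
structure AutCSPInstance (d : ℕ) where
  numVars : ℕ
  scopes : List (List (Fin numVars))
  scopes_nodup : scopes.Nodup
  scopes_ne_nil : ∀ s ∈ scopes, s ≠ []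
  aut : FinAutomaton d

namespace AutCSPInstance

variable {d : ℕ}

/-- A tuple `s` stands for the constraint `⟨s, R_{|s|}⟩`. -/
def constraints (I : AutCSPInstance d) : Set (CSPConstraint I.numVars d) :=
  {c | ∃ s ∈ I.scopes, c = ⟨s.length, s.get, I.aut.rel s.length⟩}

/-- `|C|`, the sum of the lengths of the constraints. -/
def constraintSize (I : AutCSPInstance d) : ℕ := (I.scopes.map List.length).sum

/-- The variable `x` occurs in some constraint. -/
def Occurs (I : AutCSPInstance d) (x : Fin I.numVars) : Prop := ∃ s ∈ I.scopes, x ∈ s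

/-- The representation of an instance as a sequence of numbers: `|V|`, `|D|`, the numbers of
states, of transitions and of constraints; the transitions; for each state whether it is initial,
and for each state whether it is accepting; each constraint preceded by its length. -/
def encode (I : AutCSPInstance d) : List ℕ :=
  [I.numVars, d, I.aut.numStates, I.aut.trans.length, I.scopes.length]
    ++ I.aut.trans.flatMap (fun e => [(e.1 : ℕ), (e.2.1 : ℕ), (e.2.2 : ℕ)])
    ++ List.ofFn (fun s => (I.aut.isStart s).toNat)
    ++ List.ofFn (fun s => (I.aut.isAccept s).toNat)
    ++ I.scopes.flatMap (fun s => s.length :: s.map (fun x => (x : ℕ)))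

end AutCSPInstance

/-! ## Explicitly represented CSP instances -/

/-- An `r`-ary constraint whose relation is given by the list of its tuples. -/
structure ExplicitConstraint (n d r : ℕ) where
  scope : Fin r → Fin n
  tuples : List (Fin r → Fin d)
  tuples_nodup : tuples.Nodup

namespace ExplicitConstraint

variable {n d r : ℕ}

def rel (c : ExplicitConstraint n d r) : Set (Fin r → Fin d) := {x | x ∈ c.tuples}

def toConstraint (c : ExplicitConstraint n d r) : CSPConstraint n d := ⟨r, c.scope, c.rel⟩

/-- The scope, the number of tuples, the tuples. -/
def encode (c : ExplicitConstraint n d r) : List ℕ :=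
  List.ofFn (fun j => (c.scope j : ℕ)) ++ [c.tuples.length]
    ++ c.tuples.flatMap (fun x => List.ofFn (fun j => (x j : ℕ)))

/-- The representation of the instance `(V, D, L)`: `|V|`, `|D|`, the number of constraints, the
constraints. -/
def encodeInstance (L : List (ExplicitConstraint n d r)) : List ℕ :=
  [n, d, L.length] ++ L.flatMap encode

end ExplicitConstraint

/-! ## Random access machines

A unit-cost random access machine on natural numbers with addition and truncated subtraction, but
without multiplication, as a structured programming language. The memory consists of
registers and of infinite arrays (a program refers to finitely many of either). The absence of
multiplication keeps the lengths of the numbers at most linear in the number of steps, so that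
polynomial time on this machine is polynomial time on Turing machines. -/

/-- Expressions: `get a e` is the cell of the array `a` whose address is the value of `e`. -/
inductive RamExpr : Type
  | const (v : ℕ) : RamExpr
  | reg (i : ℕ) : RamExpr
  | get (a : ℕ) (e : RamExpr) : RamExpr
  | add (e₁ e₂ : RamExpr) : RamExpr
  | sub (e₁ e₂ : RamExpr) : RamExpr

/-- Programs: `ite e p q` runs `p` if the value of `e` is nonzero and `q` otherwise; `loop e p`
runs `p` as long as the value of `e` is nonzero. -/
inductive RamProg : Type
  | skip : RamProg
  | assign (i : ℕ) (e : RamExpr) : RamProg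
  | store (a : ℕ) (addr e : RamExpr) : RamProg
  | seq (p q : RamProg) : RamProg
  | ite (e : RamExpr) (p q : RamProg) : RamProg
  | loop (e : RamExpr) (p : RamProg) : RamProg

/-- Memory contents: `mem a j` is the cell of address `j` of the array `a`. -/
structure RamState where
  reg : ℕ → ℕ
  mem : ℕ → ℕ → ℕ

namespace RamExpr

def eval (σ : RamState) : RamExpr → ℕ
  | const v => v
  | reg i => σ.reg i
  | get a e => σ.mem a (eval σ e)
  | add e₁ e₂ => eval σ e₁ + eval σ e₂
  | sub e₁ e₂ => eval σ e₁ - eval σ e₂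

/-- The number of steps of the evaluation: one for each node. -/
def cost : RamExpr → ℕ
  | const _ => 1
  | reg _ => 1
  | get _ e => cost e + 1
  | add e₁ e₂ => cost e₁ + cost e₂ + 1
  | sub e₁ e₂ => cost e₁ + cost e₂ + 1

end RamExpr

namespace RamState

def setReg (σ : RamState) (i v : ℕ) : RamState :=
  { σ with reg := Function.update σ.reg i v }

def setMem (σ : RamState) (a j v : ℕ) : RamState :=
  { σ with mem := Function.update σ.mem a (Function.update (σ.mem a) j v) }

/-- The initial state: the input is in array `0`, everything else is `0`. -/
def initial (x : List ℕ) : RamState where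
  reg := fun _ => 0
  mem := fun a j => if a = 0 then x.getD j 0 else 0

end RamState

namespace RamProg

/-- `Exec p σ t σ'`: started in the state `σ`, the program `p` halts after exactly `t` steps in
the state `σ'`. -/
inductive Exec : RamProg → RamState → ℕ → RamState → Prop
  | skip (σ : RamState) : Exec skip σ 1 σ
  | assign (i : ℕ) (e : RamExpr) (σ : RamState) :
      Exec (assign i e) σ (e.cost + 1) (σ.setReg i (e.eval σ))
  | store (a : ℕ) (addr e : RamExpr) (σ : RamState) :
      Exec (store a addr e) σ (addr.cost + e.cost + 1) (σ.setMem a (addr.eval σ) (e.eval σ))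
  | seq {p q : RamProg} {σ₁ σ₂ σ₃ : RamState} {t₁ t₂ : ℕ} :
      Exec p σ₁ t₁ σ₂ → Exec q σ₂ t₂ σ₃ → Exec (seq p q) σ₁ (t₁ + t₂) σ₃
  | ite_pos {e : RamExpr} {p q : RamProg} {σ₁ σ₂ : RamState} {t : ℕ} :
      e.eval σ₁ ≠ 0 → Exec p σ₁ t σ₂ → Exec (ite e p q) σ₁ (e.cost + 1 + t) σ₂
  | ite_zero {e : RamExpr} {p q : RamProg} {σ₁ σ₂ : RamState} {t : ℕ} :
      e.eval σ₁ = 0 → Exec q σ₁ t σ₂ → Exec (ite e p q) σ₁ (e.cost + 1 + t) σ₂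
  | loop_zero {e : RamExpr} {p : RamProg} {σ : RamState} :
      e.eval σ = 0 → Exec (loop e p) σ (e.cost + 1) σ
  | loop_pos {e : RamExpr} {p : RamProg} {σ₁ σ₂ σ₃ : RamState} {t₁ t₂ : ℕ} :
      e.eval σ₁ ≠ 0 → Exec p σ₁ t₁ σ₂ → Exec (loop e p) σ₂ t₂ σ₃ →
        Exec (loop e p) σ₁ (e.cost + 1 + t₁ + t₂) σ₃

/-- On the input `x`, the program `p` halts after exactly `t` steps with the output `y`, which is
read from array `1`. -/
def Computes (p : RamProg) (x y : List ℕ) (t : ℕ) : Prop :=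
  ∃ σ : RamState, Exec p (RamState.initial x) t σ ∧
    ∀ (i : ℕ) (hi : i < y.length), σ.mem 1 i = y[i]

end RamProg

/-! ## Time bounds and frame conditions for random access machines -/

namespace RamState

/-! Put `m = k - 1`. By the Baker–Pixley theorem (`IsNearUnanimity.mem_of_projections`) every
`R_{|s|}` is determined by its projections to `m` coordinates. Let `P_u` consist of the value tuples
for `u` that are compatible with each constraint `s`: some accepted word of length `|s|` carries
these values wherever a variable of `u` stands in `s`. Such a word may give different letters to two
occurrences of a variable outside `u`. This relaxation is harmless, since Baker–Pixley looks at `m`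
positions of `s` at a time (`AutCSPInstance.isSolution_iff_compatible`), and it makes membership in
`P_u` easy to test: a subset simulation of the automaton, restricted to admissible letters, takes
`O(|C||A|)` steps (`RamProg.runs_check`). Applying `g` letterwise to the witnessing words shows that
`g` preserves `P_u` (`AutCSPInstance.Compatible.apply`). At most `|C|^m` tuples of occurring
variables, `d^m` tuples of values and one test for each combination give the bound of (a).

For (b), start from all functional assignments to `m` variables that are compatible with every
constraint, and delete those that fail to extend to some further variable, until nothing changes.
What remains is the greatest strategy `H`. The restrictions of a solution form a strategy, so `H` is
nonempty if there are a solution and a variable. Conversely, `H` is closed under `g` because it is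
greatest (`ClosedUnder.greatest`), and near unanimity then extends a consistent partial assignment
by one variable after another (`ConsistentOn.extend`), so no search is needed. There are `(|V|d)^m`
assignments to inspect, which is polynomial for fixed `k`.

The programs are verified with a timed Hoare logic: `Runs p σ T Q` bounds the time and describes the
final state, and `Frame` supplies everything that the program does not write. -/

@[simp] theorem setReg_reg (σ : RamState) (i v r : ℕ) :
    (σ.setReg i v).reg r = if r = i then v else σ.reg r := by
  simp [setReg, Function.update_apply]

@[simp] theorem setReg_mem (σ : RamState) (i v : ℕ) : (σ.setReg i v).mem = σ.mem := rfl

@[simp] theorem setMem_reg (σ : RamState) (a j v : ℕ) : (σ.setMem a j v).reg = σ.reg := rfl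

@[simp] theorem setMem_mem (σ : RamState) (a j v b i : ℕ) :
    (σ.setMem a j v).mem b i = if b = a ∧ i = j then v else σ.mem b i := by
  by_cases h : b = a
  · subst h
    simp [setMem, Function.update_apply]
  · simp [setMem, h]

end RamState

attribute [simp] RamExpr.eval RamExpr.cost

namespace RamProg

/-- The register `r` is the target of an assignment in the program. -/
@[simp] def writesReg : RamProg → ℕ → Prop
  | skip, _ => False
  | assign i _, r => r = i
  | store _ _ _, _ => False
  | seq p q, r => p.writesReg r ∨ q.writesReg r
  | ite _ p q, r => p.writesReg r ∨ q.writesReg r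
  | loop _ p, r => p.writesReg r

/-- The array `a` is the target of a store in the program. -/
@[simp] def writesMem : RamProg → ℕ → Prop
  | skip, _ => False
  | assign _ _, _ => False
  | store b _ _, a => a = b
  | seq p q, a => p.writesMem a ∨ q.writesMem a
  | ite _ p q, a => p.writesMem a ∨ q.writesMem a
  | loop _ p, a => p.writesMem a

/-- The states differ at most in the registers and arrays that the program writes. -/
structure Frame (p : RamProg) (σ σ' : RamState) : Prop where
  reg : ∀ r, ¬ p.writesReg r → σ'.reg r = σ.reg r
  mem : ∀ a, ¬ p.writesMem a → σ'.mem a = σ.mem a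

theorem Frame.refl (p : RamProg) (σ : RamState) : Frame p σ σ := ⟨fun _ _ => rfl, fun _ _ => rfl⟩

theorem Frame.trans {p : RamProg} {σ₁ σ₂ σ₃ : RamState} (h : Frame p σ₁ σ₂) (h' : Frame p σ₂ σ₃) :
    Frame p σ₁ σ₃ :=
  ⟨fun r hr => (h'.reg r hr).trans (h.reg r hr), fun a ha => (h'.mem a ha).trans (h.mem a ha)⟩

theorem Frame.mono {p q : RamProg} {σ σ' : RamState} (h : Frame p σ σ')
    (hr : ∀ r, p.writesReg r → q.writesReg r) (hm : ∀ a, p.writesMem a → q.writesMem a) :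
    Frame q σ σ' :=
  ⟨fun r h' => h.reg r (mt (hr r) h'), fun a h' => h.mem a (mt (hm a) h')⟩

/-- A syntactic over-approximation of the changes is enough: every register and array has a fixed
role, so preservation of data becomes a decidable question about indices. -/
theorem Exec.frame {p : RamProg} {σ σ' : RamState} {t : ℕ} (h : Exec p σ t σ') :
    Frame p σ σ' := by
  induction h with
  | skip σ => exact .refl _ _
  | assign i e σ => exact ⟨fun r hr => by simp_all, fun _ _ => rfl⟩
  | store a addr e σ => exact ⟨fun _ _ => rfl, fun b hb => by funext j; simp_all⟩
  | seq _ _ ih₁ ih₂ =>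
    exact (ih₁.mono (fun _ => Or.inl) fun _ => Or.inl).trans
      (ih₂.mono (fun _ => Or.inr) fun _ => Or.inr)
  | ite_pos _ _ ih => exact ih.mono (fun _ => Or.inl) fun _ => Or.inl
  | ite_zero _ _ ih => exact ih.mono (fun _ => Or.inr) fun _ => Or.inr
  | loop_zero _ => exact .refl _ _
  | loop_pos _ _ _ ih₁ ih₂ =>
    exact Frame.trans (ih₁.mono (fun _ h => h) fun _ h => h) ih₂

/-- Started in `σ`, the program halts within `T` steps in a state with the property `Q`. -/
def Runs (p : RamProg) (σ : RamState) (T : ℕ) (Q : RamState → Prop) : Prop :=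
  ∃ t σ', Exec p σ t σ' ∧ t ≤ T ∧ Q σ'

/-- The consequence rule. The frame is handed to the new postcondition, so specifications need to
mention only what a program changes. -/
theorem Runs.weaken {p : RamProg} {σ : RamState} {T T' : ℕ} {Q Q' : RamState → Prop}
    (h : Runs p σ T Q) (hT : T ≤ T') (hQ : ∀ σ', Frame p σ σ' → Q σ' → Q' σ') :
    Runs p σ T' Q' := by
  obtain ⟨t, σ', h₁, h₂, h₃⟩ := h
  exact ⟨t, σ', h₁, h₂.trans hT, hQ σ' h₁.frame h₃⟩

theorem Runs.skip {σ : RamState} {T : ℕ} {Q : RamState → Prop} (hT : 1 ≤ T) (h : Q σ) :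
    Runs skip σ T Q :=
  ⟨_, _, .skip _, hT, h⟩

theorem Runs.assign {i : ℕ} {e : RamExpr} {σ : RamState} {T : ℕ} {Q : RamState → Prop}
    (hT : e.cost + 1 ≤ T) (h : Q (σ.setReg i (e.eval σ))) : Runs (assign i e) σ T Q :=
  ⟨_, _, .assign _ _ _, hT, h⟩

theorem Runs.store {a : ℕ} {e f : RamExpr} {σ : RamState} {T : ℕ} {Q : RamState → Prop}
    (hT : e.cost + f.cost + 1 ≤ T) (h : Q (σ.setMem a (e.eval σ) (f.eval σ))) :
    Runs (store a e f) σ T Q :=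
  ⟨_, _, .store _ _ _ _, hT, h⟩

theorem Runs.seq {p q : RamProg} {σ : RamState} {T₁ T₂ : ℕ} {Q₁ Q₂ : RamState → Prop}
    (h₁ : Runs p σ T₁ Q₁) (h₂ : ∀ σ', Frame p σ σ' → Q₁ σ' → Runs q σ' T₂ Q₂) :
    Runs (seq p q) σ (T₁ + T₂) Q₂ := by
  obtain ⟨t, σ', h, ht, hQ⟩ := h₁
  obtain ⟨t', σ'', h', ht', hQ'⟩ := h₂ σ' h.frame hQ
  exact ⟨_, _, .seq h h', by omega, hQ'⟩

theorem Runs.ite {e : RamExpr} {p q : RamProg} {σ : RamState} {T : ℕ} {Q : RamState → Prop}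
    (h₁ : e.eval σ ≠ 0 → Runs p σ T Q) (h₂ : e.eval σ = 0 → Runs q σ T Q) :
    Runs (ite e p q) σ (e.cost + 1 + T) Q := by
  by_cases he : e.eval σ = 0
  · obtain ⟨t, σ', h, ht, hQ⟩ := h₂ he
    exact ⟨_, _, .ite_zero he h, by omega, hQ⟩
  · obtain ⟨t, σ', h, ht, hQ⟩ := h₁ he
    exact ⟨_, _, .ite_pos he h, by omega, hQ⟩

/-- A loop whose body decreases a measure or makes the condition false. -/
theorem Runs.loop {e : RamExpr} {p : RamProg} {T : ℕ} (Inv : RamState → Prop) (μ : RamState → ℕ)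
    (step : ∀ σ, Inv σ → e.eval σ ≠ 0 →
      Runs p σ T fun σ' => Inv σ' ∧ (e.eval σ' = 0 ∨ μ σ' < μ σ))
    (σ : RamState) (h : Inv σ) :
    Runs (loop e p) σ ((μ σ + 1) * (e.cost + 1 + T) + (e.cost + 1))
      fun σ' => Inv σ' ∧ e.eval σ' = 0 := by
  have halted : ∀ σ, Inv σ → e.eval σ = 0 → ∀ n, e.cost + 1 ≤ n →
      Runs (RamProg.loop e p) σ n fun σ' => Inv σ' ∧ e.eval σ' = 0 := fun σ h he n hn =>
    ⟨_, _, .loop_zero he, hn, h, he⟩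
  induction hn : μ σ using Nat.strong_induction_on generalizing σ with
  | _ n ih =>
    by_cases he : e.eval σ = 0
    · exact halted σ h he _ (by omega)
    · obtain ⟨t, σ', h₁, ht, hI, h'⟩ := step σ h he
      -- After this pass either the condition is false or at most `n` passes remain. The pass that
      -- ends the loop need not decrease the measure, hence the `μ σ + 1` passes in the bound.
      have : Runs (RamProg.loop e p) σ' (n * (e.cost + 1 + T) + (e.cost + 1))
          fun σ' => Inv σ' ∧ e.eval σ' = 0 := by
        rcases h' with h' | h'
        · exact halted σ' hI h' _ (by omega)
        · refine (ih _ (by omega) σ' hI rfl).weaken ?_ fun _ _ => id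
          have : (μ σ' + 1) * (e.cost + 1 + T) ≤ n * (e.cost + 1 + T) :=
            Nat.mul_le_mul_right _ (by omega)
          omega
      obtain ⟨t', σ'', h₂, ht', hQ⟩ := this
      refine ⟨_, _, .loop_pos he h₁ h₂, ?_, hQ⟩
      rw [Nat.add_mul, Nat.one_mul]
      omega

/-! ### Programs without loops -/

@[simp] def LoopFree : RamProg → Prop
  | skip => True
  | assign _ _ => True
  | store _ _ _ => True
  | seq p q => p.LoopFree ∧ q.LoopFree
  | ite _ p q => p.LoopFree ∧ q.LoopFree
  | loop _ _ => False

/-- The final state of a program without loops. -/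
@[simp] def final : RamProg → RamState → RamState
  | skip, σ => σ
  | assign i e, σ => σ.setReg i (e.eval σ)
  | store a e f, σ => σ.setMem a (e.eval σ) (f.eval σ)
  | seq p q, σ => q.final (p.final σ)
  | ite e p q, σ => if e.eval σ = 0 then q.final σ else p.final σ
  | loop _ _, σ => σ

/-- A bound for the number of steps of a program without loops. -/
@[simp] def maxCost : RamProg → ℕ
  | skip => 1
  | assign _ e => e.cost + 1
  | store _ e f => e.cost + f.cost + 1
  | seq p q => p.maxCost + q.maxCost
  | ite e p q => e.cost + 1 + (p.maxCost + q.maxCost)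
  | loop _ _ => 0

theorem LoopFree.runs_final {p : RamProg} (hp : p.LoopFree) (σ : RamState) :
    Runs p σ p.maxCost (· = p.final σ) := by
  induction p generalizing σ with
  | skip => exact .skip le_rfl rfl
  | assign i e => exact .assign le_rfl rfl
  | store a e f => exact .store le_rfl rfl
  | seq p q ihp ihq =>
    refine (ihp hp.1 σ).seq ?_
    rintro _ - rfl
    exact ihq hp.2 _
  | ite e p q ihp ihq =>
    refine .ite (fun h => ?_) fun h => ?_
    · exact (ihp hp.1 σ).weaken (Nat.le_add_right _ _) fun _ _ h' => by simp [h, h']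
    · exact (ihq hp.2 σ).weaken (Nat.le_add_left _ _) fun _ _ h' => by simp [h, h']
  | loop e p => exact hp.elim

/-- Straight-line code is verified by symbolic execution: `simp` evaluates `final` and `maxCost`. -/
theorem LoopFree.runs {p : RamProg} (hp : p.LoopFree) {σ : RamState} {T : ℕ}
    {Q : RamState → Prop} (hT : p.maxCost ≤ T) (h : Q (p.final σ)) : Runs p σ T Q :=
  (hp.runs_final σ).weaken hT fun _ _ e => e ▸ h

/-! ### Counting loops -/

/-- For `i = 0, …, b - 1` the body is run, where `b` is the content of a register. -/
def forLoop (i b : ℕ) (body : RamProg) : RamProg :=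
  seq (assign i (.const 0))
    (loop (.sub (.reg b) (.reg i)) (seq body (assign i (.add (.reg i) (.const 1)))))

@[simp] theorem forLoop_writesReg (i b : ℕ) (body : RamProg) (r : ℕ) :
    (forLoop i b body).writesReg r ↔ r = i ∨ body.writesReg r := by
  simp only [forLoop, writesReg]; tauto

@[simp] theorem forLoop_writesMem (i b : ℕ) (body : RamProg) (a : ℕ) :
    (forLoop i b body).writesMem a ↔ body.writesMem a := by
  simp [forLoop]

/-- The time of the body may depend on the index, so that constraints of different lengths can be
summed up. A pass pays 4 steps for the test and 4 for the increment; the initialization and the last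
test make 6. The invariant has to ignore the counter, because the increment comes after the body has
established it. -/
theorem Runs.forLoop_sum {i b B : ℕ} {T : ℕ → ℕ} {body : RamProg} (Inv : ℕ → RamState → Prop)
    {σ : RamState} (hib : i ≠ b) (hi : ¬ body.writesReg i) (hb : ¬ body.writesReg b)
    (hB : σ.reg b = B) (hinv : ∀ j τ v, Inv j τ → Inv j (τ.setReg i v)) (h0 : Inv 0 σ)
    (step : ∀ j < B, ∀ τ, Frame (forLoop i b body) σ τ → τ.reg i = j → Inv j τ →
      Runs body τ (T j) (Inv (j + 1))) :
    Runs (forLoop i b body) σ ((∑ j ∈ Finset.range B, (T j + 8)) + 6) (Inv B) := by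
  -- Induction on the number `n` of passes still to be made.
  have key : ∀ n j τ, j + n = B → Frame (forLoop i b body) σ τ → τ.reg i = j → Inv j τ →
      Runs (RamProg.loop (.sub (.reg b) (.reg i))
        (RamProg.seq body (RamProg.assign i (.add (.reg i) (.const 1)))))
        τ ((∑ l ∈ Finset.Ico j B, (T l + 8)) + 4) (Inv B) := by
    intro n
    induction n with
    | zero =>
      intro j τ hj hF hτ hI
      have : τ.reg b = B := by rw [hF.reg b (by simp [hib.symm, hb]), hB]
      obtain rfl : j = B := by omega
      exact ⟨_, _, .loop_zero (by simp [this, hτ]), by simp, hI⟩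
    | succ n ih =>
      intro j τ hj hF hτ hI
      have hτb : τ.reg b = B := by rw [hF.reg b (by simp [hib.symm, hb]), hB]
      obtain ⟨t, τ', h₁, ht, hI'⟩ := step j (by omega) τ hF hτ hI
      have hi' : τ'.reg i = j := by rw [h₁.frame.reg i hi, hτ]
      have h₂ : Exec (RamProg.assign i (.add (.reg i) (.const 1))) τ' 4 (τ'.setReg i (j + 1)) := by
        have := Exec.assign i (.add (.reg i) (.const 1)) τ'
        simpa [hi'] using this
      have hF' : Frame (forLoop i b body) σ (τ'.setReg i (j + 1)) := by
        refine hF.trans ((h₁.seq h₂).frame.mono ?_ ?_)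
        · intro r; simp only [writesReg, forLoop_writesReg]; tauto
        · intro r; simp
      obtain ⟨t', τ'', h₃, ht', hQ⟩ := ih (j + 1) (τ'.setReg i (j + 1)) (by omega) hF' (by simp)
        (hinv _ _ _ hI')
      refine ⟨_, _, .loop_pos (by simp [hτb, hτ]; omega) (h₁.seq h₂) h₃, ?_, hQ⟩
      rw [Finset.sum_eq_sum_Ico_succ_bot (by omega)]
      simp only [RamExpr.cost]
      omega
  have h₁ : Runs (RamProg.assign i (.const 0)) σ 2 (· = σ.setReg i 0) := .assign (by simp) rfl
  have := h₁.seq (T₂ := (∑ l ∈ Finset.Ico 0 B, (T l + 8)) + 4) (Q₂ := Inv B)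
    (q := RamProg.loop (.sub (.reg b) (.reg i))
      (RamProg.seq body (RamProg.assign i (.add (.reg i) (.const 1)))))
    (by
      rintro τ hF rfl
      exact key B 0 _ (by omega) (hF.mono (by simp) (by simp)) (by simp) (hinv _ _ _ h0))
  refine Runs.weaken (p := forLoop i b body) this ?_ fun _ _ => id
  simp only [Nat.Ico_zero_eq_range]
  omega

theorem Runs.forLoop {i b B T : ℕ} {body : RamProg} (Inv : ℕ → RamState → Prop)
    {σ : RamState} (hib : i ≠ b) (hi : ¬ body.writesReg i) (hb : ¬ body.writesReg b)
    (hB : σ.reg b = B) (hinv : ∀ j τ v, Inv j τ → Inv j (τ.setReg i v)) (h0 : Inv 0 σ)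
    (step : ∀ j < B, ∀ τ, Frame (forLoop i b body) σ τ → τ.reg i = j → Inv j τ →
      Runs body τ T (Inv (j + 1))) :
    Runs (forLoop i b body) σ (B * (T + 8) + 6) (Inv B) := by
  have := Runs.forLoop_sum (T := fun _ => T) Inv hib hi hb hB hinv h0 step
  simpa using this

/-! ### Nested counting loops -/

/-- The loops of the registers `r, …, r + m - 1`, each from `0` to the content of the register `b`,
the first of them innermost. -/
def nestLoop (r b : ℕ) (body : RamProg) : ℕ → RamProg
  | 0 => body
  | m + 1 => forLoop (r + m) b (nestLoop r b body m)

theorem nestLoop_writesReg (r b : ℕ) (body : RamProg) (m s : ℕ) :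
    (nestLoop r b body m).writesReg s ↔ (r ≤ s ∧ s < r + m) ∨ body.writesReg s := by
  induction m with
  | zero => simp only [nestLoop]; constructor
            · exact Or.inr
            · rintro (h | h)
              · omega
              · exact h
  | succ m ih =>
    simp only [nestLoop, forLoop_writesReg, ih, ← or_assoc]
    apply or_congr_left
    omega

theorem nestLoop_writesMem (r b : ℕ) (body : RamProg) (m a : ℕ) :
    (nestLoop r b body m).writesMem a ↔ body.writesMem a := by
  induction m with
  | zero => simp [nestLoop]
  | succ m ih => simp [nestLoop, ih]

/-- The time bound of a nest of `m` loops. -/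
def nestCost (B T : ℕ) : ℕ → ℕ
  | 0 => T
  | m + 1 => B * (nestCost B T m + 8) + 6

/-- For `B ≥ 1` the overhead `8 * B + 6` of a level is at most `14 * B`. -/
theorem nestCost_le (B T m : ℕ) (hB : 1 ≤ B) : nestCost B T m ≤ B ^ m * (T + 14 * m) := by
  induction m with
  | zero => simp [nestCost]
  | succ m ih =>
    have h1 : 1 ≤ B ^ m := Nat.one_le_pow _ _ hB
    have h2 : nestCost B T m + 14 ≤ B ^ m * (T + 14 * (m + 1)) := by
      nlinarith
    calc nestCost B T (m + 1) ≤ B * (nestCost B T m + 14) := by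
          rw [nestCost]; nlinarith
      _ ≤ B * (B ^ m * (T + 14 * (m + 1))) := Nat.mul_le_mul_left _ h2
      _ = _ := by ring

/-- The number with the digits `x 0, …, x (m - 1)` in base `B`, the first of them lowest. -/
def digitSum (B m : ℕ) (x : ℕ → ℕ) : ℕ := ∑ i ∈ Finset.range m, x i * B ^ i

theorem digitSum_succ (B m : ℕ) (x : ℕ → ℕ) :
    digitSum B (m + 1) x = digitSum B m x + x m * B ^ m := Finset.sum_range_succ _ _

/-- The invariant is indexed by the number of tuples already processed, which is the value of the
counters read as digits in base `B`. A nest can thus be used like a single loop of length `B ^ m`.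
-/
theorem Runs.nestLoop {r b B T : ℕ} {body : RamProg} {m : ℕ} (Inv : ℕ → RamState → Prop)
    {σ : RamState} (hbr : b < r ∨ r + m ≤ b) (hr : ∀ s, r ≤ s → s < r + m → ¬ body.writesReg s)
    (hb : ¬ body.writesReg b) (hB : σ.reg b = B)
    (hinv : ∀ j τ s v, r ≤ s → s < r + m → Inv j τ → Inv j (τ.setReg s v)) (h0 : Inv 0 σ)
    (step : ∀ x : ℕ → ℕ, (∀ i < m, x i < B) → ∀ τ, Frame (nestLoop r b body m) σ τ →
      (∀ i < m, τ.reg (r + i) = x i) → Inv (digitSum B m x) τ →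
      Runs body τ T (Inv (digitSum B m x + 1))) :
    Runs (nestLoop r b body m) σ (nestCost B T m) (Inv (B ^ m)) := by
  induction m generalizing σ Inv with
  | zero =>
    refine (step (fun _ => 0) (by simp) σ (.refl _ _) (by simp)
      (by simpa [digitSum] using h0)).weaken le_rfl ?_
    intro τ _ h
    simpa [digitSum] using h
  | succ m ih =>
    have hm : ¬ (RamProg.nestLoop r b body m).writesReg (r + m) := by
      rw [nestLoop_writesReg]
      rintro (h | h)
      exacts [by omega, hr (r + m) (by omega) (by omega) h]
    have := Runs.forLoop (i := r + m) (b := b) (B := B) (T := nestCost B T m)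
      (body := RamProg.nestLoop r b body m) (fun j => Inv (j * B ^ m)) (σ := σ)
      (by omega) hm (by rw [nestLoop_writesReg]; rintro (h | h); exacts [by omega, hb h]) hB
      (fun j τ v => hinv _ τ _ v (by omega) (by omega)) (by simpa using h0) ?_
    · refine this.weaken le_rfl ?_
      intro τ _ h
      rwa [pow_succ, mul_comm]
    intro j hj τ hF hτ hI
    have hτb : τ.reg b = B := by
      rw [← hB]; apply hF.reg; rw [forLoop_writesReg, nestLoop_writesReg]
      rintro (h | h | h)
      exacts [by omega, by omega, hb h]
    -- The inner nest sees the invariant shifted by the contribution of the outermost counter, which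
    -- is the leading digit.
    have := ih (σ := τ) (fun l => Inv (j * B ^ m + l)) (by omega)
      (fun s h h' => hr s h (by omega)) hτb
      (fun l τ s v h h' => hinv _ τ s v h (by omega)) (by simpa using hI) ?_
    · refine this.weaken le_rfl ?_
      intro τ' _ h
      rwa [Nat.add_mul, one_mul]
    intro x hx τ' hF' hx' hI'
    have hreg : τ'.reg (r + m) = j := by
      rw [← hτ]; exact hF'.reg _ hm
    have e : digitSum B (m + 1) (Function.update x m j) = j * B ^ m + digitSum B m x := by
      rw [digitSum_succ, add_comm, Function.update_self, digitSum, digitSum]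
      congr 1
      refine Finset.sum_congr rfl fun i hi => ?_
      rw [Function.update_of_ne (by simp at hi; omega)]
    have hs := step (Function.update x m j) ?_ τ' ?_ ?_ (by rw [e]; exact hI')
    · rw [e] at hs
      exact hs
    · intro i hi
      rcases eq_or_ne i m with rfl | h
      · simpa
      · rw [Function.update_of_ne h]; exact hx i (by omega)
    · refine hF.trans (hF'.mono ?_ ?_)
      · intro s h; exact (forLoop_writesReg _ _ _ _).2 (.inr h)
      · intro s h; exact (forLoop_writesMem _ _ _ _).2 h
    · intro i hi
      rcases eq_or_ne i m with rfl | h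
      · simpa
      · rw [Function.update_of_ne h]; exact hx' i (by omega)

end RamProg

/-! ### Expressions -/

namespace RamExpr

/-- Nonzero if and only if the values are distinct. -/
def ne (a b : RamExpr) : RamExpr := .add (.sub a b) (.sub b a)

@[simp] theorem ne_eval_eq_zero (a b : RamExpr) (σ : RamState) :
    (ne a b).eval σ = 0 ↔ a.eval σ = b.eval σ := by
  simp only [ne, eval]; omega

/-- Zero if and only if `a = b` implies `c = d`. -/
def imp (a b c d : RamExpr) : RamExpr := .sub (.sub (.const 1) (ne a b)) (.sub (.const 1) (ne c d))

@[simp] theorem imp_eval_eq_zero (a b c d : RamExpr) (σ : RamState) :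
    (imp a b c d).eval σ = 0 ↔ (a.eval σ = b.eval σ → c.eval σ = d.eval σ) := by
  simp only [imp, ne, eval]; omega

/-- The sum of `m` expressions. -/
def sum (f : ℕ → RamExpr) : ℕ → RamExpr
  | 0 => .const 0
  | m + 1 => .add (sum f m) (f m)

theorem sum_eval (f : ℕ → RamExpr) (m : ℕ) (σ : RamState) :
    (sum f m).eval σ = ∑ i ∈ Finset.range m, (f i).eval σ := by
  induction m with
  | zero => simp [sum]
  | succ m ih => simp [sum, ih, Finset.sum_range_succ]

theorem sum_eval_eq_zero (f : ℕ → RamExpr) (m : ℕ) (σ : RamState) :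
    (sum f m).eval σ = 0 ↔ ∀ i < m, (f i).eval σ = 0 := by
  simp [sum_eval]

end RamExpr

/-! ### Lists in arrays -/

/-- The list `l` is stored in `f` from the address `p` on. -/
def Holds (f : ℕ → ℕ) : ℕ → List ℕ → Prop
  | _, [] => True
  | p, x :: l => f p = x ∧ Holds f (p + 1) l

@[simp] theorem holds_nil (f : ℕ → ℕ) (p : ℕ) : Holds f p [] ↔ True := Iff.rfl

@[simp] theorem holds_cons (f : ℕ → ℕ) (p x : ℕ) (l : List ℕ) :
    Holds f p (x :: l) ↔ f p = x ∧ Holds f (p + 1) l := Iff.rfl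

@[simp] theorem holds_append (f : ℕ → ℕ) (p : ℕ) (l l' : List ℕ) :
    Holds f p (l ++ l') ↔ Holds f p l ∧ Holds f (p + l.length) l' := by
  induction l generalizing p with
  | nil => simp
  | cons x l ih =>
    rw [List.cons_append, holds_cons, ih, holds_cons, List.length_cons, and_assoc, add_right_comm p 1,
      add_assoc]

theorem holds_iff_getElem (f : ℕ → ℕ) (p : ℕ) (l : List ℕ) :
    Holds f p l ↔ ∀ (i : ℕ) (hi : i < l.length), f (p + i) = l[i] := by
  induction l generalizing p with
  | nil => simp
  | cons x l ih =>
    rw [holds_cons, ih]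
    constructor
    · rintro ⟨h, h'⟩ (_ | i) hi
      · simpa using h
      · simpa [add_assoc, add_comm 1] using h' i (by simpa using hi)
    · intro h
      exact ⟨h 0 (Nat.succ_pos _), fun i hi => by
        have := h (i + 1) (Nat.succ_lt_succ hi)
        rw [List.getElem_cons_succ] at this
        rw [← this]
        congr 1
        omega⟩

theorem Holds.congr {f f' : ℕ → ℕ} {p : ℕ} {l : List ℕ} (h : Holds f p l)
    (hf : ∀ j, p ≤ j → j < p + l.length → f' j = f j) : Holds f' p l := by
  rw [holds_iff_getElem] at h ⊢
  intro i hi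
  rw [hf _ (by omega) (by omega), h i hi]

/-- Records of constant length `c` allow random access. -/
theorem Holds.getElem_flatMap {α : Type*} {f : ℕ → ℕ} {p c : ℕ} {l : List α} {e : α → List ℕ}
    (he : ∀ a, (e a).length = c) (h : Holds f p (l.flatMap e)) (i : ℕ) (hi : i < l.length) :
    Holds f (p + c * i) (e l[i]) := by
  induction l generalizing p i with
  | nil => simp at hi
  | cons a l ih =>
    rw [List.flatMap_cons, holds_append, he] at h
    cases i with
    | zero => simpa using h.1
    | succ i =>
      have := ih h.2 i (by simpa using hi)
      simpa [Nat.mul_add, add_assoc, add_comm, add_left_comm] using this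

/-! ## Near-unanimity operations -/

section NearUnanimity

variable {D : Type*} {k : ℕ} {g : (Fin k → D) → D}

/-- With at most one dissenting argument, `x` is a constant tuple updated at one position. If nobody
dissents, any position serves, and `1 ≤ k` provides one. -/
theorem IsNearUnanimity.apply_eq (hg : IsNearUnanimity g) (hk : 1 ≤ k) {x : Fin k → D} {y : D}
    (h : ∀ i i', x i ≠ y → x i' ≠ y → i = i') : g x = y := by
  obtain ⟨i, hi⟩ : ∃ i, ∀ i', i' ≠ i → x i' = y := by
    by_cases h' : ∃ i, x i ≠ y
    · obtain ⟨i, hi⟩ := h'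
      exact ⟨i, fun i' hne => by_contra fun hi' => hne (h _ _ hi' hi)⟩
    · push Not at h'
      exact ⟨⟨0, hk⟩, fun i' _ => h' i'⟩
  have : x = Function.update (fun _ => y) i (x i) := by
    funext i'
    by_cases hii : i' = i
    · subst hii; simp
    · simp [hii, hi i' hii]
  rw [this]
  exact hg i _ y

/-- Repetitions are allowed; the arbitrary element only pads the enumeration when `S` has fewer than
`p` elements. -/
theorem exists_fin_enumeration {α : Type*} [Nonempty α] (S : Finset α) {p : ℕ} (h : S.card ≤ p) :
    ∃ J : Fin p → α, ∀ x ∈ S, ∃ i, J i = x := by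
  refine ⟨fun i => S.toList.getD i (Classical.arbitrary α), fun x hx => ?_⟩
  obtain ⟨i, hi, hx'⟩ := List.getElem_of_mem (Finset.mem_toList.2 hx)
  have : i < p := by simp at hi; omega
  exact ⟨⟨i, this⟩, (List.getD_eq_getElem _ _ hi).trans hx'⟩

theorem exists_fin_injection {α : Type*} (S : Finset α) {p : ℕ} (h : p ≤ S.card) :
    ∃ w : Fin p → α, Function.Injective w ∧ ∀ i, w i ∈ S :=
  ⟨fun i => S.equivFin.symm (Fin.castLE h i),
    fun i j hij => by simpa [Subtype.ext_iff] using hij, fun i => by simp⟩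

/-- The Baker–Pixley theorem: a relation with a `k`-ary near-unanimity polymorphism is determined by
its projections to `k - 1` coordinates. -/
theorem IsNearUnanimity.mem_of_projections (hg : IsNearUnanimity g) (hk : 1 ≤ k) {m : ℕ}
    (hm : 0 < m) {R : Set (Fin m → D)} (hR : IsPolymorphism g R) (r : Fin m → D)
    (h : ∀ J : Fin (k - 1) → Fin m, ∃ r' ∈ R, ∀ i, r' (J i) = r (J i)) : r ∈ R := by
  have key : ∀ (n : ℕ) (S : Finset (Fin m)), S.card = n → ∃ r' ∈ R, ∀ j ∈ S, r' j = r j := by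
    intro n
    induction n with
    | zero =>
      intro S hS
      have : Nonempty (Fin m) := ⟨⟨0, hm⟩⟩
      -- Even for no coordinates a member of `R` is needed; any projection supplies one.
      obtain ⟨r', hr', -⟩ := h fun _ => ⟨0, hm⟩
      exact ⟨r', hr', by simp [Finset.card_eq_zero.1 hS]⟩
    | succ n ih =>
      intro S hS
      by_cases hn : S.card ≤ k - 1
      · have : Nonempty (Fin m) := ⟨⟨0, hm⟩⟩
        obtain ⟨J, hJ⟩ := exists_fin_enumeration S hn
        obtain ⟨r', hr', h'⟩ := h J
        refine ⟨r', hr', fun j hj => ?_⟩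
        obtain ⟨i, rfl⟩ := hJ j hj
        exact h' i
      -- Omit `k` distinct coordinates one at a time. At a coordinate `j` of `S` only the `y i` with
      -- `w i = j` can be wrong, and there is at most one such `i`, so `g` outvotes it.
      · obtain ⟨w, hw, hwS⟩ := exists_fin_injection S (p := k) (by omega)
        choose y hy hy' using fun i => ih (S.erase (w i)) (by
          rw [Finset.card_erase_of_mem (hwS i)]; omega)
        refine ⟨_, hR y hy, fun j hj => hg.apply_eq hk fun i i' hi hi' => hw ?_⟩
        have : ∀ i, y i j ≠ r j → j = w i := fun i hi => by
          by_contra hne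
          exact hi (hy' i j (Finset.mem_erase.2 ⟨hne, hj⟩))
        rw [← this i hi, ← this i' hi']
  obtain ⟨r', hr', h'⟩ := key _ Finset.univ rfl
  rwa [← funext fun j => h' j (Finset.mem_univ j)]

/-! ### Consistency -/

variable {V : Type*} {m : ℕ}

/-- A set `H` of assignments to tuples of `m` variables, contained in `B`, such that each element
of `H` can be extended to every further variable. -/
def IsStrategy (B H : Set (Fin m → V × D)) : Prop :=
  H ⊆ B ∧ ∀ x ∈ H, ∀ v, ∃ a, ∀ J : Fin m → Fin (m + 1),
    (fun i => Fin.snoc (α := fun _ => V × D) x (v, a) (J i)) ∈ H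

/-- The set is closed under `g`, applied to assignments to the same variables. -/
def ClosedUnder (g : (Fin k → D) → D) (B : Set (Fin m → V × D)) : Prop :=
  ∀ (u : Fin m → V) (y : Fin k → Fin m → D), (∀ i, (fun j => (u j, y i j)) ∈ B) →
    (fun j => (u j, g fun i => y i j)) ∈ B

theorem snoc_prodMk (u : Fin m → V) (t : Fin m → D) (v : V) (a : D) (q : Fin (m + 1)) :
    Fin.snoc (α := fun _ => V × D) (fun j => (u j, t j)) (v, a) q =
      (Fin.snoc (α := fun _ => V) u v q, Fin.snoc (α := fun _ => D) t a q) := by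
  refine Fin.lastCases ?_ (fun l => ?_) q <;> simp

theorem snoc_comp (ψ : V → D) (u : Fin m → V) (v : V) (q : Fin (m + 1)) :
    Fin.snoc (α := fun _ => D) (fun j => ψ (u j)) (ψ v) q =
      ψ (Fin.snoc (α := fun _ => V) u v q) := by
  refine Fin.lastCases ?_ (fun l => ?_) q <;> simp

theorem snoc_apply (g : (Fin k → D) → D) (y : Fin k → Fin m → D) (a : Fin k → D)
    (q : Fin (m + 1)) :
    Fin.snoc (α := fun _ => D) (fun j => g fun i => y i j) (g a) q =
      g fun i => Fin.snoc (α := fun _ => D) (y i) (a i) q := by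
  refine Fin.lastCases ?_ (fun l => ?_) q <;> simp

/-- The images under `g` of elements of `H` with common variables form a strategy themselves: if the
arguments extend to `v` by the values `a i`, their image extends by `g a`. Since `H` is greatest, it
contains them. -/
theorem ClosedUnder.greatest {B H : Set (Fin m → V × D)} (hB : ClosedUnder g B)
    (hH : IsStrategy B H) (hmax : ∀ H', IsStrategy B H' → H' ⊆ H) : ClosedUnder g H := by
  intro u y hy
  refine hmax {x | ∃ (u : Fin m → V) (y : Fin k → Fin m → D), (∀ i, (fun j => (u j, y i j)) ∈ H) ∧
    x = fun j => (u j, g fun i => y i j)} ⟨?_, ?_⟩ ⟨u, y, hy, rfl⟩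
  · rintro _ ⟨u, y, hy, rfl⟩
    exact hB u y fun i => hH.1 (hy i)
  · rintro _ ⟨u, y, hy, rfl⟩ v
    choose a ha using fun i => hH.2 _ (hy i) v
    refine ⟨g a, fun J => ⟨fun j => Fin.snoc (α := fun _ => V) u v (J j),
      fun i j => Fin.snoc (α := fun _ => D) (y i) (a i) (J j), fun i => ?_, ?_⟩⟩
    · simpa only [snoc_prodMk] using ha i J
    · funext j
      rw [snoc_prodMk, snoc_apply]

/-- All restrictions of `f` to tuples of variables in `W` belong to `H`. -/
def ConsistentOn (H : Set (Fin m → V × D)) (W : Finset V) (f : V → D) : Prop :=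
  ∀ u : Fin m → V, (∀ i, u i ∈ W) → (fun i => (u i, f (u i))) ∈ H

/-- Induction on the size of `W`. A small `W` fits into one tuple, which `H` extends to `v`.
Otherwise leave out each of `k` elements `w i` of `W` in turn, take the values `a i` for `v` that
the induction provides, and let `g a` be the value: the dependence on the omitted elements is
removed by near unanimity. The extra condition on `W` ensures that there is an `m`-tuple of
variables in `W`. -/
theorem ConsistentOn.extend [DecidableEq V] (hg : IsNearUnanimity g) (hk : k = m + 1)
    {B H : Set (Fin m → V × D)} (hH : IsStrategy B H) (hcl : ClosedUnder g H) (f : V → D) (v : V) :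
    ∀ (n : ℕ) (W : Finset V), W.card = n → v ∉ W → (W.Nonempty ∨ m = 0) → ConsistentOn H W f →
      ∃ a, ConsistentOn H (insert v W) (Function.update f v a) := by
  intro n
  induction n using Nat.strong_induction_on with
  | _ n ih =>
    intro W hW hv hne hf
    by_cases hn : W.card ≤ m
    · obtain ⟨u, huW, hu⟩ : ∃ u : Fin m → V, (∀ i, u i ∈ W) ∧ ∀ x ∈ W, ∃ i, u i = x := by
        rcases hne with ⟨w, hw⟩ | rfl
        · have : Nonempty W := ⟨⟨w, hw⟩⟩
          obtain ⟨J, hJ⟩ := exists_fin_enumeration (Finset.univ : Finset W) (p := m) (by simpa)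
          refine ⟨fun i => J i, fun i => (J i).2, fun x hx => ?_⟩
          obtain ⟨i, hi⟩ := hJ ⟨x, hx⟩ (Finset.mem_univ _)
          exact ⟨i, congrArg Subtype.val hi⟩
        · have : W = ∅ := Finset.card_eq_zero.1 (by omega)
          exact ⟨Fin.elim0, fun i => i.elim0, by simp [this]⟩
      obtain ⟨a, ha⟩ := hH.2 _ (hf u huW) v
      refine ⟨a, fun u' hu' => ?_⟩
      have : ∀ i, ∃ j : Fin (m + 1),
          Fin.snoc (α := fun _ => V × D) (fun i => (u i, f (u i))) (v, a) j =
            (u' i, Function.update f v a (u' i)) := by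
        intro i
        by_cases h : u' i = v
        · exact ⟨Fin.last m, by simp [h]⟩
        · obtain ⟨j, hj⟩ := hu (u' i) (Finset.mem_of_mem_insert_of_ne (hu' i) h)
          exact ⟨j.castSucc, by simp [h, hj]⟩
      -- Every tuple over `insert v W` is a selection from the extended enumeration of `W`; this is
      -- why strategies require all selections `J`, with repetitions, to stay in `H`.
      choose J hJ using this
      have := ha J
      simpa only [hJ] using this
    · obtain ⟨w, hw, hwW⟩ := exists_fin_injection W (p := k) (by omega)
      have hc : ∀ i, (W.erase (w i)).card = n - 1 := fun i => by
        rw [Finset.card_erase_of_mem (hwW i), hW]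
      choose a ha using fun i => ih (n - 1) (by omega) (W.erase (w i)) (hc i)
        (fun h => hv (Finset.mem_of_mem_erase h))
        (by
          rcases Nat.eq_zero_or_pos m with h | h
          · exact .inr h
          · left
            rw [← Finset.card_pos, hc]
            omega)
        (fun u hu => hf u fun j => Finset.mem_of_mem_erase (hu j))
      refine ⟨g a, fun u hu => ?_⟩
      by_cases hvu : ∃ j, u j = v
      -- For each `i` there is an element of `H` on the same variables `u` that is right about `f`
      -- except possibly at `w i`, and has the value `a i` at `v`.
      · have : ∀ i, ∃ y : Fin m → D, (fun j => (u j, y j)) ∈ H ∧ ∀ j, (u j = v → y j = a i) ∧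
            (u j ≠ v → u j ≠ w i → y j = f (u j)) := by
          intro i
          -- Replacing `w i` by `v` moves the tuple into the range of the induction hypothesis; the
          -- extension property of `H` then restores `w i` with some value `b`.
          have h₁ := ha i (fun j => if u j = w i then v else u j) (fun j => by
            split_ifs with h
            · simp
            · rcases Finset.mem_insert.1 (hu j) with h' | h'
              · simp [h']
              · simp [h, h'])
          obtain ⟨b, hb⟩ := hH.2 _ h₁ (w i)
          have hb' := hb fun j => if u j = w i then Fin.last m else j.castSucc
          have hvw : v ≠ w i := fun h => hv (h ▸ hwW i)
          refine ⟨fun j => if u j = w i then b else Function.update f v (a i) (u j), ?_, ?_⟩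
          · convert hb' using 2 with j
            by_cases h : u j = w i <;> simp [h]
          · intro j
            refine ⟨fun h => ?_, fun h h' => ?_⟩
            · simp [h, hvw]
            · simp [h, h']
        choose y hy hy' using this
        have := hcl u y hy
        convert this using 2 with j
        congr 1
        by_cases h : u j = v
        · rw [h, Function.update_self]
          congr 1
          funext i
          exact ((hy' i j).1 h).symm
        · rw [Function.update_of_ne h]
          -- Only the `y i` with `w i = u j` can deviate from `f (u j)`, and `w` is injective.
          refine (hg.apply_eq (by omega) fun i i' hi hi' => hw ?_).symm
          have : ∀ i, y i j ≠ f (u j) → u j = w i := fun i hi => by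
            by_contra hne
            exact hi ((hy' i j).2 h hne)
          rw [← this i hi, ← this i' hi']
      · push Not at hvu
        have := hf u fun j => Finset.mem_of_mem_insert_of_ne (hu j) (hvu j)
        simpa [hvu] using this

/-- If the greatest strategy is not empty, then there is a global assignment. -/
theorem IsStrategy.exists_assignment [Finite V] [Nonempty D] (hg : IsNearUnanimity g)
    (hk : k = m + 1) {B H : Set (Fin m → V × D)} (hB : ClosedUnder g B)
    (hfun : ∀ x ∈ B, ∀ i j, (x i).1 = (x j).1 → (x i).2 = (x j).2)
    (hH : IsStrategy B H) (hmax : ∀ H', IsStrategy B H' → H' ⊆ H) (hne : H.Nonempty) :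
    ∃ ψ : V → D, ∀ u : Fin m → V, (fun i => (u i, ψ (u i))) ∈ B := by
  classical
  cases nonempty_fintype V
  have hcl := hB.greatest hH hmax
  suffices h : ∃ f, ConsistentOn H Finset.univ f by
    obtain ⟨f, hf⟩ := h
    exact ⟨f, fun u => hH.1 (hf u fun _ => Finset.mem_univ _)⟩
  obtain ⟨x, hx⟩ := hne
  rcases Nat.eq_zero_or_pos m with rfl | hm
  · exact ⟨fun _ => Classical.arbitrary D, fun u _ => by convert hx⟩
  let W₀ := Finset.univ.image fun i => (x i).1
  have h0 : W₀.Nonempty := ⟨(x ⟨0, hm⟩).1, by simp [W₀]⟩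
  have hstart : ∃ f, ConsistentOn H W₀ f := by
    -- The first partial assignment is read off one element `x` of `H`; `hfun` makes it well defined
    -- at repeated variables.
    have hex : ∀ v, ∃ a, ∀ i, (x i).1 = v → (x i).2 = a := fun v => by
      by_cases h : ∃ i, (x i).1 = v
      · obtain ⟨i, hi⟩ := h
        exact ⟨(x i).2, fun j hj => hfun x (hH.1 hx) _ _ (hj.trans hi.symm)⟩
      · exact ⟨Classical.arbitrary D, fun i hi => (h ⟨i, hi⟩).elim⟩
    choose f hf using hex
    refine ⟨f, fun u hu => ?_⟩
    have hu' : ∀ j, ∃ i, (x i).1 = u j := fun j => by simpa [W₀] using hu j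
    choose J hJ using hu'
    -- The variable is immaterial: the extension property is used only for its closure under
    -- selections from `x`.
    obtain ⟨a, ha⟩ := hH.2 x hx (x ⟨0, hm⟩).1
    convert ha fun j => (J j).castSucc using 2 with j
    rw [Fin.snoc_castSucc]
    exact Prod.ext (hJ j).symm (hf _ _ (hJ j)).symm
  have step : ∀ W : Finset V, ∃ f, ConsistentOn H (W₀ ∪ W) f := by
    intro W
    induction W using Finset.induction_on with
    | empty => simpa using hstart
    | insert v W _ ih =>
      obtain ⟨f, hf⟩ := ih
      rw [Finset.union_insert]
      by_cases hv : v ∈ W₀ ∪ W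
      · exact ⟨f, by rwa [Finset.insert_eq_of_mem hv]⟩
      · obtain ⟨a, ha⟩ := ConsistentOn.extend hg hk hH hcl f v _ _ rfl hv
          (.inl (h0.mono Finset.subset_union_left)) hf
        exact ⟨_, ha⟩
  obtain ⟨f, hf⟩ := step Finset.univ
  exact ⟨f, fun u _ => hf u fun i => by simp⟩

/-- The restrictions of a global assignment extend by its own values. Hence a solution leaves its
trace in the greatest strategy. -/
theorem isStrategy_of_assignment {B : Set (Fin m → V × D)} {ψ : V → D}
    (h : ∀ u : Fin m → V, (fun i => (u i, ψ (u i))) ∈ B) :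
    IsStrategy B {x | ∃ u : Fin m → V, x = fun i => (u i, ψ (u i))} := by
  refine ⟨?_, ?_⟩
  · rintro _ ⟨u, rfl⟩
    exact h u
  · rintro _ ⟨u, rfl⟩ v
    refine ⟨ψ v, fun J => ⟨fun i => Fin.snoc (α := fun _ => V) u v (J i), ?_⟩⟩
    funext i
    rw [snoc_prodMk, snoc_comp]

end NearUnanimity

/-! ## Decomposition of automatic instances -/

namespace AutCSPInstance

variable {d k m : ℕ}

/-- Some accepted word of the length of `s` takes the values `t` at the positions of the
variables `u` in `s`. -/
def Compatible (I : AutCSPInstance d) (u : Fin m → Fin I.numVars) (t : Fin m → Fin d)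
    (s : List (Fin I.numVars)) : Prop :=
  ∃ r ∈ I.aut.rel s.length, ∀ j i, u i = s.get j → t i = r j

variable {I : AutCSPInstance d} {g : (Fin k → Fin d) → Fin d}

/-- Apply `g` to the witnessing words letter by letter. The class `K` speaks of positive arities
only, so the scope has to be nonempty. -/
theorem Compatible.apply (hI : I.aut ∈ FinAutomaton.classK g) {u : Fin m → Fin I.numVars}
    {t : Fin k → Fin m → Fin d} {s : List (Fin I.numVars)} (hs : s ∈ I.scopes)
    (h : ∀ i, I.Compatible u (t i) s) : I.Compatible u (fun j => g fun i => t i j) s := by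
  choose r hr hr' using h
  refine ⟨_, hI s.length (List.length_pos_iff.2 (I.scopes_ne_nil s hs)) r hr, fun j i hij => ?_⟩
  exact congrArg g (funext fun l => hr' l j i hij)

/-- From right to left, Baker–Pixley is applied to `R_{|s|}`: for `k - 1` positions of `s`, take `u`
to be the variables standing there; the word that witnesses compatibility agrees with `ψ` at these
positions. -/
theorem isSolution_iff_compatible (hk : 1 ≤ k) (hg : IsNearUnanimity g)
    (hI : I.aut ∈ FinAutomaton.classK g) (ψ : Fin I.numVars → Fin d) :
    IsSolution ψ I.constraints ↔ ∀ u : Fin (k - 1) → Fin I.numVars, (∀ j, I.Occurs (u j)) →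
      ∀ s ∈ I.scopes, I.Compatible u (fun i => ψ (u i)) s := by
  constructor
  · intro h u _ s hs
    exact ⟨_, h _ ⟨s, hs, rfl⟩, fun j i hij => congrArg ψ hij⟩
  · rintro h _ ⟨s, hs, rfl⟩
    have hpos := List.length_pos_iff.2 (I.scopes_ne_nil s hs)
    refine hg.mem_of_projections hk hpos (hI s.length hpos) _ fun J => ?_
    obtain ⟨r, hr, hr'⟩ := h (fun i => s.get (J i)) (fun j => ⟨s, hs, List.get_mem _ _⟩) s hs
    exact ⟨r, hr, fun i => (hr' (J i) i rfl).symm⟩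

/-- The assignments to tuples of `m` variables that are functions and compatible with all
constraints. -/
def localAssignments (I : AutCSPInstance d) (m : ℕ) : Set (Fin m → Fin I.numVars × Fin d) :=
  {x | (∀ i j, (x i).1 = (x j).1 → (x i).2 = (x j).2) ∧
    ∀ s ∈ I.scopes, I.Compatible (fun i => (x i).1) (fun i => (x i).2) s}

theorem closedUnder_localAssignments (hI : I.aut ∈ FinAutomaton.classK g) :
    ClosedUnder g (I.localAssignments m) := by
  intro u y hy
  refine ⟨fun i j hij => ?_, fun s hs => Compatible.apply hI hs fun i => (hy i).2 s hs⟩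
  dsimp only
  congr 1
  funext l
  exact (hy l).1 i j hij

/-- The instance has a solution if and only if the greatest strategy is not empty. -/
theorem exists_isSolution_iff (hd : 0 < d) (hk : 1 ≤ k) (hg : IsNearUnanimity g)
    (hI : I.aut ∈ FinAutomaton.classK g) {H : Set (Fin (k - 1) → Fin I.numVars × Fin d)}
    (hH : IsStrategy (I.localAssignments (k - 1)) H)
    (hmax : ∀ H', IsStrategy (I.localAssignments (k - 1)) H' → H' ⊆ H) :
    (∃ ψ : Fin I.numVars → Fin d, IsSolution ψ I.constraints) ↔ I.numVars = 0 ∨ H.Nonempty := by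
  constructor
  · rintro ⟨ψ, hψ⟩
    -- Without variables there may be no tuple of variables at all, so `H` can be empty although the
    -- empty map is a solution.
    rcases Nat.eq_zero_or_pos I.numVars with h | h
    · exact .inl h
    · right
      refine ⟨_, hmax _ (isStrategy_of_assignment (ψ := ψ) fun u => ⟨fun i j hij => ?_,
        fun s hs => ⟨_, hψ _ ⟨s, hs, rfl⟩, fun j i hij => ?_⟩⟩) ⟨fun _ => ⟨0, h⟩, rfl⟩⟩
      · exact congrArg ψ hij
      · exact congrArg ψ hij
  · rintro (h | h)
    · refine ⟨fun v => ⟨0, hd⟩, ?_⟩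
      rintro _ ⟨s, hs, rfl⟩
      -- A nonempty scope would supply a variable, so without variables there are no constraints.
      obtain ⟨v, l, rfl⟩ := List.exists_cons_of_ne_nil (I.scopes_ne_nil s hs)
      exact (by omega : ¬ (v : ℕ) < I.numVars).elim v.2
    · have : Nonempty (Fin d) := ⟨⟨0, hd⟩⟩
      obtain ⟨ψ, hψ⟩ := IsStrategy.exists_assignment hg (by omega)
        (closedUnder_localAssignments hI) (fun x hx => hx.1) hH hmax h
      exact ⟨ψ, (isSolution_iff_compatible hk hg hI ψ).2 fun u _ => (hψ u).2⟩

end AutCSPInstance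

/-! ## Reading an instance -/

namespace AutCSPInstance

variable {d : ℕ}

/-- The content of the input array. -/
def input (I : AutCSPInstance d) (j : ℕ) : ℕ := I.encode.getD j 0

/-- The encoding of the constraints. -/
abbrev encodeScopes {n : ℕ} (l : List (List (Fin n))) : List ℕ :=
  l.flatMap fun s => s.length :: s.map Fin.val

variable (I : AutCSPInstance d)

theorem holds_input : Holds I.input 0 I.encode := by
  rw [holds_iff_getElem]
  intro i hi
  rw [zero_add, input, List.getD_eq_getElem _ _ hi]

theorem input_header : I.input 0 = I.numVars ∧ I.input 1 = d ∧ I.input 2 = I.aut.numStates ∧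
    I.input 3 = I.aut.trans.length ∧ I.input 4 = I.scopes.length := by
  have := I.holds_input
  simp only [encode, holds_append, holds_cons] at this
  tauto

theorem length_encodeTrans (l : List (Fin I.aut.numStates × Fin d × Fin I.aut.numStates)) :
    (l.flatMap (fun e => [(e.1 : ℕ), (e.2.1 : ℕ), (e.2.2 : ℕ)])).length = 3 * l.length := by
  induction l with
  | nil => rfl
  | cons a l ih => rw [List.flatMap_cons, List.length_append, ih, List.length_cons]; simp; omega

theorem input_trans (e : ℕ) (he : e < I.aut.trans.length) :
    I.input (5 + 3 * e) = I.aut.trans[e].1 ∧ I.input (5 + 3 * e + 1) = I.aut.trans[e].2.1 ∧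
      I.input (5 + 3 * e + 2) = I.aut.trans[e].2.2 := by
  have := I.holds_input
  simp only [encode, holds_append] at this
  have h := this.1.1.1.2.getElem_flatMap (c := 3) (fun _ => rfl) e he
  simpa [add_assoc] using h

theorem input_start (q : Fin I.aut.numStates) :
    I.input (5 + 3 * I.aut.trans.length + q) = (I.aut.isStart q).toNat := by
  have := I.holds_input
  simp only [encode, holds_append, List.length_append, length_encodeTrans] at this
  have h := (holds_iff_getElem _ _ _).1 this.1.1.2 q (by simp)
  simpa using h

theorem input_accept (q : Fin I.aut.numStates) :
    I.input (5 + 3 * I.aut.trans.length + I.aut.numStates + q) = (I.aut.isAccept q).toNat := by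
  have := I.holds_input
  simp only [encode, holds_append, List.length_append, length_encodeTrans] at this
  have h := (holds_iff_getElem _ _ _).1 this.1.2 q (by simp)
  simpa using h

theorem input_scopes :
    Holds I.input (5 + 3 * I.aut.trans.length + I.aut.numStates + I.aut.numStates)
      (encodeScopes I.scopes) := by
  have := I.holds_input
  simp only [encode, holds_append, List.length_append, length_encodeTrans] at this
  simpa only [List.length_ofFn, List.length_cons, List.length_nil, zero_add, encodeScopes,
    List.map_id', List.pure_def, List.bind_eq_flatMap, ← List.map_eq_flatMap] using this.2

/-- The header of the instance is in the registers `0, …, 7`. -/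
structure Loaded (σ : RamState) : Prop where
  mem : σ.mem 0 = I.input
  numVars : σ.reg 0 = I.numVars
  domain : σ.reg 1 = d
  numStates : σ.reg 2 = I.aut.numStates
  numTrans : σ.reg 3 = I.aut.trans.length
  numScopes : σ.reg 4 = I.scopes.length
  startPos : σ.reg 5 = 5 + 3 * I.aut.trans.length
  acceptPos : σ.reg 6 = 5 + 3 * I.aut.trans.length + I.aut.numStates
  scopesPos : σ.reg 7 = 5 + 3 * I.aut.trans.length + I.aut.numStates + I.aut.numStates

variable {I}

/-- After the header has been loaded, the registers below 8 and the input array are never written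
again, so this applies to every later program. -/
theorem Loaded.of_frame {p : RamProg} {σ τ : RamState} (h : I.Loaded σ) (hF : p.Frame σ τ)
    (hr : ∀ r < 8, ¬ p.writesReg r) (hm : ¬ p.writesMem 0) : I.Loaded τ := by
  have hr' : ∀ r < 8, τ.reg r = σ.reg r := fun r h => hF.reg r (hr r h)
  obtain ⟨h1, h2, h3, h4, h5, h6, h7, h8, h9⟩ := h
  constructor <;> first | rwa [hF.mem 0 hm] | rwa [hr' _ (by norm_num)]

end AutCSPInstance

/-! ### Reading the constraints as a stream -/

namespace RamProg

open RamExpr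

/-- Load the header of the instance. -/
def loadHeader : RamProg :=
  seq (assign 0 (get 0 (const 0))) <| seq (assign 1 (get 0 (const 1))) <|
  seq (assign 2 (get 0 (const 2))) <| seq (assign 3 (get 0 (const 3))) <|
  seq (assign 4 (get 0 (const 4))) <|
  seq (assign 5 (add (const 5) (add (reg 3) (add (reg 3) (reg 3))))) <|
  seq (assign 6 (add (reg 5) (reg 2))) (assign 7 (add (reg 6) (reg 2)))

theorem runs_loadHeader {d : ℕ} (I : AutCSPInstance d) :
    Runs loadHeader (RamState.initial I.encode) 31 I.Loaded := by
  refine LoopFree.runs (by simp [loadHeader]) (by simp [loadHeader]) ?_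
  obtain ⟨h0, h1, h2, h3, h4⟩ := I.input_header
  have hm : (RamState.initial I.encode).mem 0 = I.input := by
    funext j; simp [RamState.initial, AutCSPInstance.input]
  constructor <;> simp [loadHeader, *] <;> omega

/-- Read the constraints one after the other: `pre` is run before the variables of a constraint are
read, `letter` for each of them (it is in the register `13`), and `post` afterwards. -/
def scan (pre letter post : RamProg) : RamProg :=
  seq (assign 9 (reg 7)) <| forLoop 10 4 <|
    seq (seq (assign 11 (get 0 (reg 9))) (assign 9 (add (reg 9) (const 1)))) <| seq pre <|
    seq (forLoop 12 11 <|
      seq (seq (assign 13 (get 0 (reg 9))) (assign 9 (add (reg 9) (const 1)))) letter) post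

theorem scan_writesReg (pre letter post : RamProg) (r : ℕ) :
    (scan pre letter post).writesReg r ↔ (9 ≤ r ∧ r ≤ 13) ∨ pre.writesReg r ∨
      letter.writesReg r ∨ post.writesReg r := by
  simp only [scan, writesReg, forLoop_writesReg]
  constructor
  · rintro (h | h | (h | h) | h | (h | (h | h) | h) | h) <;> first | (left; omega) | tauto
  · rintro (⟨h, h'⟩ | h | h | h)
    · interval_cases r <;> simp
    all_goals tauto

theorem scan_writesMem (pre letter post : RamProg) (a : ℕ) :
    (scan pre letter post).writesMem a ↔ pre.writesMem a ∨ letter.writesMem a ∨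
      post.writesMem a := by
  simp [scan]

/-- The program writes neither the registers below `14` nor the input array. -/
structure Spares (p : RamProg) : Prop where
  reg : ∀ r < 14, ¬ p.writesReg r
  mem : ¬ p.writesMem 0

theorem sum_range_getD {α : Type*} (f : α → ℕ) (x : α) (l : List α) :
    ∑ c ∈ Finset.range l.length, f (l.getD c x) = (l.map f).sum := by
  induction l with
  | nil => simp
  | cons a l ih => simp [Finset.sum_range_succ', ← ih, add_comm]

/-- `Inv l` holds after the constraints in `l`, and `InvL l a` after the prefix `a` of the next one.
Both have to ignore the registers `9, …, 13`, which belong to the scan. -/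
theorem Runs.scan {d : ℕ} {I : AutCSPInstance d} {pre letter post : RamProg} {T₁ T₂ T₃ : ℕ}
    (Inv : List (List (Fin I.numVars)) → RamState → Prop)
    (InvL : List (List (Fin I.numVars)) → List (Fin I.numVars) → RamState → Prop)
    {σ : RamState} (hσ : I.Loaded σ) (h₁ : pre.Spares) (h₂ : letter.Spares) (h₃ : post.Spares)
    (hinv : ∀ l τ r v, 9 ≤ r → r ≤ 13 → Inv l τ → Inv l (τ.setReg r v))
    (hinvL : ∀ l s τ r v, 9 ≤ r → r ≤ 13 → InvL l s τ → InvL l s (τ.setReg r v))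
    (h0 : Inv [] σ)
    (hpre : ∀ l s l', I.scopes = l ++ s :: l' → ∀ τ, Frame (scan pre letter post) σ τ → Inv l τ →
      Runs pre τ T₁ (InvL l []))
    (hletter : ∀ l (s : List (Fin I.numVars)) l' a (v : Fin I.numVars) b, I.scopes = l ++ s :: l' → s = a ++ v :: b → ∀ τ,
      Frame (scan pre letter post) σ τ → τ.reg 13 = (v : ℕ) → InvL l a τ →
      Runs letter τ T₂ (InvL l (a ++ [v])))
    (hpost : ∀ l s l', I.scopes = l ++ s :: l' → ∀ τ, Frame (scan pre letter post) σ τ →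
      InvL l s τ → Runs post τ T₃ (Inv (l ++ [s]))) :
    Runs (scan pre letter post) σ (I.constraintSize * (T₁ + T₂ + T₃ + 36) + 8)
      (Inv I.scopes) := by
  have frame_mem : ∀ τ, Frame (RamProg.scan pre letter post) σ τ → τ.mem 0 = I.input :=
    fun τ hF => by
      rw [hF.mem 0, hσ.mem]
      rw [scan_writesMem]
      rintro (h | h | h)
      exacts [h₁.mem h, h₂.mem h, h₃.mem h]
  let tail (j : ℕ) : List ℕ := AutCSPInstance.encodeScopes (I.scopes.drop j)
  let time (s : List (Fin I.numVars)) : ℕ := 7 + (T₁ + ((s.length * (7 + T₂ + 8) + 6) + T₃))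
  have hassign : Runs (RamProg.assign 9 (.reg 7)) σ 2 (· = σ.setReg 9 (σ.reg 7)) :=
    .assign (by simp) rfl
  have main := hassign.seq (T₂ := (∑ c ∈ Finset.range I.scopes.length,
      (time (I.scopes.getD c []) + 8)) + 6) (Q₂ := Inv I.scopes)
    (q := RamProg.forLoop 10 4 <|
      RamProg.seq (RamProg.seq (RamProg.assign 11 (get 0 (reg 9)))
        (RamProg.assign 9 (add (reg 9) (const 1)))) <| RamProg.seq pre <|
      RamProg.seq (RamProg.forLoop 12 11 <|
        RamProg.seq (RamProg.seq (RamProg.assign 13 (get 0 (reg 9)))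
          (RamProg.assign 9 (add (reg 9) (const 1)))) letter) post) ?_
  · refine Runs.weaken (p := RamProg.scan pre letter post) main ?_ fun _ _ => id
    rw [sum_range_getD (fun s => time s + 8)]
    -- The cost per constraint is charged to its letters: a nonempty scope has at least one, so the
    -- total is proportional to `constraintSize`. The 36 is 21 steps of overhead for a constraint
    -- and 15 for a letter.
    have : ∀ l : List (List (Fin I.numVars)), (∀ s ∈ l, s ≠ []) →
        (l.map fun s => time s + 8).sum ≤ (l.map List.length).sum * (T₁ + T₂ + T₃ + 36) := by
      intro l hl
      induction l with
      | nil => simp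
      | cons s l ih =>
        have h := ih fun t ht => hl t (List.mem_cons_of_mem _ ht)
        have hs := List.length_pos_iff.2 (hl s List.mem_cons_self)
        simp only [List.map_cons, List.sum_cons, Nat.add_mul]
        refine Nat.add_le_add ?_ (by simpa [Nat.add_mul] using h)
        simp only [time]
        nlinarith
    have := this I.scopes I.scopes_ne_nil
    rw [AutCSPInstance.constraintSize]
    omega
  rintro σ₁ hF₁ rfl
  have hmono₁ : Frame (RamProg.scan pre letter post) σ (σ.setReg 9 (σ.reg 7)) :=
    hF₁.mono (fun r h => by rw [scan_writesReg]; simp at h; omega) (by simp)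
  refine (Runs.forLoop_sum (T := fun c => time (I.scopes.getD c []))
    -- The register `9` points to the unread part of the input.
    (fun c τ => Inv (I.scopes.take c) τ ∧ Holds I.input (τ.reg 9) (tail c)) (by norm_num)
    ?_ ?_ ?_ ?_ ?_ ?_).weaken le_rfl ?_
  · have := h₁.reg 10; have := h₂.reg 10; have := h₃.reg 10
    simp_all
  · have := h₁.reg 4; have := h₂.reg 4; have := h₃.reg 4
    simp_all
  · simpa using hσ.numScopes
  · rintro j τ v ⟨h, h'⟩
    exact ⟨hinv _ _ _ _ (by norm_num) (by norm_num) h, by simpa using h'⟩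
  · exact ⟨by simpa using hinv _ _ _ _ (by norm_num) (by norm_num) h0,
      by simpa [tail, hσ.scopesPos] using I.input_scopes⟩
  · intro c hc τ hF hτ ⟨hI, hH⟩
    have hdrop := List.drop_eq_getElem_cons hc
    have hsplit : I.scopes = I.scopes.take c ++ I.scopes[c] :: I.scopes.drop (c + 1) := by
      rw [← hdrop, List.take_append_drop]
    have hgetD : I.scopes.getD c [] = I.scopes[c] := List.getD_eq_getElem _ _ hc
    have htake := List.take_concat_get' I.scopes c hc
    simp only [hgetD, ← htake]
    clear htake
    generalize I.scopes[c] = s at *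
    have toScan : ∀ {p : RamProg} {τ₁ τ₂ : RamState},
        Frame (RamProg.scan pre letter post) σ τ₁ → Frame p τ₁ τ₂ →
        (∀ r, p.writesReg r → (9 ≤ r ∧ r ≤ 13) ∨ pre.writesReg r ∨ letter.writesReg r ∨
          post.writesReg r) → (∀ a, p.writesMem a → pre.writesMem a ∨ letter.writesMem a ∨
          post.writesMem a) → Frame (RamProg.scan pre letter post) σ τ₂ :=
      fun h h' hr hm => h.trans (h'.mono (fun r hr' => (scan_writesReg _ _ _ _).2 (hr r hr'))
        fun a ha => (scan_writesMem _ _ _ _).2 (hm a ha))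
    have hFτ : Frame (RamProg.scan pre letter post) σ τ := hmono₁.trans
      (hF.mono (fun r h => by rw [RamProg.scan, writesReg]; exact .inr h)
        fun a h => by rw [RamProg.scan, writesMem]; exact .inr h)
    simp only [tail, hdrop, AutCSPInstance.encodeScopes, List.flatMap_cons, List.cons_append,
      holds_cons] at hH
    have hread : Runs (RamProg.seq (RamProg.assign 11 (get 0 (reg 9)))
        (RamProg.assign 9 (add (reg 9) (const 1)))) τ 7
        (· = (τ.setReg 11 s.length).setReg 9 (τ.reg 9 + 1)) :=
      LoopFree.runs (by simp) (by simp) (by simp [frame_mem τ hFτ, hH.1])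
    refine (hread.seq ?_).weaken le_rfl fun _ _ => id
    rintro τ₁ hF' rfl
    have hFτ₁ := toScan hFτ hF' (fun r h => by simp at h; omega) (by simp)
    have hpre' := hpre _ _ _ hsplit _ hFτ₁ (hinv _ _ _ _ (by norm_num) (by norm_num)
      (hinv _ _ _ _ (by norm_num) (by norm_num) hI))
    refine (hpre'.seq ?_).weaken le_rfl fun _ _ => id
    intro τ₂ hF₂ hL₂
    have hFτ₂ := toScan hFτ₁ hF₂ (fun r h => .inr (.inl h)) (fun r h => .inl h)
    have h9 : τ₂.reg 9 = τ.reg 9 + 1 := by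
      rw [hF₂.reg 9 (h₁.reg 9 (by norm_num))]; simp
    have h11 : τ₂.reg 11 = s.length := by
      rw [hF₂.reg 11 (h₁.reg 11 (by norm_num))]; simp
    have hfor := Runs.forLoop (i := 12) (b := 11) (B := s.length) (T := 7 + T₂)
      (body := RamProg.seq (RamProg.seq (RamProg.assign 13 (get 0 (reg 9)))
          (RamProg.assign 9 (add (reg 9) (const 1)))) letter) (σ := τ₂)
      (fun j τ => InvL (I.scopes.take c) (s.take j) τ ∧
        Holds I.input (τ.reg 9) ((s.drop j).map Fin.val ++ tail (c + 1)))
      (by norm_num) ?_ ?_ h11 ?_ ?_ ?_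
    · refine (hfor.seq ?_).weaken le_rfl fun _ _ => id
      rintro τ₃ hF₃ ⟨hL₃, hH₃⟩
      have hFτ₃ := toScan hFτ₂ hF₃
        (fun r h => by
          simp only [forLoop_writesReg, writesReg] at h
          rcases h with h | (h | h) | h
          exacts [.inl (by omega), .inl (by omega), .inl (by omega), .inr (.inr (.inl h))])
        (fun a h => by simp at h; tauto)
      rw [List.take_length] at hL₃
      refine (hpost _ _ _ hsplit _ hFτ₃ hL₃).weaken le_rfl fun τ₄ hF₄ h => ⟨?_, ?_⟩
      · exact h
      · rw [hF₄.reg 9 (h₃.reg 9 (by norm_num))]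
        simpa using hH₃
    · have := h₂.reg 12
      simpa using this
    · have := h₂.reg 11
      simpa using this
    · rintro j τ v ⟨h, h'⟩
      exact ⟨hinvL _ _ _ _ _ (by norm_num) (by norm_num) h, by simpa using h'⟩
    · exact ⟨by simpa using hL₂, by simpa [h9, tail, AutCSPInstance.encodeScopes] using hH.2⟩
    · intro j hj τ₃ hF₃ _ ⟨hL₃, hH₃⟩
      have hFτ₃ := toScan hFτ₂ hF₃
        (fun r h => by
          simp only [forLoop_writesReg, writesReg] at h
          rcases h with h | (h | h) | h
          exacts [.inl (by omega), .inl (by omega), .inl (by omega), .inr (.inr (.inl h))])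
        (fun a h => by simp at h; tauto)
      have hdrop' := List.drop_eq_getElem_cons hj
      have hsplit' : s = s.take j ++ s[j] :: s.drop (j + 1) := by
        rw [← hdrop', List.take_append_drop]
      rw [hdrop', List.map_cons, List.cons_append, holds_cons] at hH₃
      have hread' : Runs (RamProg.seq (RamProg.assign 13 (get 0 (reg 9)))
          (RamProg.assign 9 (add (reg 9) (const 1)))) τ₃ 7
          (· = (τ₃.setReg 13 s[j]).setReg 9 (τ₃.reg 9 + 1)) :=
        LoopFree.runs (by simp) (by simp) (by simp [frame_mem τ₃ hFτ₃, hH₃.1])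
      refine (hread'.seq ?_).weaken le_rfl fun _ _ => id
      rintro τ₄ hF₄ rfl
      have hFτ₄ := toScan hFτ₃ hF₄ (fun r h => by simp at h; omega) (by simp)
      refine (hletter _ _ _ _ _ _ hsplit hsplit' _ hFτ₄ (by simp) (hinvL _ _ _ _ _ (by norm_num)
        (by norm_num) (hinvL _ _ _ _ _ (by norm_num) (by norm_num) hL₃))).weaken le_rfl
        fun τ₅ hF₅ h => ⟨?_, ?_⟩
      · rw [← List.take_concat_get' _ _ hj]
        exact h
      · rw [hF₅.reg 9 (h₂.reg 9 (by norm_num))]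
        simpa using hH₃.2
  · rintro τ - ⟨h, -⟩
    simpa using h

end RamProg

/-! ## Checking compatibility -/

namespace AutCSPInstance

variable {d m : ℕ} (I : AutCSPInstance d)

/-- The letter `a` at the position of the variable `v` respects the values `t` of the variables
`u`. -/
def LetterOk (u : Fin m → Fin I.numVars) (t : Fin m → Fin d) (v : Fin I.numVars) (a : Fin d) :
    Prop :=
  ∀ i, u i = v → t i = a

/-- The states reached from `S` by an admissible letter at the position of `v`. -/
def admissibleStep (u : Fin m → Fin I.numVars) (t : Fin m → Fin d) (S : Set (Fin I.aut.numStates))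
    (v : Fin I.numVars) : Set (Fin I.aut.numStates) :=
  {q' | ∃ q ∈ S, ∃ a, I.LetterOk u t v a ∧ (q, a, q') ∈ I.aut.trans}

/-- The states reached from the initial ones by admissible letters. -/
def reached (u : Fin m → Fin I.numVars) (t : Fin m → Fin d) (s : List (Fin I.numVars)) :
    Set (Fin I.aut.numStates) :=
  s.foldl (I.admissibleStep u t) {q | I.aut.isStart q = true}

variable {I}

theorem reached_append (u : Fin m → Fin I.numVars) (t : Fin m → Fin d) (s : List (Fin I.numVars))
    (v : Fin I.numVars) :
    I.reached u t (s ++ [v]) = I.admissibleStep u t (I.reached u t s) v := by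
  simp [reached]

/-- The subset construction, with the alphabet restricted at each position to the letters that
respect `t`. It replaces the search through exponentially many words by the propagation of one set
of states. -/
theorem mem_reached_iff (u : Fin m → Fin I.numVars) (t : Fin m → Fin d)
    (s : List (Fin I.numVars)) (q : Fin I.aut.numStates) :
    q ∈ I.reached u t s ↔ ∃ w, List.Forall₂ (I.LetterOk u t) s w ∧ q ∈ I.aut.toNFA.eval w := by
  induction s using List.reverseRecOn generalizing q with
  | nil => simp [reached, FinAutomaton.toNFA]
  | append_singleton s v ih =>
    rw [reached_append]
    constructor
    · rintro ⟨q', hq', a, ha, htr⟩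
      obtain ⟨w, hw, hq⟩ := (ih q').1 hq'
      refine ⟨w ++ [a], List.rel_append hw (.cons ha .nil), ?_⟩
      rw [NFA.eval_append_singleton, NFA.mem_stepSet]
      exact ⟨q', hq, htr⟩
    · rintro ⟨w, hw, hq⟩
      rcases List.eq_nil_or_concat w with rfl | ⟨w, a, rfl⟩
      · have := hw.length_eq
        simp at this
      · rw [List.concat_eq_append] at hw hq
        have hlen : s.length = w.length := by
          have := hw.length_eq
          simpa using this
        have hw' := List.forall₂_take s.length hw
        have ha := List.forall₂_drop s.length hw
        rw [List.take_left] at hw'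
        rw [hlen, List.take_left] at hw'
        rw [List.drop_left, hlen, List.drop_left] at ha
        rw [NFA.eval_append_singleton, NFA.mem_stepSet] at hq
        obtain ⟨q', hq', htr⟩ := hq
        exact ⟨q', (ih q').2 ⟨w, hw', hq'⟩, a, by simpa using ha, htr⟩

theorem compatible_iff_reached (u : Fin m → Fin I.numVars) (t : Fin m → Fin d)
    (s : List (Fin I.numVars)) :
    I.Compatible u t s ↔ ∃ q ∈ I.reached u t s, I.aut.isAccept q = true := by
  simp only [mem_reached_iff]
  constructor
  · rintro ⟨r, ⟨q, hq, hr⟩, h⟩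
    refine ⟨q, ⟨List.ofFn r, ?_, hr⟩, hq⟩
    rw [List.forall₂_iff_get]
    refine ⟨by simp, fun j hj _ i hi => ?_⟩
    simpa using h ⟨j, hj⟩ i hi
  · rintro ⟨q, ⟨w, hw, hq⟩, hacc⟩
    obtain ⟨hlen, h⟩ := List.forall₂_iff_get.1 hw
    refine ⟨fun j => w.get (j.cast hlen), ⟨q, hacc, ?_⟩, fun j i hij =>
      h j j.2 (hlen ▸ j.2) i hij⟩
    convert hq
    apply List.ext_get
    · simp [hlen]
    · simp

/-- The array `a` represents the set `S` of states. -/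
def StateSet (I : AutCSPInstance d) (σ : RamState) (a : ℕ) (S : Set (Fin I.aut.numStates)) :
    Prop :=
  ∀ q : Fin I.aut.numStates, σ.mem a q ≠ 0 ↔ q ∈ S

end AutCSPInstance

/-! ### Simulation of the automaton on all admissible words -/

namespace RamProg

open RamExpr AutCSPInstance

/-- Initialize the current set of states, in array `2`. -/
def initStates : RamProg := forLoop 14 2 (store 2 (reg 14) (get 0 (add (reg 5) (reg 14))))

/-- Process one transition: the pointer to it is in the register `16`, the variable is in the
register `13`. The `i`-th variable and value to be respected are given by expressions. -/
def processTrans (u t : ℕ → RamExpr) (m : ℕ) : RamProg :=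
  seq (ite (get 2 (get 0 (reg 16)))
      (ite (sum (fun i => imp (u i) (reg 13) (t i) (get 0 (add (reg 16) (const 1)))) m) skip
        (store 3 (get 0 (add (reg 16) (const 2))) (const 1))) skip)
    (assign 16 (add (reg 16) (const 3)))

/-- Copy the next set of states, in array `3`, to the current one, and clear it. -/
def advance : RamProg :=
  forLoop 14 2 (seq (store 2 (reg 14) (get 3 (reg 14))) (store 3 (reg 14) (const 0)))

/-- Process one letter. -/
def readLetter (u t : ℕ → RamExpr) (m : ℕ) : RamProg :=
  seq (assign 16 (const 5)) (seq (forLoop 15 3 (processTrans u t m)) advance)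

/-- Clear the flag in the register `18` if no current state is accepting. -/
def testAccept : RamProg :=
  seq (assign 17 (const 0)) <|
  seq (forLoop 14 2 (ite (get 2 (reg 14))
    (ite (get 0 (add (reg 6) (reg 14))) (assign 17 (const 1)) skip) skip))
  (ite (reg 17) skip (assign 18 (const 0)))

/-- Set the flag in the register `18` if the values of the variables are compatible with all
constraints. -/
def check (u t : ℕ → RamExpr) (m : ℕ) : RamProg :=
  seq (assign 18 (const 1)) (scan initStates (readLetter u t m) testAccept)

theorem check_writesReg (u t : ℕ → RamExpr) (m r : ℕ) :
    (check u t m).writesReg r ↔ 9 ≤ r ∧ r ≤ 18 := by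
  simp only [check, writesReg, scan_writesReg, initStates, readLetter, processTrans, advance,
    testAccept, forLoop_writesReg, or_false, false_or]
  omega

theorem check_writesMem (u t : ℕ → RamExpr) (m a : ℕ) :
    (check u t m).writesMem a ↔ a = 2 ∨ a = 3 := by
  simp only [check, writesMem, scan_writesMem, initStates, readLetter, processTrans, advance,
    testAccept, forLoop_writesMem]
  tauto

variable {d m : ℕ} {I : AutCSPInstance d}

theorem runs_initStates {σ : RamState} (hσ : I.Loaded σ) :
    Runs initStates σ (I.aut.numStates * 14 + 6)
      (I.StateSet · 2 {q | I.aut.isStart q = true}) := by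
  refine (Runs.forLoop (B := I.aut.numStates) (T := 6)
    (fun j τ => ∀ q : Fin I.aut.numStates, q < j → (τ.mem 2 q ≠ 0 ↔ I.aut.isStart q = true))
    (by norm_num) (by simp) (by simp) hσ.numStates (fun j τ v h => by simpa using h)
    (by simp) ?_).weaken le_rfl ?_
  · intro j hj τ hF hτ hI
    refine LoopFree.runs (by simp) (by simp) ?_
    have hL := hσ.of_frame hF (by simp; omega) (by simp)
    intro q hq
    by_cases h : (q : ℕ) = j
    · have := I.input_start q
      rw [h] at this
      simp [h, hτ, hL.startPos, hL.mem, this]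
    · have := hI q (by omega)
      simpa [hτ, h] using this
  · intro τ _ h q
    exact h q q.2

theorem runs_processTrans {u t : ℕ → RamExpr} {U : Fin m → Fin I.numVars} {T : Fin m → Fin d}
    {S : Set (Fin I.aut.numStates)} {v : Fin I.numVars} {σ : RamState} (hσ : I.Loaded σ)
    (hu : ∀ i : Fin m, (u i).eval σ = U i) (ht : ∀ i : Fin m, (t i).eval σ = T i)
    (hv : σ.reg 13 = v) (hS : I.StateSet σ 2 S) {e : ℕ} (he : e < I.aut.trans.length)
    (hp : σ.reg 16 = 5 + 3 * e) :
    Runs (processTrans u t m) σ (processTrans u t m).maxCost fun τ =>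
      τ.reg 16 = 5 + 3 * (e + 1) ∧ ∀ q : Fin I.aut.numStates, τ.mem 3 q ≠ 0 ↔
        σ.mem 3 q ≠ 0 ∨ (I.aut.trans[e].2.2 = q ∧ I.aut.trans[e].1 ∈ S ∧
          I.LetterOk U T v I.aut.trans[e].2.1) := by
  refine LoopFree.runs (by simp [processTrans]) le_rfl ?_
  obtain ⟨h1, h2, h3⟩ := I.input_trans e he
  -- The sum of the `m` implication tests vanishes if and only if the letter of the transition is
  -- admissible.
  have hcond : (sum (fun i => imp (u i) (reg 13) (t i) (get 0 (add (reg 16) (const 1)))) m).eval σ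
      = 0 ↔ I.LetterOk U T v I.aut.trans[e].2.1 := by
    rw [sum_eval_eq_zero]
    simp only [imp_eval_eq_zero, eval, hσ.mem, hp, h2, hv]
    constructor
    · intro h i hi
      have := h i i.2
      rw [hu, ht] at this
      exact Fin.ext (this (congrArg _ hi))
    · intro h i hi
      rw [hu ⟨i, hi⟩, ht ⟨i, hi⟩]
      intro h'
      exact congrArg _ (h ⟨i, hi⟩ (Fin.ext h'))
  have hcur := hS I.aut.trans[e].1
  generalize I.aut.trans[e] = tr at *
  simp only [processTrans, final, eval, hσ.mem, hp, h1, h3]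
  by_cases hs : tr.1 ∈ S
  · have h0 := hcur.2 hs
    rw [if_neg h0]
    by_cases hl : I.LetterOk U T v tr.2.1
    · rw [if_pos (hcond.2 hl)]
      refine ⟨by simp [hp]; ring, fun q => ?_⟩
      simp only [RamState.setReg_mem, RamState.setMem_mem, hs, hl, and_true, true_and]
      by_cases hq : tr.2.2 = q
      · simp [hq]
      · have : ¬ (q : ℕ) = tr.2.2 := fun h => hq (Fin.ext h.symm)
        simp [hq, this]
    · rw [if_neg (mt hcond.1 hl)]
      exact ⟨by simp [hp]; ring, fun q => by simp [hl]⟩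
  · have h0 : σ.mem 2 tr.1 = 0 := by
      by_contra h
      exact hs (hcur.1 h)
    rw [if_pos h0]
    exact ⟨by simp [hp]; ring, fun q => by simp [hs]⟩

/-- Array `3` is cleared while it is copied, so that the next letter finds it empty. In the
invariant, the states below `j` are done and array `3` is intact from `j` on. -/
theorem runs_advance {S : Set (Fin I.aut.numStates)} {σ : RamState} (hσ : I.Loaded σ)
    (hS : I.StateSet σ 3 S) :
    Runs advance σ (I.aut.numStates * 15 + 6) fun τ =>
      I.StateSet τ 2 S ∧ I.StateSet τ 3 ∅ := by
  refine (Runs.forLoop (B := I.aut.numStates) (T := 7)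
    (fun j τ => ∀ q : Fin I.aut.numStates, (q < j → (τ.mem 2 q ≠ 0 ↔ q ∈ S) ∧ τ.mem 3 q = 0) ∧
      (j ≤ q → (τ.mem 3 q ≠ 0 ↔ q ∈ S)))
    (by norm_num) (by simp) (by simp) hσ.numStates (fun j τ v h => by simpa using h)
    (by simpa [StateSet] using hS) ?_).weaken le_rfl ?_
  · intro j hj τ hF hτ hI
    refine LoopFree.runs (by simp) (by simp) fun q => ?_
    obtain ⟨h, h'⟩ := hI q
    by_cases hq : (q : ℕ) = j
    · have := h' hq.ge
      simp [hτ, hq] at this ⊢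
      exact this
    · refine ⟨fun hlt => ?_, fun hle => ?_⟩
      · simpa [hτ, hq] using h (by omega)
      · simpa [hτ, hq] using h' (by omega)
  · intro τ _ h
    exact ⟨fun q => ((h q).1 q.2).1, fun q => by simp [((h q).1 q.2).2]⟩

/-- One pass through the transitions and one through the states, hence linear in `|A|`; the additive
constants are absorbed because there is a state. The expressions are required to keep their values
in all states within the frame, as they are evaluated anew for each transition. -/
theorem runs_readLetter {u t : ℕ → RamExpr} {U : Fin m → Fin I.numVars} {T : Fin m → Fin d}
    {S : Set (Fin I.aut.numStates)} {v : Fin I.numVars} {σ : RamState} (hσ : I.Loaded σ)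
    (hu : ∀ τ, Frame (readLetter u t m) σ τ → ∀ i : Fin m, (u i).eval τ = U i)
    (ht : ∀ τ, Frame (readLetter u t m) σ τ → ∀ i : Fin m, (t i).eval τ = T i)
    (hv : σ.reg 13 = v) (hS : I.StateSet σ 2 S) (h3 : I.StateSet σ 3 ∅) :
    Runs (readLetter u t m) σ (I.aut.size * ((processTrans u t m).maxCost + 30)) fun τ =>
      I.StateSet τ 2 (I.admissibleStep U T S v) ∧ I.StateSet τ 3 ∅ := by
  have hfirst : Runs (RamProg.assign 16 (const 5)) σ 2 (· = σ.setReg 16 5) :=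
    .assign (by simp) rfl
  have main := hfirst.seq (T₂ := (I.aut.trans.length * ((processTrans u t m).maxCost + 8) + 6) +
    (I.aut.numStates * 15 + 6)) (q := seq (forLoop 15 3 (processTrans u t m)) advance) (Q₂ := fun τ =>
      I.StateSet τ 2 (I.admissibleStep U T S v) ∧ I.StateSet τ 3 ∅) ?_
  · refine Runs.weaken (p := readLetter u t m) main ?_ fun _ _ h => h
    have := I.aut.numStates_pos
    rw [FinAutomaton.size]
    nlinarith
  rintro _ hF₁ rfl
  have hF₁' : Frame (readLetter u t m) σ (σ.setReg 16 5) :=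
    hF₁.mono (by simp [readLetter]) (by simp [readLetter])
  refine Runs.seq (Q₁ := (I.StateSet · 3 (I.admissibleStep U T S v))) ?_ ?_
  · refine (Runs.forLoop (B := I.aut.trans.length) (T := (processTrans u t m).maxCost)
      (fun e τ => τ.reg 16 = 5 + 3 * e ∧ ∀ q : Fin I.aut.numStates, τ.mem 3 q ≠ 0 ↔
        ∃ tr ∈ I.aut.trans.take e, tr.2.2 = q ∧ tr.1 ∈ S ∧ I.LetterOk U T v tr.2.1)
      (by norm_num) (by simp [processTrans]) (by simp [processTrans])
      (by simpa using hσ.numTrans) (fun j τ v h => by simpa using h)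
      (by simpa [StateSet] using h3) ?_).weaken le_rfl ?_
    · intro e he τ hF _ ⟨hp, hI⟩
      have hFτ : Frame (readLetter u t m) σ τ := hF₁'.trans (hF.mono
        (fun r h => by rw [readLetter, writesReg, writesReg]; exact .inr (.inl h))
        (fun r h => by rw [readLetter, writesMem, writesMem]; exact .inr (.inl h)))
      have hL := hσ.of_frame hFτ (by simp [readLetter, processTrans, advance]; omega)
        (by simp [readLetter, processTrans, advance])
      have h2 : I.StateSet τ 2 S := by
        have : τ.mem 2 = σ.mem 2 := by
          rw [hF.mem 2 (by simp [processTrans])]; simp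
        simpa [StateSet, this] using hS
      have h13 : τ.reg 13 = v := by
        rw [hF.reg 13 (by simp [processTrans])]; simpa using hv
      refine (runs_processTrans hL (hu τ hFτ) (ht τ hFτ) h13 h2 he hp).weaken le_rfl ?_
      rintro τ' _ ⟨h, h'⟩
      refine ⟨h, fun q => ?_⟩
      rw [h' q, hI q, ← List.take_concat_get' _ _ he]
      simp only [List.mem_append, List.mem_singleton, or_and_right, exists_or, exists_eq_left]
    · rintro τ _ ⟨-, h⟩ q
      rw [h q]
      simp only [List.take_length, admissibleStep, Set.mem_ofPred_eq]
      constructor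
      · rintro ⟨⟨q₁, a, q₂⟩, hm, rfl, hs, ha⟩
        exact ⟨q₁, hs, a, ha, hm⟩
      · rintro ⟨q₁, hs, a, ha, hm⟩
        exact ⟨(q₁, a, q), hm, rfl, hs, ha⟩
  · intro τ hF h
    have hL : I.Loaded τ := (hσ.of_frame hF₁ (by simp; omega) (by simp)).of_frame hF
      (by simp [processTrans]; omega) (by simp [processTrans])
    exact runs_advance hL h

theorem runs_testAccept {S : Set (Fin I.aut.numStates)} {σ : RamState} (hσ : I.Loaded σ)
    (hS : I.StateSet σ 2 S) :
    Runs testAccept σ (I.aut.numStates * 25 + 13) fun τ =>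
      (τ.reg 18 ≠ 0 ↔ σ.reg 18 ≠ 0 ∧ ∃ q ∈ S, I.aut.isAccept q = true) := by
  have hfirst : Runs (RamProg.assign 17 (const 0)) σ 2 (· = σ.setReg 17 0) :=
    .assign (by simp) rfl
  have main := hfirst.seq (T₂ := (I.aut.numStates * (14 + 8) + 6) + 5)
    (q := seq (forLoop 14 2 (RamProg.ite (get 2 (reg 14))
      (RamProg.ite (get 0 (add (reg 6) (reg 14))) (RamProg.assign 17 (const 1)) RamProg.skip)
        RamProg.skip))
      (RamProg.ite (reg 17) RamProg.skip (RamProg.assign 18 (const 0)))) (Q₂ := fun τ =>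
      (τ.reg 18 ≠ 0 ↔ σ.reg 18 ≠ 0 ∧ ∃ q ∈ S, I.aut.isAccept q = true)) ?_
  · exact Runs.weaken (p := testAccept) main (by omega) fun _ _ h => h
  rintro _ hF₁ rfl
  refine Runs.seq (Q₁ := fun τ => τ.reg 17 ≠ 0 ↔ ∃ q ∈ S, I.aut.isAccept q = true) ?_ ?_
  · refine (Runs.forLoop (B := I.aut.numStates) (T := 14)
      (fun j τ => τ.reg 17 ≠ 0 ↔ ∃ q : Fin I.aut.numStates, q < j ∧ q ∈ S ∧ I.aut.isAccept q = true)
      (by norm_num) (by simp) (by simp) (by simpa using hσ.numStates)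
      (fun j τ v h => by simpa using h) (by simp) ?_).weaken le_rfl ?_
    · intro j hj τ hF hτ hI
      have hL := (hσ.of_frame hF₁ (by simp; omega) (by simp)).of_frame hF (by simp; omega) (by simp)
      refine LoopFree.runs (by simp) (by simp) ?_
      have h2 : τ.mem 2 = σ.mem 2 := by rw [hF.mem 2 (by simp)]; simp
      have hcur := hS ⟨j, hj⟩
      have hacc := I.input_accept ⟨j, hj⟩
      have hsplit : (∃ q : Fin I.aut.numStates, q < j + 1 ∧ q ∈ S ∧ I.aut.isAccept q = true) ↔
          (∃ q : Fin I.aut.numStates, q < j ∧ q ∈ S ∧ I.aut.isAccept q = true) ∨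
            ((⟨j, hj⟩ : Fin I.aut.numStates) ∈ S ∧ I.aut.isAccept ⟨j, hj⟩ = true) := by
        constructor
        · rintro ⟨q, hq, h⟩
          by_cases hqj : (q : ℕ) = j
          · right; subst hqj; exact h
          · left; exact ⟨q, by omega, h⟩
        · rintro (⟨q, hq, h⟩ | h)
          · exact ⟨q, by omega, h⟩
          · exact ⟨⟨j, hj⟩, by simp, h⟩
      rw [hsplit, ← hI, ← hcur]
      dsimp only at hacc
      simp only [final, eval, hτ, hL.mem, hL.acceptPos, hacc, h2]
      by_cases hz : σ.mem 2 j = 0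
      · simp [hz]
      · cases hb : I.aut.isAccept ⟨j, hj⟩ <;> simp [hz]
    · intro τ _ h
      rw [h]
      simp
  · intro τ hF h
    have h18 : τ.reg 18 = σ.reg 18 := by rw [hF.reg 18 (by simp)]; simp
    refine LoopFree.runs (by simp) (by simp) ?_
    rw [← h, ← h18]
    by_cases hz : τ.reg 17 = 0 <;> simp [hz]

/-- A bound for the number of steps of `check`. -/
def checkCost (u t : ℕ → RamExpr) (m : ℕ) : ℕ := (processTrans u t m).maxCost + 200

/-- The time is `O(|C||A|)` with a constant depending on the expressions and `m` only. The flag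
accumulates the conjunction over the constraints already read. -/
theorem runs_check {u t : ℕ → RamExpr} {U : Fin m → Fin I.numVars} {T : Fin m → Fin d}
    {σ : RamState} (hσ : I.Loaded σ)
    (hu : ∀ τ, Frame (check u t m) σ τ → ∀ i : Fin m, (u i).eval τ = U i)
    (ht : ∀ τ, Frame (check u t m) σ τ → ∀ i : Fin m, (t i).eval τ = T i)
    (h3 : I.StateSet σ 3 ∅) :
    Runs (check u t m) σ (I.constraintSize * (I.aut.size * checkCost u t m) + 10) fun τ =>
      (τ.reg 18 ≠ 0 ↔ ∀ s ∈ I.scopes, I.Compatible U T s) ∧ I.StateSet τ 3 ∅ := by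
  have hfirst : Runs (RamProg.assign 18 (const 1)) σ 2 (· = σ.setReg 18 1) :=
    .assign (by simp) rfl
  have main := hfirst.seq (T₂ := I.constraintSize * ((I.aut.numStates * 14 + 6) +
    (I.aut.size * ((processTrans u t m).maxCost + 30)) + (I.aut.numStates * 25 + 13) + 36) + 8)
    (q := scan initStates (readLetter u t m) testAccept) (Q₂ := fun τ =>
      (τ.reg 18 ≠ 0 ↔ ∀ s ∈ I.scopes, I.Compatible U T s) ∧ I.StateSet τ 3 ∅) ?_
  · refine Runs.weaken (p := check u t m) main ?_ fun _ _ h => h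
    rw [← add_assoc, add_comm 2, add_assoc]
    refine Nat.add_le_add (Nat.mul_le_mul_left _ ?_) (by norm_num)
    have := I.aut.numStates_pos
    have : I.aut.numStates ≤ I.aut.size := Nat.le_add_right _ _
    rw [checkCost]
    nlinarith
  rintro _ hF₁ rfl
  have hF₁' : Frame (check u t m) σ (σ.setReg 18 1) :=
    hF₁.mono (fun r h => by simp at h; simp [check, h]) (by simp)
  have hL₁ := hσ.of_frame hF₁ (by simp; omega) (by simp)
  have toCheck : ∀ {τ}, Frame (RamProg.scan initStates (readLetter u t m) testAccept)
      (σ.setReg 18 1) τ → Frame (check u t m) σ τ := fun h =>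
    hF₁'.trans (h.mono (fun r h => by rw [check, writesReg]; exact .inr h)
      fun r h => by rw [check, writesMem]; exact .inr h)
  have loaded : ∀ {τ}, Frame (RamProg.scan initStates (readLetter u t m) testAccept)
      (σ.setReg 18 1) τ → I.Loaded τ := fun h =>
    hσ.of_frame (toCheck h) (fun r hr => by rw [check_writesReg]; omega)
      (by rw [check_writesMem]; omega)
  refine (Runs.scan
    -- Inside a constraint, array `2` holds the states reached by admissible words for the prefix
    -- read so far.
    (fun l τ => (τ.reg 18 ≠ 0 ↔ ∀ s ∈ l, I.Compatible U T s) ∧ I.StateSet τ 3 ∅)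
    (fun l s τ => (τ.reg 18 ≠ 0 ↔ ∀ s ∈ l, I.Compatible U T s) ∧ I.StateSet τ 3 ∅ ∧
      I.StateSet τ 2 (I.reached U T s)) hL₁
    ⟨by simp [initStates]; omega, by simp [initStates]⟩
    ⟨by simp [readLetter, processTrans, advance]; omega,
      by simp [readLetter, processTrans, advance]⟩
    ⟨by simp [testAccept]; omega, by simp [testAccept]⟩ ?_ ?_ ?_ ?_ ?_ ?_).weaken le_rfl ?_
  · intro l τ r v _ hr h
    have : r ≠ 18 := by omega
    simpa [StateSet, this.symm] using h
  · intro l s τ r v _ hr h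
    have : r ≠ 18 := by omega
    simpa [StateSet, this.symm] using h
  · simpa [StateSet] using h3
  · intro l s l' _ τ hF ⟨h, h'⟩
    refine (runs_initStates (loaded hF)).weaken le_rfl fun τ' hF' h2 => ⟨?_, ?_, h2⟩
    · rwa [hF'.reg 18 (by simp [initStates])]
    · simpa [StateSet, hF'.mem 3 (by simp [initStates])] using h'
  · intro l s l' a v b _ _ τ hF hv ⟨h, h', h2⟩
    have toCheck' : ∀ {τ'}, Frame (readLetter u t m) τ τ' → Frame (check u t m) σ τ' := fun hF' =>
      (toCheck hF).trans (hF'.mono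
        (fun r h => by rw [check, writesReg, scan_writesReg]; exact .inr (.inr (.inr (.inl h))))
        fun r h => by rw [check, writesMem, scan_writesMem]; exact .inr (.inr (.inl h)))
    refine (runs_readLetter (loaded hF) (fun τ' hF' => hu τ' (toCheck' hF'))
      (fun τ' hF' => ht τ' (toCheck' hF')) hv h2 h').weaken le_rfl ?_
    rintro τ' hF' ⟨h₁, h₂⟩
    refine ⟨?_, h₂, by rwa [reached_append]⟩
    rwa [hF'.reg 18 (by simp [readLetter, processTrans, advance])]
  · intro l s l' _ τ hF ⟨h, h', h2⟩
    refine (runs_testAccept (loaded hF) h2).weaken le_rfl fun τ' hF' h₁ => ⟨?_, ?_⟩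
    · rw [h₁, h, ← compatible_iff_reached]
      simp [or_imp, forall_and]
    · simpa [StateSet, hF'.mem 3 (by simp [testAccept])] using h'
  · exact fun τ _ h => h

end RamProg

/-! ## Enumerating tuples -/

open RamProg (digitSum)

/-- The functions from `Fin m` to `Fin B` in the order of `digitSum`. -/
def allTuples (B m : ℕ) : List (Fin m → Fin B) :=
  (List.finRange (B ^ m)).map finFunctionFinEquiv.symm

theorem length_allTuples (B m : ℕ) : (allTuples B m).length = B ^ m := by simp [allTuples]

theorem nodup_allTuples (B m : ℕ) : (allTuples B m).Nodup :=
  (List.nodup_finRange _).map finFunctionFinEquiv.symm.injective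

theorem mem_allTuples {B m : ℕ} (x : Fin m → Fin B) : x ∈ allTuples B m := by
  simp only [allTuples, List.mem_map, List.mem_finRange, true_and]
  exact ⟨finFunctionFinEquiv x, by simp⟩

theorem digitSum_eq {B m : ℕ} (x : Fin m → Fin B) {y : ℕ → ℕ} (h : ∀ i : Fin m, y i = x i) :
    digitSum B m y = finFunctionFinEquiv x := by
  rw [finFunctionFinEquiv_apply, digitSum, Finset.sum_range]
  exact Finset.sum_congr rfl fun i _ => by rw [h i]

/-- One more pass of the nest of loops appends exactly the tuple of its counters; this connects
`Runs.nestLoop` with lists. -/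
theorem take_allTuples {B m : ℕ} (x : Fin m → Fin B) {y : ℕ → ℕ} (h : ∀ i : Fin m, y i = x i) :
    (allTuples B m).take (digitSum B m y + 1) = (allTuples B m).take (digitSum B m y) ++ [x] := by
  have hlt : digitSum B m y < (allTuples B m).length := by
    rw [length_allTuples, digitSum_eq x h]
    exact Fin.is_lt _
  rw [← List.take_concat_get' _ _ hlt]
  congr
  simp only [allTuples, List.getElem_map, List.getElem_finRange, Equiv.symm_apply_eq]
  exact Fin.ext (digitSum_eq x h)

namespace RamProg

open RamExpr AutCSPInstance

variable {d : ℕ} {I : AutCSPInstance d}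

/-! ## The variables that occur -/

/-- Append the variable in the register `13` to the list in array `4` of the length in the
register `21` unless it has been seen before. -/
def collectVar : RamProg :=
  ite (get 5 (reg 13)) skip <| seq (store 5 (reg 13) (const 1)) <|
    seq (store 4 (reg 21) (reg 13)) (assign 21 (add (reg 21) (const 1)))

/-- List the variables that occur in array `4`. -/
def collect : RamProg := scan skip collectVar skip

/-- The variables in `vs` are listed in array `4` without repetition. -/
structure Collected (I : AutCSPInstance d) (vs l : List (Fin I.numVars)) (σ : RamState) :
    Prop where
  nodup : l.Nodup
  mem_iff : ∀ x, x ∈ l ↔ x ∈ vs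
  length : σ.reg 21 = l.length
  holds : Holds (σ.mem 4) 0 (l.map Fin.val)
  seen : ∀ x : Fin I.numVars, σ.mem 5 x ≠ 0 ↔ x ∈ l

theorem runs_collectVar {vs l : List (Fin I.numVars)} {v : Fin I.numVars} {σ : RamState}
    (hv : σ.reg 13 = v) (h : Collected I vs l σ) :
    Runs collectVar σ 20 fun τ => ∃ l, Collected I (vs ++ [v]) l τ := by
  refine LoopFree.runs (by simp [collectVar]) (by simp [collectVar]) ?_
  obtain ⟨h1, h2, h3, h4, h5⟩ := h
  by_cases hseen : v ∈ l
  · have h0 := (h5 v).2 hseen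
    simp only [collectVar, final, eval, hv, if_neg h0]
    refine ⟨l, h1, fun x => ?_, h3, h4, h5⟩
    rw [List.mem_append, List.mem_singleton, h2]
    constructor
    · exact .inl
    · rintro (h | rfl)
      exacts [h, (h2 _).1 hseen]
  · have h0 : σ.mem 5 v = 0 := by
      by_contra h0
      exact hseen ((h5 v).1 h0)
    simp only [collectVar, final, eval, hv, if_pos h0]
    refine ⟨l ++ [v], ?_, fun x => ?_, by simp [h3], ?_, fun x => ?_⟩
    · exact List.nodup_append.2 ⟨h1, by simp, by
        rintro a ha b hb rfl
        exact hseen (by simpa using (List.mem_singleton.1 hb) ▸ ha)⟩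
    · rw [List.mem_append, List.mem_append, h2]
    · rw [List.map_append, holds_append]
      refine ⟨h4.congr fun j _ hj => ?_, by simp [h3, hv]⟩
      have : ¬ j = l.length := by simp at hj; omega
      simp [h3, this]
    · have := h5 x
      by_cases hx : x = v
      · simp [hx]
      · have : ¬ (x : ℕ) = v := fun h => hx (Fin.ext h)
        simp only [RamState.setReg_mem, RamState.setMem_mem]
        simpa [this, hx] using h5 x

theorem collect_writesReg (r : ℕ) : collect.writesReg r ↔ (9 ≤ r ∧ r ≤ 13) ∨ r = 21 := by
  simp only [collect, scan_writesReg, collectVar, writesReg, or_false, false_or]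

theorem collect_writesMem (a : ℕ) : collect.writesMem a ↔ a = 4 ∨ a = 5 := by
  simp only [collect, scan_writesMem, collectVar, writesMem, or_false, false_or]
  tauto

/-- Looking up a mark in array `5` takes constant time, and the marks are zero from the start. So
the time depends on `|C|` and not on the number of variables, as the bound in (a) demands. -/
theorem runs_collect {σ : RamState} (hσ : I.Loaded σ) (h21 : σ.reg 21 = 0)
    (h5 : ∀ j, σ.mem 5 j = 0) :
    Runs collect σ (I.constraintSize * 58 + 8) fun τ =>
      ∃ l, Collected I I.scopes.flatten l τ := by
  have hins : ∀ vs τ r v, 9 ≤ r → r ≤ 13 → (∃ l, Collected I vs l τ) →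
      ∃ l, Collected I vs l (τ.setReg r v) := by
    rintro vs τ r v _ hr ⟨l, h1, h2, h3, h4, h5⟩
    have : ¬ 21 = r := by omega
    exact ⟨l, h1, h2, by simpa [this] using h3, h4, h5⟩
  refine Runs.scan (T₁ := 1) (T₂ := 20) (T₃ := 1)
    (fun l τ => ∃ l', Collected I l.flatten l' τ)
    (fun l s τ => ∃ l', Collected I (l.flatten ++ s) l' τ) hσ ⟨by simp, by simp⟩
    ⟨by simp [collectVar]; omega, by simp [collectVar]⟩ ⟨by simp, by simp⟩
    (fun l => hins _) (fun l s => hins _) ?_ ?_ ?_ ?_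
  · exact ⟨[], by simp, by simp, by simpa using h21, by simp, by simp [h5]⟩
  · intro l s l' _ τ _ h
    exact .skip le_rfl (by simpa using h)
  · rintro l s l' a v b _ _ τ _ hv ⟨l₁, h⟩
    rw [← List.append_assoc]
    exact runs_collectVar hv h
  · intro l s l' _ τ _ h
    exact .skip le_rfl (by simpa using h)

/-! ## The decomposition -/

/-- Append the values of `m` expressions to the output; the register `19` is the end of the
output. -/
def emit (e : ℕ → RamExpr) : ℕ → RamProg
  | 0 => skip
  | m + 1 => seq (emit e m) (seq (store 1 (reg 19) (e m)) (assign 19 (add (reg 19) (const 1))))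

theorem emit_writesReg {e : ℕ → RamExpr} {m r : ℕ} (h : (emit e m).writesReg r) : r = 19 := by
  induction m with
  | zero => exact h.elim
  | succ m ih =>
    simp only [emit, writesReg, false_or] at h
    exact h.elim ih id

theorem emit_writesMem {e : ℕ → RamExpr} {m a : ℕ} (h : (emit e m).writesMem a) : a = 1 := by
  induction m with
  | zero => exact h.elim
  | succ m ih =>
    simp only [emit, writesMem, or_false] at h
    exact h.elim ih id

/-- The values are required in all states that differ from `σ` only in the output and its end
pointer, because later expressions are evaluated after earlier ones have been written. -/
theorem runs_emit {e : ℕ → RamExpr} {m : ℕ} {σ : RamState} (x : Fin m → ℕ)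
    (he : ∀ τ : RamState, (∀ r, r ≠ 19 → τ.reg r = σ.reg r) → (∀ a, a ≠ 1 → τ.mem a = σ.mem a) →
      ∀ i : Fin m, (e i).eval τ = x i) :
    Runs (emit e m) σ (emit e m).maxCost fun τ => τ.reg 19 = σ.reg 19 + m ∧
      Holds (τ.mem 1) (σ.reg 19) (List.ofFn x) ∧ ∀ j < σ.reg 19, τ.mem 1 j = σ.mem 1 j := by
  induction m with
  | zero => exact .skip le_rfl ⟨rfl, by simp, fun _ _ => rfl⟩
  | succ m ih =>
    refine (ih (fun i => x i.castSucc) fun τ hr hm i => he τ hr hm i.castSucc).seq ?_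
    rintro τ hF ⟨h1, h2, h3⟩
    have hlast := he τ (fun r hr => hF.reg r (mt emit_writesReg hr))
      (fun a ha => hF.mem a (mt emit_writesMem ha)) (Fin.last m)
    refine LoopFree.runs (by simp) le_rfl ?_
    have hx : List.ofFn x = List.ofFn (fun i : Fin m => x i.castSucc) ++ [x (Fin.last m)] := by
      rw [List.ofFn_succ', List.concat_eq_append]
    refine ⟨by simp [h1]; ring, ?_, fun j hj => ?_⟩
    · rw [hx, holds_append]
      refine ⟨h2.congr fun j _ hj => ?_, ?_⟩
      · have : ¬ j = σ.reg 19 + m := by simp at hj; omega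
        simp [h1, this]
      · have := hlast
        simp only [Fin.val_last] at this
        simp [h1, this]
    · have : ¬ j = σ.reg 19 + m := by omega
      simp [h1, this, h3 j hj]

/-- The `i`-th variable of the current tuple. -/
def scopeVar (i : ℕ) : RamExpr := get 4 (reg (100 + i))

/-- The `i`-th value of the current tuple. -/
def tupleVal (m i : ℕ) : RamExpr := reg (100 + m + i)

/-- Append the current tuple of values to the output if it is compatible with all constraints. -/
def outputTuple (m : ℕ) : RamProg :=
  seq (check scopeVar (tupleVal m) m) <| ite (reg 18)
    (seq (store 1 (reg 20) (add (get 1 (reg 20)) (const 1))) (emit (tupleVal m) m)) skip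

/-- Append the constraint for the current tuple of variables to the output. -/
def outputConstraint (m : ℕ) : RamProg :=
  seq (store 1 (const 2) (add (get 1 (const 2)) (const 1))) <| seq (emit scopeVar m) <|
  seq (seq (assign 20 (reg 19)) <| seq (store 1 (reg 20) (const 0))
    (assign 19 (add (reg 19) (const 1))))
  (nestLoop (100 + m) 1 (outputTuple m) m)

/-- Construct the decomposition of an instance into constraints of arity `m`. -/
def decompose (m : ℕ) : RamProg :=
  seq loadHeader <| seq collect <|
  seq (seq (store 1 (const 0) (reg 0)) <| seq (store 1 (const 1) (reg 1)) <|
    seq (store 1 (const 2) (const 0)) (assign 19 (const 3)))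
  (nestLoop 100 21 (outputConstraint m) m)

end RamProg

namespace AutCSPInstance

variable {d m : ℕ} (I : AutCSPInstance d) (u : Fin m → Fin I.numVars)

open Classical in
/-- The tuples in `l` that are compatible with all constraints. -/
noncomputable def compatibleTuples (l : List (Fin m → Fin d)) : List (Fin m → Fin d) :=
  l.filter fun t => ∀ s ∈ I.scopes, I.Compatible u t s

variable {I u}

@[simp] theorem compatibleTuples_nil : I.compatibleTuples u [] = [] := rfl

theorem mem_compatibleTuples {l : List (Fin m → Fin d)} {t : Fin m → Fin d} :
    t ∈ I.compatibleTuples u l ↔ t ∈ l ∧ ∀ s ∈ I.scopes, I.Compatible u t s := by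
  simp [compatibleTuples]

theorem compatibleTuples_append_of_forall {l : List (Fin m → Fin d)} {t : Fin m → Fin d}
    (h : ∀ s ∈ I.scopes, I.Compatible u t s) :
    I.compatibleTuples u (l ++ [t]) = I.compatibleTuples u l ++ [t] := by
  classical
  simp only [compatibleTuples, List.filter_append, List.filter_singleton, decide_eq_true h,
    cond_true]

theorem compatibleTuples_append_of_not_forall {l : List (Fin m → Fin d)} {t : Fin m → Fin d}
    (h : ¬ ∀ s ∈ I.scopes, I.Compatible u t s) :
    I.compatibleTuples u (l ++ [t]) = I.compatibleTuples u l := by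
  classical
  simp only [compatibleTuples, List.filter_append, List.filter_singleton, decide_eq_false h,
    cond_false, List.append_nil]

variable (I u)

/-- The constraint for the variables `u`: the tuples compatible with all constraints of `I`. -/
noncomputable def localConstraint : ExplicitConstraint I.numVars d m where
  scope := u
  tuples := I.compatibleTuples u (allTuples d m)
  tuples_nodup := (nodup_allTuples d m).filter _

end AutCSPInstance

/-- The list of the entries of a list of tuples. -/
abbrev encodeTuples {d m : ℕ} (l : List (Fin m → Fin d)) : List ℕ :=
  l.flatMap fun x => List.ofFn fun j => (x j : ℕ)

namespace RamProg

open RamExpr AutCSPInstance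

variable {d m : ℕ} {I : AutCSPInstance d}

/-- A bound for the number of steps of `outputTuple`. -/
def outputTupleCost (I : AutCSPInstance d) (m : ℕ) : ℕ :=
  I.constraintSize * (I.aut.size * checkCost scopeVar (tupleVal m) m) +
    (20 + (emit (tupleVal m) m).maxCost)

theorem outputTuple_writesReg {r : ℕ} (h : (outputTuple m).writesReg r) : 9 ≤ r ∧ r ≤ 19 := by
  simp only [outputTuple, writesReg, check_writesReg] at h
  rcases h with h | (h | h) | h
  · omega
  · exact h.elim
  · have := emit_writesReg h; omega
  · exact h.elim

theorem outputTuple_writesMem {a : ℕ} (h : (outputTuple m).writesMem a) : 1 ≤ a ∧ a ≤ 3 := by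
  simp only [outputTuple, writesMem, check_writesMem] at h
  rcases h with h | (h | h) | h
  · omega
  · omega
  · have := emit_writesMem h; omega
  · exact h.elim

/-- The count at the address `q` and the list of the tuples in `l` that are compatible with all
constraints. -/
structure TuplesWritten (I : AutCSPInstance d) (u : Fin m → Fin I.numVars) (q : ℕ) (σ : RamState)
    (l : List (Fin m → Fin d)) (τ : RamState) : Prop where
  pos : τ.reg 20 = q
  count : τ.mem 1 q = (I.compatibleTuples u l).length
  next_cell : τ.reg 19 = q + 1 + (encodeTuples (I.compatibleTuples u l)).length
  holds : Holds (τ.mem 1) (q + 1) (encodeTuples (I.compatibleTuples u l))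
  states : I.StateSet τ 3 ∅
  old : ∀ j < q, τ.mem 1 j = σ.mem 1 j

/-- The number of tuples precedes the tuples in the encoding but is not known in advance; the cell
`q` is reserved for it and incremented with each tuple. -/
theorem runs_outputTuple {u : Fin m → Fin I.numVars} {t : Fin m → Fin d} {q : ℕ} {σ₀ σ : RamState}
    {l : List (Fin m → Fin d)} (hσ : I.Loaded σ)
    (hu : ∀ i : Fin m, σ.mem 4 (σ.reg (100 + i)) = u i)
    (ht : ∀ i : Fin m, σ.reg (100 + m + i) = t i) (h : TuplesWritten I u q σ₀ l σ) :
    Runs (outputTuple m) σ (outputTupleCost I m) (TuplesWritten I u q σ₀ (l ++ [t])) := by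
  obtain ⟨h1, h2, h3, h4, h5, h6⟩ := h
  have hcheck := runs_check (u := scopeVar) (t := tupleVal m) (U := u) (T := t) hσ
    (fun τ hF i => by
      rw [scopeVar, eval, eval, hF.mem 4 (by simp [check_writesMem]),
        hF.reg _ (by rw [check_writesReg]; omega), hu])
    (fun τ hF i => by rw [tupleVal, eval, hF.reg _ (by rw [check_writesReg]; omega), ht]) h5
  refine Runs.weaken (hcheck.seq (T₂ := 10 + (emit (tupleVal m) m).maxCost)
    (Q₂ := TuplesWritten I u q σ₀ (l ++ [t])) ?_) (by rw [outputTupleCost]; omega) fun _ _ h => h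
  rintro τ hF ⟨hflag, h5'⟩
  have h20 : τ.reg 20 = q := by rw [hF.reg _ (by simp [check_writesReg]), h1]
  have h19 := hF.reg 19 (by simp [check_writesReg])
  have hmem1 := hF.mem 1 (by simp [check_writesMem])
  refine (Runs.ite (T := 8 + (emit (tupleVal m) m).maxCost) (fun hf => ?_)
    fun hf => ?_).weaken (by simp; omega) fun _ _ h => h
  · have hgood := hflag.1 hf
    have hstore : Runs (RamProg.store 1 (reg 20) (add (get 1 (reg 20)) (const 1))) τ 8
        (· = τ.setMem 1 q (τ.mem 1 q + 1)) :=
      LoopFree.runs (by simp) (by simp) (by simp [h20])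
    refine hstore.seq ?_
    rintro _ hF' rfl
    refine (runs_emit (fun i => (t i : ℕ)) fun τ' hr _ i => ?_).weaken le_rfl ?_
    · rw [tupleVal, eval, hr _ (by omega), RamState.setMem_reg,
        hF.reg _ (by rw [check_writesReg]; omega), ht]
    · rintro τ' hF'' ⟨e1, e2, e3⟩
      simp only [RamState.setMem_reg, h19, h3] at e1 e2 e3
      -- Below the old end of the output, only the count has changed.
      have hnew : ∀ j < q + 1 + (encodeTuples (I.compatibleTuples u l)).length,
          τ'.mem 1 j = if j = q then σ.mem 1 q + 1 else σ.mem 1 j := fun j hj => by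
        rw [e3 j hj]
        simp [hmem1]
      have hfil := compatibleTuples_append_of_forall (l := l) hgood
      refine ⟨?_, ?_, ?_, ?_, ?_, ?_⟩
      · rw [hF''.reg 20 (fun h => by have := emit_writesReg h; omega)]
        simpa using h20
      · rw [hnew q (by omega), hfil, if_pos rfl, h2]; simp
      · rw [e1, hfil]; simp; ring
      · rw [hfil, encodeTuples, List.flatMap_append, holds_append]
        refine ⟨h4.congr fun j hj hj' => ?_, by simpa using e2⟩
        rw [hnew j hj', if_neg (by omega)]
      · have : τ'.mem 3 = τ.mem 3 := by
          rw [hF''.mem 3 (fun h => by have := emit_writesMem h; omega)]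
          funext j; simp
        simpa [StateSet, this] using h5'
      · intro j hj
        rw [hnew j (by omega), if_neg (by omega), h6 j hj]
  · refine .skip (by omega) ?_
    have hbad : ¬ ∀ s ∈ I.scopes, I.Compatible u t s := fun h => hflag.2 h hf
    have hfil := compatibleTuples_append_of_not_forall (l := l) hbad
    exact ⟨h20, by rw [hfil, hmem1, h2], by rw [hfil, h19, h3], by rw [hfil, hmem1]; exact h4, h5',
      by rw [hmem1]; exact h6⟩

/-- A bound for the number of steps of `outputConstraint`. -/
def outputConstraintCost (I : AutCSPInstance d) (m : ℕ) : ℕ :=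
  20 + (emit scopeVar m).maxCost + nestCost d (outputTupleCost I m) m

theorem outputConstraint_writesReg {r : ℕ} (h : (outputConstraint m).writesReg r) :
    (9 ≤ r ∧ r ≤ 20) ∨ (100 + m ≤ r) := by
  simp only [outputConstraint, writesReg, nestLoop_writesReg, false_or] at h
  rcases h with h | (h | h) | h | h
  · have := emit_writesReg h; omega
  · omega
  · omega
  · omega
  · have := outputTuple_writesReg h; omega

theorem outputConstraint_writesMem {a : ℕ} (h : (outputConstraint m).writesMem a) :
    1 ≤ a ∧ a ≤ 3 := by
  simp only [outputConstraint, writesMem, nestLoop_writesMem, false_or, or_false] at h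
  rcases h with h | h | h | h
  · omega
  · have := emit_writesMem h; omega
  · omega
  · exact outputTuple_writesMem h

/-- The constraints in `L` have been written. -/
structure ConstraintsWritten (I : AutCSPInstance d)
    (L : List (ExplicitConstraint I.numVars d m)) (τ : RamState) : Prop where
  holds : Holds (τ.mem 1) 0 (ExplicitConstraint.encodeInstance L)
  next_cell : τ.reg 19 = (ExplicitConstraint.encodeInstance L).length
  states : I.StateSet τ 3 ∅

/-- The number of constraints, in cell `2`, is likewise kept up to date while the output grows. All
older cells except this one persist. -/
theorem runs_outputConstraint {u : Fin m → Fin I.numVars} {σ : RamState}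
    {L : List (ExplicitConstraint I.numVars d m)} (hσ : I.Loaded σ)
    (hu : ∀ i : Fin m, σ.mem 4 (σ.reg (100 + i)) = u i) (h : ConstraintsWritten I L σ) :
    Runs (outputConstraint m) σ (outputConstraintCost I m)
      (ConstraintsWritten I (L ++ [I.localConstraint u])) := by
  obtain ⟨h1, h2, h3⟩ := h
  have hlen : (ExplicitConstraint.encodeInstance L).length =
      3 + (L.flatMap ExplicitConstraint.encode).length := by
    simp [ExplicitConstraint.encodeInstance]; omega
  simp only [ExplicitConstraint.encodeInstance, holds_append, holds_cons, holds_nil, and_true,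
    zero_add, List.length_cons, List.length_nil] at h1
  obtain ⟨⟨hm0, hm1, hm2⟩, hmL⟩ := h1
  norm_num at hm0 hm1 hm2 hmL
  have hfirst : Runs (RamProg.store 1 (const 2) (add (get 1 (const 2)) (const 1))) σ 6
      (· = σ.setMem 1 2 (L.length + 1)) :=
    LoopFree.runs (by simp) (by simp) (by simp [hm2])
  refine Runs.weaken (hfirst.seq (T₂ := (emit scopeVar m).maxCost +
    (12 + nestCost d (outputTupleCost I m) m))
    (Q₂ := ConstraintsWritten I (L ++ [I.localConstraint u])) ?_)
    (by rw [outputConstraintCost]; omega) fun _ _ h => h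
  rintro _ hF₁ rfl
  refine Runs.seq (runs_emit (fun i => (u i : ℕ)) fun τ hr hm i => ?_) ?_
  · rw [scopeVar, eval, eval, hr _ (by omega), hm 4 (by norm_num)]
    simpa using hu i
  rintro τ₁ hF₂ ⟨e1, e2, e3⟩
  simp only [RamState.setMem_reg, h2] at e1 e2 e3
  set p := (ExplicitConstraint.encodeInstance L).length with hp
  have hcopy : Runs (RamProg.seq (RamProg.assign 20 (reg 19)) <|
      RamProg.seq (RamProg.store 1 (reg 20) (const 0)) (RamProg.assign 19 (add (reg 19) (const 1)))) τ₁
      12 (· = ((τ₁.setReg 20 (p + m)).setMem 1 (p + m) 0).setReg 19 (p + m + 1)) :=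
    LoopFree.runs (by simp) (by simp) (by simp [e1])
  refine hcopy.seq ?_
  rintro σ₁ hF₃ hσ₁
  have hL₁ : I.Loaded σ₁ := by
    refine ((hσ.of_frame hF₁ (by simp) (by simp)).of_frame hF₂ (fun r hr h => ?_)
      (fun h => ?_)).of_frame hF₃ (by simp; omega) (by simp)
    · have := emit_writesReg h; omega
    · have := emit_writesMem h; omega
  have hu₁ : ∀ i : Fin m, σ₁.mem 4 (σ₁.reg (100 + i)) = u i := by
    intro i
    rw [hF₃.mem 4 (by simp), hF₂.mem 4 (fun h => by have := emit_writesMem h; omega),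
      hF₃.reg _ (by simp; omega), hF₂.reg _ (fun h => by have := emit_writesReg h; omega)]
    simpa using hu i
  have hs₁ : I.StateSet σ₁ 3 ∅ := by
    intro q
    rw [← h3 q, hF₃.mem 3 (by simp), hF₂.mem 3 (fun h => by have := emit_writesMem h; omega)]
    simp
  have hold : ∀ j < p + m, σ₁.mem 1 j = τ₁.mem 1 j := by
    intro j hj
    have : ¬ j = p + m := by omega
    simp [hσ₁, this]
  have hnest := Runs.nestLoop (r := 100 + m) (b := 1) (B := d) (T := outputTupleCost I m)
    (body := outputTuple m) (m := m) (σ := σ₁)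
    (fun e => TuplesWritten I u (p + m) σ₁ ((allTuples d m).take e)) (by omega)
    (fun s hs _ h => by have := outputTuple_writesReg h; omega)
    (fun h => by have := outputTuple_writesReg h; omega) hL₁.domain ?_ ?_ ?_
  · refine hnest.weaken le_rfl ?_
    rintro τ _ ⟨g1, g2, g3, g4, g5, g6⟩
    rw [List.take_of_length_le (by rw [length_allTuples])] at g2 g3 g4
    have htup : ∀ j < p, τ.mem 1 j = if j = 2 then L.length + 1 else σ.mem 1 j := by
      intro j hj
      rw [g6 j (by omega), hold j (by omega), e3 j hj]
      simp
    have henc : ExplicitConstraint.encode (I.localConstraint u) =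
        List.ofFn (fun j => (u j : ℕ)) ++ [(I.localConstraint u).tuples.length] ++
          (I.localConstraint u).tuples.flatMap fun x => List.ofFn fun j => (x j : ℕ) := rfl
    refine ⟨?_, ?_, g5⟩
    · simp only [ExplicitConstraint.encodeInstance, holds_append, holds_cons, holds_nil, and_true,
        zero_add, List.length_cons, List.length_nil, List.flatMap_append, List.flatMap_singleton,
        List.length_append]
      refine ⟨⟨?_, ?_, ?_⟩, ?_, ?_⟩
      · rw [htup 0 (by omega), if_neg (by norm_num), hm0]
      · rw [htup 1 (by omega), if_neg (by norm_num), hm1]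
      · rw [htup _ (by omega), if_pos rfl]
      · refine hmL.congr fun j hj hj' => ?_
        rw [htup j (by omega), if_neg (by omega)]
      · rw [show 1 + 1 + 1 + (L.flatMap ExplicitConstraint.encode).length = p by omega, henc,
          holds_append, holds_append]
        refine ⟨⟨e2.congr fun j hj hj' => ?_, ?_⟩, ?_⟩
        · simp only [List.length_ofFn] at hj'
          rw [g6 j (by omega), hold j (by omega)]
        · simpa [localConstraint] using g2
        · simpa [add_assoc, localConstraint] using g4
    · rw [g3]
      simp only [ExplicitConstraint.encodeInstance, List.flatMap_append, List.length_append, henc,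
        List.flatMap_singleton, List.length_cons, List.length_nil, List.length_ofFn] at hp ⊢
      rw [hp]
      simp only [localConstraint]
      ring
  · rintro j τ s v hs _ ⟨g1, g2, g3, g4, g5, g6⟩
    have h20 : ¬ 20 = s := by omega
    have h19 : ¬ 19 = s := by omega
    exact ⟨by simpa [h20] using g1, g2, by simpa [h19] using g3, g4, g5, g6⟩
  · refine ⟨by simp [hσ₁], by simp [hσ₁], by simp [hσ₁], by simp, hs₁, fun _ _ => rfl⟩
  · intro x hx τ hF hxr hI
    have hw : ∀ r, r < 100 + m → ¬ (9 ≤ r ∧ r ≤ 19) →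
        ¬ (nestLoop (100 + m) 1 (outputTuple m) m).writesReg r := fun r hr hr' h => by
      rcases (nestLoop_writesReg _ _ _ _ _).1 h with h | h
      · omega
      · exact hr' (outputTuple_writesReg h)
    have hwm : ∀ a, ¬ (1 ≤ a ∧ a ≤ 3) →
        ¬ (nestLoop (100 + m) 1 (outputTuple m) m).writesMem a := fun a ha h =>
      ha (outputTuple_writesMem ((nestLoop_writesMem _ _ _ _ _).1 h))
    have hLτ := hL₁.of_frame hF (fun r hr => hw r (by omega) (by omega)) (hwm 0 (by omega))
    rw [take_allTuples (fun i => ⟨x i, hx i i.2⟩) fun _ => rfl]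
    refine runs_outputTuple hLτ (fun i => ?_) (fun i => hxr i i.2) hI
    rw [hF.mem 4 (hwm 4 (by omega)), hF.reg _ (hw _ (by omega) (by omega)), hu₁]

/-- A bound for the number of steps of `decompose`, for `v` occurring variables. -/
def decomposeCost (I : AutCSPInstance d) (m v : ℕ) : ℕ :=
  I.constraintSize * 58 + 60 + nestCost v (outputConstraintCost I m) m

/-- The loops run through the list `l` of occurring variables instead of all variables; each has at
most `|C|` passes, and distinct counters give distinct scopes since `l` has no repetition. -/
theorem runs_decompose (I : AutCSPInstance d) (m : ℕ) :
    ∃ l : List (Fin I.numVars), l.Nodup ∧ (∀ x, x ∈ l ↔ I.Occurs x) ∧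
      l.length ≤ I.constraintSize ∧
      Runs (decompose m) (RamState.initial I.encode) (decomposeCost I m l.length) fun τ =>
        Holds (τ.mem 1) 0 (ExplicitConstraint.encodeInstance
          ((allTuples l.length m).map fun x => I.localConstraint fun i => l.get (x i))) := by
  obtain ⟨t₁, σ₁, hE₁, ht₁, hL₁⟩ := runs_loadHeader I
  have hF₁ := hE₁.frame
  have hmem : ∀ a, a ≠ 0 → ∀ j, σ₁.mem a j = 0 := fun a ha j => by
    rw [hF₁.mem a (by simp [loadHeader])]
    simp [RamState.initial, ha]
  have h21 : σ₁.reg 21 = 0 := by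
    rw [hF₁.reg 21 (by simp [loadHeader])]
    simp [RamState.initial]
  obtain ⟨t₂, σ₂, hE₂, ht₂, l, hl⟩ := runs_collect hL₁ h21 (hmem 5 (by norm_num))
  have hF₂ := hE₂.frame
  have hL₂ := hL₁.of_frame hF₂ (fun r hr => by rw [collect_writesReg]; omega)
    (by rw [collect_writesMem]; omega)
  have hmem₂ : ∀ a, a ≠ 0 → a ≠ 4 → a ≠ 5 → ∀ j, σ₂.mem a j = 0 := fun a ha ha' ha'' j => by
    rw [hF₂.mem a (by rw [collect_writesMem]; omega), hmem a ha]
  refine ⟨l, hl.nodup, fun x => by simp [hl.mem_iff, Occurs, List.mem_flatten], ?_, ?_⟩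
  · have : l.length ≤ I.scopes.flatten.length :=
      (List.subperm_of_subset hl.nodup fun x hx => (hl.mem_iff x).1 hx).length_le
    rwa [List.length_flatten] at this
  obtain ⟨t₃, σ₃, hE₃, ht₃, hσ₃⟩ : Runs (seq (store 1 (const 0) (reg 0)) <|
      seq (store 1 (const 1) (reg 1)) <| seq (store 1 (const 2) (const 0)) (assign 19 (const 3)))
      σ₂ 20 (· = (((σ₂.setMem 1 0 I.numVars).setMem 1 1 d).setMem 1 2 0).setReg 19 3) :=
    LoopFree.runs (by simp) (by simp) (by simp [hL₂.numVars, hL₂.domain])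
  have hF₃ := hE₃.frame
  have hL₃ := hL₂.of_frame hF₃ (by simp; omega) (by simp)
  have hw : ∀ r, r < 100 → ¬ (9 ≤ r ∧ r ≤ 20) →
      ¬ (nestLoop 100 21 (outputConstraint m) m).writesReg r := fun r hr hr' h => by
    rcases (nestLoop_writesReg _ _ _ _ _).1 h with h | h
    · omega
    · have := outputConstraint_writesReg h; omega
  have hwm : ∀ a, ¬ (1 ≤ a ∧ a ≤ 3) →
      ¬ (nestLoop 100 21 (outputConstraint m) m).writesMem a := fun a ha h =>
    ha (outputConstraint_writesMem ((nestLoop_writesMem _ _ _ _ _).1 h))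
  have hnest := Runs.nestLoop (r := 100) (b := 21) (B := l.length)
    (T := outputConstraintCost I m) (body := outputConstraint m) (m := m) (σ := σ₃)
    (fun e => ConstraintsWritten I (((allTuples l.length m).take e).map
      fun x => I.localConstraint fun i => l.get (x i))) (by omega)
    (fun s hs _ h => by have := outputConstraint_writesReg h; omega)
    (fun h => by have := outputConstraint_writesReg h; omega)
    (by rw [hF₃.reg 21 (by simp), hl.length]) ?_ ?_ ?_
  · obtain ⟨t₄, σ₄, hE₄, ht₄, hσ₄⟩ := hnest
    refine ⟨_, σ₄, hE₁.seq (hE₂.seq (hE₃.seq hE₄)), ?_, ?_⟩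
    · rw [decomposeCost]; omega
    · have := hσ₄.holds
      rwa [List.take_of_length_le (by rw [length_allTuples])] at this
  · rintro j τ s v hs _ ⟨g1, g2, g3⟩
    have h19 : ¬ 19 = s := by omega
    exact ⟨g1, by simpa [h19] using g2, g3⟩
  · refine ⟨by simp [hσ₃, ExplicitConstraint.encodeInstance],
      by simp [hσ₃, ExplicitConstraint.encodeInstance], fun q => ?_⟩
    simp [hσ₃, hmem₂ 3]
  · intro x hx τ hF hxr hI
    have hLτ := hL₃.of_frame hF (fun r hr => hw r (by omega) (by omega)) (hwm 0 (by omega))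
    rw [take_allTuples (fun i => ⟨x i, hx i i.2⟩) fun _ => rfl, List.map_append, List.map_singleton]
    refine runs_outputConstraint hLτ (fun i => ?_) hI
    rw [hF.mem 4 (hwm 4 (by omega)), hF₃.mem 4 (by simp), hxr i i.2]
    have := (holds_iff_getElem _ _ _).1 hl.holds (x i) (by simpa using hx i i.2)
    simpa using this

/-- At most `|C| ^ m` scopes, `d ^ m` tuples for each and `O(|C||A|)` steps per tuple; this product
absorbs the lower terms as soon as `|C|` is positive. -/
theorem decomposeCost_le (m : ℕ) : ∃ c, ∀ (d : ℕ), 0 < d → ∀ (I : AutCSPInstance d) (v : ℕ),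
    v ≤ I.constraintSize →
      decomposeCost I m v ≤ c * (I.constraintSize ^ (m + 1) * I.aut.size * d ^ m + 1) := by
  set K := checkCost scopeVar (tupleVal m) m with hK
  set a := 20 + (emit (tupleVal m) m).maxCost with ha
  set b := 20 + (emit scopeVar m).maxCost with hb
  refine ⟨58 + 60 + (b + K + a + 28 * m) + 6, fun d hd I v hv => ?_⟩
  have hS : 1 ≤ I.aut.size := le_add_right I.aut.numStates_pos
  have hdm : 1 ≤ d ^ m := Nat.one_le_pow _ _ hd
  have hT : outputConstraintCost I m ≤
      d ^ m * (b + I.constraintSize * (I.aut.size * K) + a + 14 * m) := by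
    have h := nestCost_le d (outputTupleCost I m) m hd
    rw [outputTupleCost, ← hK, ← ha] at h
    rw [outputConstraintCost, ← hb, outputTupleCost, ← hK, ← ha]
    nlinarith
  rw [decomposeCost]
  -- If `|C| = 0`, no variable occurs. A nest of loops then ends at once, but for `m = 0` its body
  -- still runs for the empty scope; the summand 1 in the bound pays for this.
  rcases Nat.eq_zero_or_pos I.constraintSize with h0 | hpos
  · have hv0 : v = 0 := by omega
    have : nestCost v (outputConstraintCost I m) m ≤ (b + K + a + 28 * m) + 6 := by
      rcases m with _ | m
      · simp [h0] at hT
        simp only [nestCost]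
        omega
      · simp [nestCost, hv0]
    rw [h0]
    simp
    omega
  · have hC : 1 ≤ I.constraintSize ^ m := Nat.one_le_pow _ _ hpos
    have hn : nestCost v (outputConstraintCost I m) m ≤
        6 + I.constraintSize ^ m * (outputConstraintCost I m + 14 * m) := by
      rcases Nat.eq_zero_or_pos v with hv0 | hv0
      · rcases m with _ | m
        · simp [nestCost]
        · simp [nestCost, hv0]
      · refine (nestCost_le v _ m hv0).trans (le_add_left ?_)
        exact Nat.mul_le_mul_right _ (Nat.pow_le_pow_left hv m)
    set C := I.constraintSize
    set S := I.aut.size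
    set E := d ^ m
    have hX : 1 ≤ C * S := Nat.mul_pos hpos hS
    have h1 : outputConstraintCost I m + 14 * m ≤ E * (C * S * (b + K + a + 28 * m)) := by
      have : b + C * (S * K) + a + 14 * m + 14 * m ≤ C * S * (b + K + a + 28 * m) := by nlinarith
      calc _ ≤ E * (b + C * (S * K) + a + 14 * m) + E * (14 * m) :=
            add_le_add hT (Nat.le_mul_of_pos_left _ hdm)
        _ = E * (b + C * (S * K) + a + 14 * m + 14 * m) := by ring
        _ ≤ _ := Nat.mul_le_mul_left _ this
    have h2 : C ^ m * (outputConstraintCost I m + 14 * m) ≤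
        (b + K + a + 28 * m) * (C ^ (m + 1) * S * E) := by
      calc _ ≤ C ^ m * (E * (C * S * (b + K + a + 28 * m))) := Nat.mul_le_mul_left _ h1
        _ = _ := by ring
    have h3 : C ≤ C ^ (m + 1) * S * E := by
      calc C = 1 * C * 1 * 1 := by ring
        _ ≤ C ^ m * C * S * E := by gcongr
        _ = _ := by ring
    nlinarith

end RamProg

/-- The algorithm for the construction of an equivalent instance with constraints of arity
`k - 1`. -/
theorem exists_decomposition (k : ℕ) (hk : 1 ≤ k) :
    ∃ (p : RamProg) (c : ℕ), ∀ (d : ℕ), 0 < d →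
      ∀ g : (Fin k → Fin d) → Fin d, IsNearUnanimity g →
      ∀ I : AutCSPInstance d, I.aut ∈ FinAutomaton.classK g →
        ∃ (L : List (ExplicitConstraint I.numVars d (k - 1))) (t : ℕ),
          p.Computes I.encode (ExplicitConstraint.encodeInstance L) t ∧
          t ≤ c * (I.constraintSize ^ k * I.aut.size * d ^ (k - 1) + 1) ∧
          (L.map ExplicitConstraint.scope).Nodup ∧
          (∀ u : Fin (k - 1) → Fin I.numVars,
            u ∈ L.map ExplicitConstraint.scope ↔ ∀ j, I.Occurs (u j)) ∧
          (∀ P ∈ L, P.rel ∈ InvRel g (k - 1)) ∧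
          (∀ ψ : Fin I.numVars → Fin d,
            IsSolution ψ I.constraints ↔
              IsSolution ψ {P | ∃ P' ∈ L, P = P'.toConstraint}) := by
  obtain ⟨c, hc⟩ := RamProg.decomposeCost_le (k - 1)
  refine ⟨RamProg.decompose (k - 1), c, fun d hd g hg I hI => ?_⟩
  obtain ⟨l, hl, hocc, hlen, t, σ, hE, ht, hσ⟩ := RamProg.runs_decompose I (k - 1)
  have hrel : ∀ (u : Fin (k - 1) → Fin I.numVars) (x : Fin (k - 1) → Fin d),
      x ∈ (I.localConstraint u).rel ↔ ∀ s ∈ I.scopes, I.Compatible u x s := fun u x => by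
    simp [ExplicitConstraint.rel, AutCSPInstance.localConstraint, mem_allTuples,
      AutCSPInstance.mem_compatibleTuples]
  -- The scopes written are exactly the tuples of occurring variables, because `l` lists these
  -- variables.
  have hmem : ∀ u : Fin (k - 1) → Fin I.numVars,
      (∃ x : Fin (k - 1) → Fin l.length, (fun i => l.get (x i)) = u) ↔ ∀ j, I.Occurs (u j) := by
    intro u
    simp only [← hocc]
    constructor
    · rintro ⟨x, rfl⟩ j
      exact List.get_mem _ _
    · intro h
      choose x hx using fun j => List.mem_iff_get.1 (h j)
      exact ⟨x, funext hx⟩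
  refine ⟨(allTuples l.length (k - 1)).map fun x => I.localConstraint fun i => l.get (x i), t, ⟨σ, hE, fun i hi => ?_⟩, ?_, ?_, ?_, ?_, ?_⟩
  · rw [← (holds_iff_getElem _ _ _).1 hσ i hi, zero_add]
  · have := hc d hd I l.length hlen
    rw [Nat.sub_add_cancel hk] at this
    exact ht.trans this
  · rw [List.map_map]
    refine (nodup_allTuples _ _).map fun x y hxy => funext fun i => ?_
    exact hl.get_inj_iff.1 (congrFun hxy i)
  · intro u
    rw [← hmem u, List.map_map]
    simp only [List.mem_map, mem_allTuples, true_and]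
    rfl
  · intro P hP
    obtain ⟨x, -, rfl⟩ := List.mem_map.1 hP
    intro y hy
    rw [hrel]
    intro s hs
    exact AutCSPInstance.Compatible.apply hI hs fun i => (hrel _ _).1 (hy i) s hs
  · intro ψ
    rw [AutCSPInstance.isSolution_iff_compatible hk hg hI]
    constructor
    · rintro h _ ⟨P', hP', rfl⟩
      obtain ⟨x, -, rfl⟩ := List.mem_map.1 hP'
      exact (hrel _ _).2 (h _ ((hmem _).1 ⟨x, rfl⟩))
    · intro h u hu
      obtain ⟨x, rfl⟩ := (hmem u).2 hu
      exact (hrel _ _).1 (h _ ⟨_, List.mem_map.2 ⟨x, mem_allTuples x, rfl⟩, rfl⟩)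

/-! ## Tables for pairs of variables and values -/

namespace RamProg

open RamExpr AutCSPInstance

variable {d m : ℕ} {I : AutCSPInstance d}

/-- Tables of the components of the pairs of a variable and a value; the number of pairs is put
into the register `22`. -/
def pairTables : RamProg :=
  forLoop 23 0 <| forLoop 28 1 <| seq (store 7 (reg 22) (reg 23)) <|
    seq (store 8 (reg 22) (reg 28)) (assign 22 (add (reg 22) (const 1)))

/-- Tables of the multiples of the first `m` powers of the number of pairs. -/
def powerTables : ℕ → RamProg
  | 0 => assign 26 (const 1)
  | m + 1 => seq (powerTables m) <| seq (assign 27 (const 0)) <|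
      seq (forLoop 30 22 (seq (store (10 + m) (reg 30) (reg 27))
        (assign 27 (add (reg 27) (reg 26))))) (assign 26 (reg 27))

theorem powerTables_writesReg {r : ℕ} (h : (powerTables m).writesReg r) :
    26 ≤ r ∧ r ≤ 30 := by
  induction m with
  | zero => simp [powerTables] at h; omega
  | succ m ih =>
    simp only [powerTables, writesReg, forLoop_writesReg, false_or] at h
    rcases h with h | h
    · exact ih h
    · omega

theorem powerTables_writesMem {a : ℕ} (h : (powerTables m).writesMem a) :
    10 ≤ a ∧ a < 10 + m := by
  induction m with
  | zero => simp [powerTables] at h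
  | succ m ih =>
    simp only [powerTables, writesMem, forLoop_writesMem, or_false, false_or] at h
    rcases h with h | h
    · have := ih h; omega
    · omega

/-- The pair of `v` and `a` has the number `v * d + a`, which is also its rank in the two nested
loops. Counting therefore yields tables of quotients and remainders without any division. -/
theorem runs_pairTables {σ : RamState} (hσ : I.Loaded σ) (h22 : σ.reg 22 = 0) :
    Runs pairTables σ (I.numVars * (d * 22 + 14) + 6) fun τ => τ.reg 22 = I.numVars * d ∧
      ∀ y < I.numVars * d, τ.mem 7 y = y / d ∧ τ.mem 8 y = y % d := by
  refine Runs.forLoop (B := I.numVars) (T := d * 22 + 6) (fun j τ => τ.reg 22 = j * d ∧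
      ∀ y < j * d, τ.mem 7 y = y / d ∧ τ.mem 8 y = y % d) (by norm_num) (by simp) (by simp)
    hσ.numVars (fun j τ v h => by simpa using h) (by simpa using h22) ?_
  intro j hj τ hF hτ hI
  have hL := hσ.of_frame hF (by simp; omega) (by simp)
  refine (Runs.forLoop (B := d) (T := 14) (fun a τ => τ.reg 22 = j * d + a ∧
      ∀ y < j * d + a, τ.mem 7 y = y / d ∧ τ.mem 8 y = y % d) (by norm_num) (by simp) (by simp)
    hL.domain (fun j τ v h => by simpa using h) (by simpa using hI) ?_).weaken le_rfl ?_
  · intro a ha τ' hF' hτ' ⟨h22', hI'⟩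
    have h23 : τ'.reg 23 = j := by rw [hF'.reg 23 (by simp), hτ]
    refine LoopFree.runs (by simp) (by simp) ⟨by simp [h22']; ring, fun y hy => ?_⟩
    rcases eq_or_ne y (j * d + a) with rfl | hne
    · have h1 : (j * d + a) / d = j := by
        rw [add_comm, Nat.add_mul_div_right _ _ (by omega), Nat.div_eq_of_lt ha, zero_add]
      have h2 : (j * d + a) % d = a := by
        rw [add_comm, Nat.add_mul_mod_self_right, Nat.mod_eq_of_lt ha]
      simp [h22', h23, hτ', h1, h2]
    · have := hI' y (by omega)
      simpa [h22', hne] using this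
  · rintro τ' _ h
    rwa [Nat.add_mul, one_mul]

/-- Multiplication by `N ^ i` becomes a table lookup. Each table is filled by repeated addition, and
the running sum after its `N` entries is the next power. -/
theorem runs_powerTables {σ : RamState} (m : ℕ) {N : ℕ} (h22 : σ.reg 22 = N) :
    Runs (powerTables m) σ (2 + m * (N * 16 + 10)) fun τ => τ.reg 26 = N ^ m ∧
      ∀ i < m, ∀ x < N, τ.mem (10 + i) x = x * N ^ i := by
  induction m with
  | zero => exact .assign (by simp) (by simp)
  | succ m ih =>
    refine Runs.weaken (ih.seq (T₂ := 2 + ((N * (8 + 8) + 6) + 2)) (Q₂ := fun τ =>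
      τ.reg 26 = N ^ (m + 1) ∧ ∀ i < m + 1, ∀ x < N, τ.mem (10 + i) x = x * N ^ i) ?_)
      (by rw [Nat.add_mul]; omega) fun _ _ h => h
    rintro τ hF ⟨h26, htab⟩
    have hτ22 : τ.reg 22 = N := by
      rw [hF.reg 22 (fun h => by have := powerTables_writesReg h; omega), h22]
    have hfirst : Runs (RamProg.assign 27 (const 0)) τ 2 (· = τ.setReg 27 0) :=
      .assign (by simp) rfl
    refine hfirst.seq ?_
    rintro _ - rfl
    have hloop := Runs.forLoop (i := 30) (b := 22) (B := N) (T := 8)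
      (body := seq (store (10 + m) (reg 30) (reg 27)) (assign 27 (add (reg 27) (reg 26))))
      (σ := τ.setReg 27 0)
      (fun j τ' => τ'.reg 27 = j * N ^ m ∧ ∀ x < j, τ'.mem (10 + m) x = x * N ^ m)
      (by norm_num) (by simp) (by simp) (by simpa using hτ22) (fun j τ v h => by simpa using h)
      (by simp) ?_
    · refine hloop.seq ?_
      rintro τ' hF' ⟨h27, hnew⟩
      refine .assign (by simp) ⟨by simp [h27, pow_succ, mul_comm], fun i hi x hx => ?_⟩
      rcases eq_or_ne i m with rfl | hne
      · exact hnew x hx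
      · have : τ'.mem (10 + i) = τ.mem (10 + i) := by
          rw [hF'.mem _ (by simp; omega)]; simp
        rw [RamState.setReg_mem, this, htab i (by omega) x hx]
    · intro j hj τ' hF' hj' ⟨h27, hnew⟩
      have h26' : τ'.reg 26 = N ^ m := by
        rw [hF'.reg 26 (by simp)]; simpa using h26
      refine LoopFree.runs (by simp) (by simp) ⟨by simp [h27, h26']; ring, fun x hx => ?_⟩
      rcases eq_or_ne x j with rfl | hne
      · simp [hj', h27]
      · have := hnew x (by omega)
        simpa [hj', hne] using this

/-- The instance is loaded and the tables are available. -/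
structure Ready (I : AutCSPInstance d) (m : ℕ) (σ : RamState) : Prop where
  loaded : I.Loaded σ
  pairs : σ.reg 22 = I.numVars * d
  components : ∀ y < I.numVars * d, σ.mem 7 y = y / d ∧ σ.mem 8 y = y % d
  powers : ∀ i < m, ∀ x < I.numVars * d, σ.mem (10 + i) x = x * (I.numVars * d) ^ i

theorem Ready.of_frame {p : RamProg} {σ τ : RamState} (h : Ready I m σ) (hF : p.Frame σ τ)
    (hr : ∀ r, p.writesReg r → 9 ≤ r ∧ r ≠ 22) (hm : ∀ a, p.writesMem a → 1 ≤ a ∧ a ≤ 6) :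
    Ready I m τ := by
  obtain ⟨h1, h2, h3, h4⟩ := h
  refine ⟨h1.of_frame hF (fun r hr' h => ?_) fun h => ?_, ?_, fun y hy => ?_, fun i hi x hx => ?_⟩
  · have := hr r h; omega
  · have := hm 0 h; omega
  · rw [hF.reg 22 fun h => (hr _ h).2 rfl, h2]
  · rw [hF.mem 7 fun h => by have := hm _ h; omega, hF.mem 8 fun h => by have := hm _ h; omega]
    exact h3 y hy
  · rw [hF.mem (10 + i) fun h => by have := hm _ h; omega]
    exact h4 i hi x hx

/-- The address of an assignment of values to a tuple of variables. -/
def code {n d m : ℕ} (x : Fin m → Fin n × Fin d) : ℕ :=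
  finFunctionFinEquiv fun i => finProdFinEquiv (x i)

theorem code_injective {n d m : ℕ} :
    Function.Injective (code : (Fin m → Fin n × Fin d) → ℕ) := fun x y h => by
  have := finFunctionFinEquiv.injective (Fin.ext h)
  exact funext fun i => finProdFinEquiv.injective (congrFun this i)

theorem code_lt {n d m : ℕ} (x : Fin m → Fin n × Fin d) : code x < (n * d) ^ m := Fin.is_lt _

/-- The address of the assignment whose pairs are in the registers `100 + f i`. -/
def address (f : ℕ → ℕ) (m : ℕ) : RamExpr := sum (fun i => get (10 + i) (reg (100 + f i))) m

theorem address_eval {σ : RamState} (hσ : Ready I m σ) {f : ℕ → ℕ}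
    {x : Fin m → Fin I.numVars × Fin d}
    (hx : ∀ i : Fin m, σ.reg (100 + f i) = finProdFinEquiv (x i)) :
    (address f m).eval σ = code x := by
  rw [address, sum_eval, code, finFunctionFinEquiv_apply, Finset.sum_range]
  refine Finset.sum_congr rfl fun i _ => ?_
  rw [eval, eval, hx i, hσ.powers i i.2 _ (Fin.is_lt _)]

/-- Translates the counters of a nest of loops into the assignment that they encode; the rank of the
pass is the address of the assignment. -/
theorem exists_decode {n d m : ℕ} {y : ℕ → ℕ} (hy : ∀ i < m, y i < n * d) :
    ∃ x : Fin m → Fin n × Fin d, (∀ i : Fin m, y i = finProdFinEquiv (x i)) ∧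
      digitSum (n * d) m y = code x := by
  have hx : ∀ i : Fin m, y i = finProdFinEquiv (finProdFinEquiv.symm ⟨y i, hy i i.2⟩) :=
    fun i => by rw [Equiv.apply_symm_apply]
  exact ⟨fun i => finProdFinEquiv.symm ⟨y i, hy i i.2⟩, hx, digitSum_eq _ hx⟩

/-- The variable of the pair in the register `100 + i`. -/
def pairVar (i : ℕ) : RamExpr := get 7 (reg (100 + i))

/-- The value of the pair in the register `100 + i`. -/
def pairVal (i : ℕ) : RamExpr := get 8 (reg (100 + i))

theorem pairVar_eval {σ : RamState} (hσ : Ready I m σ) {i : ℕ} {y : Fin I.numVars × Fin d}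
    (h : σ.reg (100 + i) = finProdFinEquiv y) : (pairVar i).eval σ = y.1 := by
  rw [pairVar, eval, eval, h, (hσ.components _ (Fin.is_lt _)).1]
  exact congrArg (fun z : Fin I.numVars × Fin d => (z.1 : ℕ))
    (finProdFinEquiv.symm_apply_apply y)

theorem pairVal_eval {σ : RamState} (hσ : Ready I m σ) {i : ℕ} {y : Fin I.numVars × Fin d}
    (h : σ.reg (100 + i) = finProdFinEquiv y) : (pairVal i).eval σ = y.2 := by
  rw [pairVal, eval, eval, h, (hσ.components _ (Fin.is_lt _)).2]
  exact congrArg (fun z : Fin I.numVars × Fin d => (z.2 : ℕ))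
    (finProdFinEquiv.symm_apply_apply y)

/-! ## Local consistency -/

/-- The set of assignments in array `6`. -/
def current (I : AutCSPInstance d) (m : ℕ) (σ : RamState) : Set (Fin m → Fin I.numVars × Fin d) :=
  {x | σ.mem 6 (code x) ≠ 0}

theorem mem_current {σ : RamState} {x : Fin m → Fin I.numVars × Fin d} :
    x ∈ current I m σ ↔ σ.mem 6 (code x) ≠ 0 := Iff.rfl

/-- Zero if and only if the current assignment is a function. -/
def functionTest (m : ℕ) : RamExpr :=
  sum (fun i => sum (fun j => imp (pairVar i) (pairVar j) (pairVal i) (pairVal j)) m) m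

/-- Put the current assignment into array `6` if it is a local assignment. -/
def initAssignment (m : ℕ) : RamProg :=
  seq (check pairVar pairVal m) <|
    ite (functionTest m) (store 6 (address id m) (const 0)) (store 6 (address id m) (reg 18))

/-- A bound for the number of steps of `initAssignment`. -/
def initAssignmentCost (I : AutCSPInstance d) (m : ℕ) : ℕ :=
  I.constraintSize * (I.aut.size * checkCost pairVar pairVal m) +
    (20 + (functionTest m).cost + (address id m).cost)

theorem initAssignment_writesReg {r : ℕ} : (initAssignment m).writesReg r ↔ 9 ≤ r ∧ r ≤ 18 := by
  simp [initAssignment, check_writesReg]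

theorem initAssignment_writesMem {a : ℕ} :
    (initAssignment m).writesMem a ↔ a = 2 ∨ a = 3 ∨ a = 6 := by
  simp [initAssignment, check_writesMem, or_assoc]

/-- The flag of `check` itself is stored, since `current` only distinguishes zero from nonzero. Both
branches write the cell, so nothing is assumed about its previous content. -/
theorem runs_initAssignment {σ : RamState} (hσ : Ready I m σ) (h3 : I.StateSet σ 3 ∅)
    {x : Fin m → Fin I.numVars × Fin d}
    (hx : ∀ i : Fin m, σ.reg (100 + i) = finProdFinEquiv (x i)) :
    Runs (initAssignment m) σ (initAssignmentCost I m) fun τ => I.StateSet τ 3 ∅ ∧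
      (x ∈ current I m τ ↔ x ∈ I.localAssignments m) ∧
      ∀ j, j ≠ code x → τ.mem 6 j = σ.mem 6 j := by
  have keep : ∀ τ, Frame (check pairVar pairVal m) σ τ → Ready I m τ ∧
      ∀ i : Fin m, τ.reg (100 + i) = finProdFinEquiv (x i) := fun τ hF =>
    ⟨hσ.of_frame hF (fun r h => by rw [check_writesReg] at h; omega)
      (fun a h => by rw [check_writesMem] at h; omega),
      fun i => by rw [hF.reg _ (by rw [check_writesReg]; omega), hx i]⟩
  have hcheck := runs_check (u := pairVar) (t := pairVal) (U := fun i => (x i).1)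
    (T := fun i => (x i).2) hσ.loaded
    (fun τ hF i => pairVar_eval (keep τ hF).1 ((keep τ hF).2 i))
    (fun τ hF i => pairVal_eval (keep τ hF).1 ((keep τ hF).2 i)) h3
  refine Runs.weaken (hcheck.seq (T₂ := (functionTest m).cost + 1 + ((address id m).cost + 2))
    (Q₂ := fun τ => I.StateSet τ 3 ∅ ∧ (x ∈ current I m τ ↔ x ∈ I.localAssignments m) ∧
      ∀ j, j ≠ code x → τ.mem 6 j = σ.mem 6 j) ?_) (by rw [initAssignmentCost]; omega)
    fun _ _ h => h
  rintro τ hF ⟨hflag, h3'⟩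
  obtain ⟨hτ, hxτ⟩ := keep τ hF
  have haddr : (address id m).eval τ = code x := address_eval hτ hxτ
  have hmem : τ.mem 6 = σ.mem 6 := hF.mem 6 (by simp [check_writesMem])
  have htest : (functionTest m).eval τ = 0 ↔ ∀ i j, (x i).1 = (x j).1 → (x i).2 = (x j).2 := by
    rw [functionTest, sum_eval_eq_zero]
    simp only [sum_eval_eq_zero, imp_eval_eq_zero]
    constructor
    · intro h i j hij
      have := h i i.2 j j.2
      rw [pairVar_eval hτ (hxτ i), pairVar_eval hτ (hxτ j), pairVal_eval hτ (hxτ i),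
        pairVal_eval hτ (hxτ j)] at this
      exact Fin.ext (this (congrArg _ hij))
    · intro h i hi j hj
      have hi' := hxτ ⟨i, hi⟩
      have hj' := hxτ ⟨j, hj⟩
      rw [pairVar_eval hτ hi', pairVar_eval hτ hj', pairVal_eval hτ hi', pairVal_eval hτ hj']
      exact fun h' => congrArg _ (h _ _ (Fin.ext h'))
  refine .ite (fun hf => .store (by simp) ?_) fun hf => .store (by simp) ?_
  · refine ⟨by simpa [StateSet] using h3', ?_, fun j hj => by simp [haddr, hj, hmem]⟩
    have : ¬ x ∈ I.localAssignments m := fun h => hf (htest.2 h.1)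
    simp [this, mem_current, haddr]
  · refine ⟨by simpa [StateSet] using h3', ?_, fun j hj => by simp [haddr, hj, hmem]⟩
    have hfun := htest.1 hf
    rw [mem_current, haddr, RamState.setMem_mem, if_pos ⟨rfl, rfl⟩, eval, hflag]
    exact ⟨fun h => ⟨hfun, h⟩, fun h => h.2⟩

theorem runs_initAssignments {σ : RamState} (hσ : Ready I m σ) (h3 : I.StateSet σ 3 ∅) :
    Runs (nestLoop 100 22 (initAssignment m) m) σ
      (nestCost (I.numVars * d) (initAssignmentCost I m) m)
      (current I m · = I.localAssignments m) := by
  refine (Runs.nestLoop (fun e τ => I.StateSet τ 3 ∅ ∧ ∀ x : Fin m → Fin I.numVars × Fin d,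
      code x < e → (x ∈ current I m τ ↔ x ∈ I.localAssignments m)) (by omega)
    (fun s hs _ => by rw [initAssignment_writesReg]; omega)
    (by rw [initAssignment_writesReg]; omega) hσ.pairs (fun j τ s v _ _ h => h)
    ⟨h3, by simp⟩ ?_).weaken le_rfl ?_
  · rintro y hy τ hF hreg ⟨h3', hI⟩
    obtain ⟨x, hx, hcode⟩ := exists_decode hy
    have hτ : Ready I m τ := hσ.of_frame hF
      (fun r h => by rw [nestLoop_writesReg, initAssignment_writesReg] at h; omega)
      (fun a h => by rw [nestLoop_writesMem, initAssignment_writesMem] at h; omega)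
    refine (runs_initAssignment hτ h3' fun i => (hreg i i.2).trans (hx i)).weaken le_rfl ?_
    rintro τ' _ ⟨g1, g2, g3⟩
    refine ⟨g1, fun x' hx' => ?_⟩
    rcases eq_or_ne x' x with rfl | hne
    · exact g2
    · have hc : code x' ≠ code x := fun h => hne (code_injective h)
      rw [mem_current, g3 _ hc]
      exact hI x' (by omega)
  · rintro τ _ ⟨-, h⟩
    exact Set.ext fun x => h x (code_lt x)

/-- The `e`-th function from `{0, …, m - 1}` to `{0, …, m}`. -/
def selection (m e i : ℕ) : ℕ :=
  if h : e < (m + 1) ^ m ∧ i < m then finFunctionFinEquiv.symm ⟨e, h.1⟩ ⟨i, h.2⟩ else 0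

/-- Zero if and only if all assignments selected from the pairs in the registers
`100, …, 100 + m` belong to the current set. -/
def extensionTest (m : ℕ) : RamExpr :=
  sum (fun e => sub (const 1) (get 6 (address (selection m e) m))) ((m + 1) ^ m)

/-- All `(m + 1) ^ m` selections are unrolled into one expression, whose cost depends on `m` only. A
summand `1 - c` vanishes if and only if the cell `c` is nonzero. -/
theorem extensionTest_eval_eq_zero {σ : RamState} (hσ : Ready I m σ)
    {z : Fin (m + 1) → Fin I.numVars × Fin d}
    (hz : ∀ j : Fin (m + 1), σ.reg (100 + j) = finProdFinEquiv (z j)) :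
    (extensionTest m).eval σ = 0 ↔
      ∀ J : Fin m → Fin (m + 1), (fun i => z (J i)) ∈ current I m σ := by
  have haddr : ∀ J : Fin m → Fin (m + 1),
      (address (selection m (finFunctionFinEquiv J)) m).eval σ = code fun i => z (J i) := by
    intro J
    refine address_eval hσ fun i => ?_
    rw [← hz]
    congr 2
    rw [selection, dif_pos ⟨Fin.is_lt _, i.2⟩]
    simp only [Fin.eta, Equiv.symm_apply_apply]
  rw [extensionTest, sum_eval_eq_zero]
  simp only [eval, mem_current, ← haddr]
  constructor
  · intro h J
    have := h _ (finFunctionFinEquiv J).is_lt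
    omega
  · intro h e he
    have := h (finFunctionFinEquiv.symm ⟨e, he⟩)
    rw [Equiv.apply_symm_apply] at this
    dsimp only at this
    omega

/-- The assignment `x` can be extended to the variable `v` within `H`. -/
def ExtendsTo {V D : Type*} (H : Set (Fin m → V × D)) (x : Fin m → V × D) (v : V) : Prop :=
  ∃ a, ∀ J : Fin m → Fin (m + 1), (fun i => Fin.snoc (α := fun _ => V × D) x (v, a) (J i)) ∈ H

/-- Set the register `24` if the current assignment extends to the variable in the register
`23`. -/
def searchExtension (m : ℕ) : RamProg :=
  seq (assign 24 (const 0)) <| forLoop (100 + m) 22 <|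
    ite (ne (pairVar m) (reg 23)) skip (ite (extensionTest m) skip (assign 24 (const 1)))

/-- Delete the current assignment and set the register `25` if it does not extend to all
variables. -/
def refineAssignment (m : ℕ) : RamProg :=
  ite (get 6 (address id m))
    (forLoop 23 0 <| seq (searchExtension m) <|
      ite (reg 24) skip (seq (store 6 (address id m) (const 0)) (assign 25 (const 1)))) skip

/-- The counter `100 + m` runs through all pairs and skips those with another variable. The
candidate thus stands directly behind the `m` pairs of `x`, where `extensionTest` expects it. -/
theorem runs_searchExtension {σ : RamState} (hσ : Ready I m σ)
    {x : Fin m → Fin I.numVars × Fin d}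
    (hx : ∀ i : Fin m, σ.reg (100 + i) = finProdFinEquiv (x i)) {v : Fin I.numVars}
    (hv : σ.reg 23 = v) :
    Runs (searchExtension m) σ (8 + I.numVars * d * (30 + (extensionTest m).cost))
      fun τ => τ.reg 24 ≠ 0 ↔ ExtendsTo (current I m σ) x v := by
  have hfirst : Runs (RamProg.assign 24 (const 0)) σ 2 (· = σ.setReg 24 0) :=
    .assign (by simp) rfl
  refine Runs.weaken (hfirst.seq
    (T₂ := I.numVars * d * (22 + (extensionTest m).cost + 8) + 6)
    (Q₂ := fun τ => τ.reg 24 ≠ 0 ↔ ExtendsTo (current I m σ) x v) ?_) (by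
      rw [show 22 + (extensionTest m).cost + 8 = 30 + (extensionTest m).cost by ring]
      omega) fun _ _ h => h
  rintro _ hF rfl
  refine (Runs.forLoop (B := I.numVars * d) (fun j τ => τ.reg 24 ≠ 0 ↔ ∃ a : Fin d,
      (finProdFinEquiv (v, a) : ℕ) < j ∧ ∀ J : Fin m → Fin (m + 1),
        (fun i => Fin.snoc (α := fun _ => Fin I.numVars × Fin d) x (v, a) (J i)) ∈ current I m σ)
    (by omega) (by simp; omega) (by simp) (by simpa using hσ.pairs) (fun j τ w h => ?_) (by simp)
    ?_).weaken le_rfl ?_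
  · have : ¬ 24 = 100 + m := by omega
    simpa [this] using h
  · intro j hj τ hF' hj' hI
    have hτ : Ready I m τ := (hσ.of_frame hF (by simp) (by simp)).of_frame hF'
      (by simp; omega) (by simp)
    obtain ⟨⟨w, b⟩, hwb⟩ : ∃ y : Fin I.numVars × Fin d, finProdFinEquiv y = ⟨j, hj⟩ :=
      ⟨_, finProdFinEquiv.apply_symm_apply _⟩
    have hwb' : (finProdFinEquiv (w, b) : ℕ) = j := congrArg Fin.val hwb
    have hreg : τ.reg (100 + m) = finProdFinEquiv (w, b) := by rw [hj', hwb']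
    have hcur : current I m τ = current I m σ := by
      ext x'
      rw [mem_current, mem_current, hF'.mem 6 (by simp)]
      simp
    have h23 : τ.reg 23 = v := by
      rw [hF'.reg 23 (by simp; omega)]
      simpa using hv
    have htest := extensionTest_eval_eq_zero hτ
      (z := Fin.snoc (α := fun _ => Fin I.numVars × Fin d) x (w, b)) (by
        refine Fin.lastCases ?_ fun i => ?_
        · simpa using hreg
        · have : ¬ 100 + (i : ℕ) = 100 + m := by have := i.2; omega
          rw [Fin.snoc_castSucc, Fin.val_castSucc, hF'.reg _ (by simp; omega)]
          have h24 : ¬ 100 + (i : ℕ) = 24 := by omega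
          simpa [h24] using hx i)
    rw [hcur] at htest
    -- The only new candidate in this pass is the pair `(w, b)` with number `j`.
    have hstep : (∃ a : Fin d, (finProdFinEquiv (v, a) : ℕ) < j + 1 ∧
        ∀ J : Fin m → Fin (m + 1), (fun i => Fin.snoc (α := fun _ => Fin I.numVars × Fin d) x (v, a)
          (J i)) ∈ current I m σ) ↔ τ.reg 24 ≠ 0 ∨ (w = v ∧ (extensionTest m).eval τ = 0) := by
      rw [hI, htest]
      constructor
      · rintro ⟨a, ha, h⟩
        rcases Nat.lt_succ_iff_lt_or_eq.1 ha with ha | ha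
        · exact .inl ⟨a, ha, h⟩
        · have : (w, b) = (v, a) := finProdFinEquiv.injective (Fin.ext (hwb'.trans ha.symm))
          rw [Prod.mk.injEq] at this
          obtain ⟨rfl, rfl⟩ := this
          exact .inr ⟨rfl, h⟩
      · rintro (⟨a, ha, h⟩ | ⟨rfl, h⟩)
        · exact ⟨a, by omega, h⟩
        · exact ⟨b, by omega, h⟩
    rw [show (22 + (extensionTest m).cost : ℕ) =
      (ne (pairVar m) (reg 23)).cost + 1 + ((extensionTest m).cost + 1 + 11) by
        simp [RamExpr.ne, pairVar]; ring]
    refine .ite (fun h => .skip (by omega) ?_) fun h =>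
      .ite (fun h' => .skip (by omega) ?_) fun h' => .assign (by simp) ?_
    · have : ¬ w = v := fun e => h (by
        rw [ne_eval_eq_zero, pairVar_eval hτ hreg, eval, h23, e])
      rw [hstep]
      simp [this]
    · rw [hstep]
      simp [h']
    · have : w = v := by
        rw [ne_eval_eq_zero, pairVar_eval hτ hreg, eval, h23] at h
        exact Fin.ext h
      rw [hstep]
      simp [this, h']
  · intro τ _ h
    rw [h]
    exact exists_congr fun a => and_iff_right (Fin.is_lt _)

theorem searchExtension_writesReg {r : ℕ} :
    (searchExtension m).writesReg r ↔ r = 24 ∨ r = 100 + m := by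
  simp [searchExtension, or_comm]

theorem searchExtension_writesMem {a : ℕ} : ¬ (searchExtension m).writesMem a := by
  simp [searchExtension]

/-- A bound for the number of steps of `refineAssignment`. -/
def refineAssignmentCost (I : AutCSPInstance d) (m : ℕ) : ℕ :=
  20 + (address id m).cost + I.numVars *
    (40 + I.numVars * d * (30 + (extensionTest m).cost) + (address id m).cost)

theorem refineAssignment_writesReg {r : ℕ} :
    (refineAssignment m).writesReg r ↔ r = 23 ∨ r = 24 ∨ r = 25 ∨ r = 100 + m := by
  simp only [refineAssignment, writesReg, forLoop_writesReg, searchExtension_writesReg]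
  tauto

theorem refineAssignment_writesMem {a : ℕ} : (refineAssignment m).writesMem a ↔ a = 6 := by
  simp [refineAssignment, searchExtension_writesMem]

/-- After `x` has been deleted, the remaining variables are tested against the smaller set. This
does no harm: the second alternative persists, with the variable that caused the first deletion as
its witness. -/
theorem runs_refineAssignment {σ : RamState} (hσ : Ready I m σ)
    {x : Fin m → Fin I.numVars × Fin d}
    (hx : ∀ i : Fin m, σ.reg (100 + i) = finProdFinEquiv (x i)) :
    Runs (refineAssignment m) σ (refineAssignmentCost I m) fun τ =>
      (current I m τ = current I m σ ∧ τ.reg 25 = σ.reg 25 ∧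
        (x ∈ current I m σ → ∀ v, ExtendsTo (current I m σ) x v)) ∨
      (current I m τ = current I m σ \ {x} ∧ τ.reg 25 ≠ 0 ∧ x ∈ current I m σ ∧
        ∃ v, ¬ ExtendsTo (current I m σ) x v) := by
  have haddr : (address id m).eval σ = code x := address_eval hσ hx
  refine Runs.weaken (Runs.ite (T := I.numVars *
    ((8 + I.numVars * d * (30 + (extensionTest m).cost)) + ((address id m).cost + 9) + 8) + 6)
    (fun h => ?_) fun h => .skip (by omega) (.inl ⟨rfl, rfl, fun hx' =>
      (hx' (haddr ▸ h)).elim⟩)) ?_ fun _ _ h => h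
  · have hxσ : x ∈ current I m σ := by rwa [eval, haddr] at h
    refine (Runs.forLoop (B := I.numVars) (fun j τ =>
      (current I m τ = current I m σ ∧ τ.reg 25 = σ.reg 25 ∧
        ∀ v : Fin I.numVars, v < j → ExtendsTo (current I m σ) x v) ∨
      (current I m τ = current I m σ \ {x} ∧ τ.reg 25 ≠ 0 ∧
        ∃ v, ¬ ExtendsTo (current I m σ) x v)) (by norm_num)
      (by simp [searchExtension_writesReg]; omega) (by simp [searchExtension_writesReg]; omega)
      hσ.loaded.numVars (fun j τ v h => by simpa [current] using h) (.inl ⟨rfl, rfl, by simp⟩)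
      ?_).weaken le_rfl ?_
    · intro j hj τ hF hj' hI
      have hτ : Ready I m τ := hσ.of_frame hF
        (by simp [searchExtension_writesReg]; omega) (by simp [searchExtension_writesMem])
      have hxτ : ∀ i : Fin m, τ.reg (100 + i) = finProdFinEquiv (x i) := fun i => by
        rw [hF.reg _ (by simp [searchExtension_writesReg]; omega), hx i]
      refine (runs_searchExtension hτ hxτ (v := ⟨j, hj⟩) hj').seq ?_
      intro τ' hF' hfound
      have hτ' : Ready I m τ' := hτ.of_frame hF'
        (fun r h => by rw [searchExtension_writesReg] at h; omega)
        (fun a h => (searchExtension_writesMem h).elim)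
      have hxτ' : ∀ i : Fin m, τ'.reg (100 + i) = finProdFinEquiv (x i) := fun i => by
        rw [hF'.reg _ (by rw [searchExtension_writesReg]; omega), hxτ i]
      have haddr' : (address id m).eval τ' = code x := address_eval hτ' hxτ'
      have hcur : current I m τ' = current I m τ := by
        ext x'
        rw [mem_current, mem_current, hF'.mem 6 searchExtension_writesMem]
      have h25 : τ'.reg 25 = τ.reg 25 := hF'.reg 25 (by rw [searchExtension_writesReg]; omega)
      rw [show (address id m).cost + 9 = (reg 24).cost + 1 + ((address id m).cost + 7) by
        simp; omega]
      refine .ite (fun hf => .skip (by omega) ?_)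
        fun hf => LoopFree.runs (by simp) (by simp) ?_
      · rw [hcur, h25]
        rcases hI with ⟨g1, g2, g3⟩ | g
        · refine .inl ⟨g1, g2, fun v hv => ?_⟩
          rcases Nat.lt_succ_iff_lt_or_eq.1 hv with hv | hv
          · exact g3 v hv
          · rw [g1] at hfound
            have : v = ⟨j, hj⟩ := Fin.ext hv
            rw [this]
            exact hfound.1 hf
        · exact .inr g
      · right
        have hdel : current I m (final (seq (store 6 (address id m) (const 0))
            (assign 25 (const 1))) τ') = current I m τ \ {x} := by
          rw [← hcur]
          ext x'
          simp only [mem_current, final, haddr', RamState.setReg_mem, RamState.setMem_mem, eval,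
            true_and, Set.mem_sdiff, Set.mem_singleton_iff]
          rcases eq_or_ne x' x with rfl | hne
          · simp
          · have : code x' ≠ code x := fun h => hne (code_injective h)
            simp [this, hne]
        rw [hdel]
        refine ⟨?_, by simp, ?_⟩
        · rcases hI with ⟨g1, -, -⟩ | ⟨g1, -, -⟩
          · rw [g1]
          -- Here `x` had already been deleted for an earlier variable.
          · rw [g1]; simp
        · rcases hI with ⟨g1, -, -⟩ | ⟨-, -, g3⟩
          · rw [g1] at hfound
            exact ⟨_, fun h => hfound.2 h hf⟩
          · exact g3
    · rintro τ _ (⟨g1, g2, g3⟩ | ⟨g1, g2, g3⟩)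
      · exact .inl ⟨g1, g2, fun _ v => g3 v v.2⟩
      · exact .inr ⟨g1, g2, hxσ, g3⟩
  · rw [refineAssignmentCost]
    simp only [cost]
    have : (8 + I.numVars * d * (30 + (extensionTest m).cost)) + ((address id m).cost + 9) + 8 ≤
      40 + I.numVars * d * (30 + (extensionTest m).cost) + (address id m).cost := by omega
    have := Nat.mul_le_mul_left I.numVars this
    omega

/-- Go through all assignments once. -/
def refineAll (m : ℕ) : RamProg :=
  seq (assign 25 (const 0)) (nestLoop 100 22 (refineAssignment m) m)

theorem refineAll_writesReg {r : ℕ} (h : (refineAll m).writesReg r) : 9 ≤ r ∧ r ≠ 22 := by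
  simp only [refineAll, writesReg, nestLoop_writesReg, refineAssignment_writesReg] at h
  omega

theorem refineAll_writesMem {a : ℕ} (h : (refineAll m).writesMem a) : a = 6 := by
  simpa [refineAll, nestLoop_writesMem, refineAssignment_writesMem] using h

/-- Assignments are deleted in place, so later tests of a pass refer to a smaller set. Strategies
survive nevertheless, since an assignment without extension in a superset of a strategy is not in
the strategy. If the flag stays zero, nothing was deleted, all tests referred to the same set, and
all of them succeeded. -/
theorem runs_refineAll {σ : RamState} (hσ : Ready I m σ)
    (hmax : ∀ H, IsStrategy (I.localAssignments m) H → H ⊆ current I m σ) :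
    Runs (refineAll m) σ (2 + nestCost (I.numVars * d) (refineAssignmentCost I m) m) fun τ =>
      current I m τ ⊆ current I m σ ∧
      (∀ H, IsStrategy (I.localAssignments m) H → H ⊆ current I m τ) ∧
      (τ.reg 25 = 0 → current I m τ = current I m σ ∧
        ∀ x ∈ current I m σ, ∀ v, ExtendsTo (current I m σ) x v) ∧
      (τ.reg 25 ≠ 0 → current I m τ ≠ current I m σ) := by
  have hfirst : Runs (RamProg.assign 25 (const 0)) σ 2 (· = σ.setReg 25 0) :=
    .assign (by simp) rfl
  refine hfirst.seq ?_
  rintro _ hF₁ rfl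
  have hσ₁ : Ready I m (σ.setReg 25 0) := hσ.of_frame hF₁ (by simp) (by simp)
  refine (Runs.nestLoop (fun e τ => current I m τ ⊆ current I m σ ∧
      (∀ H, IsStrategy (I.localAssignments m) H → H ⊆ current I m τ) ∧
      (τ.reg 25 = 0 → current I m τ = current I m σ ∧
        ∀ x ∈ current I m σ, code x < e → ∀ v, ExtendsTo (current I m σ) x v) ∧
      (τ.reg 25 ≠ 0 → current I m τ ≠ current I m σ)) (by omega)
    (fun s hs hs' => by rw [refineAssignment_writesReg]; omega)
    (by rw [refineAssignment_writesReg]; omega) hσ₁.pairs (fun j τ s v hs _ h => ?_)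
    ⟨subset_rfl, hmax, fun _ => ⟨rfl, by simp⟩, by simp⟩ ?_).weaken le_rfl ?_
  · have : ¬ 25 = s := by omega
    simpa [current, this] using h
  · rintro y hy τ hF hreg ⟨g1, g2, g3, g4⟩
    obtain ⟨x, hx, hcode⟩ := exists_decode hy
    have hτ : Ready I m τ := hσ₁.of_frame hF
      (fun r h => by rw [nestLoop_writesReg, refineAssignment_writesReg] at h; omega)
      (fun a h => by rw [nestLoop_writesMem, refineAssignment_writesMem] at h; omega)
    refine (runs_refineAssignment hτ fun i => (hreg i i.2).trans (hx i)).weaken le_rfl ?_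
    rintro τ' _ (⟨e1, e2, e3⟩ | ⟨e1, e2, e3, v, e4⟩)
    · rw [e1, e2]
      refine ⟨g1, g2, fun h0 => ⟨(g3 h0).1, fun x' hx' hlt => ?_⟩, g4⟩
      rcases eq_or_ne x' x with rfl | hne
      · rw [← (g3 h0).1] at hx' ⊢
        exact e3 hx'
      · have hc : code x' ≠ code x := fun h => hne (code_injective h)
        exact (g3 h0).2 x' hx' (by omega)
    · rw [e1]
      refine ⟨Set.sdiff_subset.trans g1, fun H hH x' hx' => ⟨g2 H hH hx', ?_⟩,
        fun h => (e2 h).elim, fun _ h => ?_⟩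
      -- If the deleted `x` belonged to a strategy `H`, its extension within `H` would also lie in
      -- the current set.
      · rintro rfl
        obtain ⟨a, ha⟩ := hH.2 _ hx' v
        exact e4 ⟨a, fun J => g2 H hH (ha J)⟩
      · have := h ▸ g1 e3
        exact this.2 rfl
  · rintro τ _ ⟨g1, g2, g3, g4⟩
    exact ⟨g1, g2, fun h => ⟨(g3 h).1, fun x hx => (g3 h).2 x hx (code_lt x)⟩, g4⟩

/-- Delete assignments as long as possible. -/
def refineLoop (m : ℕ) : RamProg := seq (assign 25 (const 1)) (loop (reg 25) (refineAll m))

/-- A bound for the number of steps of `refineLoop`. -/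
def refineLoopCost (I : AutCSPInstance d) (m : ℕ) : ℕ :=
  2 + (((I.numVars * d) ^ m + 1) *
    (2 + (2 + nestCost (I.numVars * d) (refineAssignmentCost I m) m)) + 2)

/-- The measure is the number of remaining assignments: a pass either deletes one or clears the flag
and ends the loop. At the end the set is a strategy that contains all strategies. -/
theorem runs_refineLoop {σ : RamState} (hσ : Ready I m σ)
    (hinit : current I m σ = I.localAssignments m) :
    Runs (refineLoop m) σ (refineLoopCost I m) fun τ =>
      Ready I m τ ∧ IsStrategy (I.localAssignments m) (current I m τ) ∧
      ∀ H, IsStrategy (I.localAssignments m) H → H ⊆ current I m τ := by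
  have hfirst : Runs (RamProg.assign 25 (const 1)) σ 2 (· = σ.setReg 25 1) :=
    .assign (by simp) rfl
  refine hfirst.seq ?_
  rintro _ hF₁ rfl
  refine (Runs.loop (e := reg 25) (p := refineAll m)
    (T := 2 + nestCost (I.numVars * d) (refineAssignmentCost I m) m)
    (fun τ => Ready I m τ ∧ current I m τ ⊆ I.localAssignments m ∧
      (∀ H, IsStrategy (I.localAssignments m) H → H ⊆ current I m τ) ∧
      -- Only a pass without deletions establishes this clause; it is vacuous at the start, where
      -- the flag is 1.
      (τ.reg 25 = 0 → IsStrategy (I.localAssignments m) (current I m τ)))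
    (fun τ => (current I m τ).ncard) ?_ (σ.setReg 25 1) ⟨hσ.of_frame hF₁ (by simp) (by simp),
      hinit.le, fun H hH => hinit ▸ hH.1, by simp⟩).weaken ?_ ?_
  · rintro τ ⟨h1, h2, h3, h4⟩ _
    refine (runs_refineAll h1 h3).weaken le_rfl ?_
    rintro τ' hF ⟨g1, g2, g3, g4⟩
    refine ⟨⟨h1.of_frame hF (fun r h => refineAll_writesReg h)
      (fun a h => by have := refineAll_writesMem h; omega), g1.trans h2, g2, fun h => ?_⟩, ?_⟩
    · obtain ⟨e1, e2⟩ := g3 h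
      rw [e1]
      exact ⟨h2, e2⟩
    · by_cases h : τ'.reg 25 = 0
      · exact .inl h
      · exact .inr (Set.ncard_lt_ncard (g1.ssubset_of_ne (g4 h)) (Set.toFinite _))
  · have : (current I m (σ.setReg 25 1)).ncard ≤ (I.numVars * d) ^ m := by
      refine (Set.ncard_le_ncard (Set.subset_univ _) (Set.toFinite _)).trans ?_
      rw [Set.ncard_univ]
      simp
    simp only [cost]
    gcongr
  · rintro τ _ ⟨⟨h1, h2, h3, h4⟩, h⟩
    exact ⟨h1, h4 h, h3⟩

/-- Put `1` into the output if there are no variables or some assignment is left, and `0`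
otherwise. -/
def answer (m : ℕ) : RamProg :=
  seq (assign 29 (sub (const 1) (reg 0))) <|
    seq (nestLoop 100 22 (ite (get 6 (address id m)) (assign 29 (const 1)) skip) m)
      (store 1 (const 0) (reg 29))

/-- A bound for the number of steps of `answer`. -/
def answerCost (I : AutCSPInstance d) (m : ℕ) : ℕ :=
  4 + (nestCost (I.numVars * d) (10 + (address id m).cost) m + 3)

theorem runs_answer {σ : RamState} (hσ : Ready I m σ) :
    Runs (answer m) σ (answerCost I m) fun τ =>
      (τ.mem 1 0 = 0 ∨ τ.mem 1 0 = 1) ∧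
      (τ.mem 1 0 = 1 ↔ I.numVars = 0 ∨ (current I m σ).Nonempty) := by
  -- By truncated subtraction the initial answer is 1 if there are no variables and 0 otherwise.
  have hfirst : Runs (RamProg.assign 29 (sub (const 1) (reg 0))) σ 4
      (· = σ.setReg 29 (1 - I.numVars)) :=
    .assign (by simp) (by simp [hσ.loaded.numVars])
  refine hfirst.seq ?_
  rintro _ hF₁ rfl
  have hσ₁ : Ready I m (σ.setReg 29 (1 - I.numVars)) := hσ.of_frame hF₁ (by simp) (by simp)
  have hnest := Runs.nestLoop (r := 100) (b := 22) (B := I.numVars * d)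
    (T := 10 + (address id m).cost) (m := m) (σ := σ.setReg 29 (1 - I.numVars))
    (body := RamProg.ite (get 6 (address id m)) (RamProg.assign 29 (const 1)) RamProg.skip)
    (fun e τ => (τ.reg 29 = 0 ∨ τ.reg 29 = 1) ∧ (τ.reg 29 = 1 ↔ I.numVars = 0 ∨
      ∃ x ∈ current I m σ, code x < e)) (by omega) (by simp; omega) (by simp) hσ₁.pairs ?_ ?_ ?_
  · refine hnest.seq ?_
    rintro τ hF ⟨g1, g2⟩
    refine .store (by simp) ?_
    simp only [eval, RamState.setMem_mem, and_self, if_true]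
    refine ⟨g1, g2.trans (or_congr_right ?_)⟩
    exact exists_congr fun x => and_iff_left (code_lt x)
  · intro j τ s v hs _ h
    have : ¬ 29 = s := by omega
    simpa [this] using h
  · simp
    omega
  · rintro y hy τ hF hreg ⟨g1, g2⟩
    obtain ⟨x, hx, hcode⟩ := exists_decode hy
    have hτ : Ready I m τ := hσ₁.of_frame hF
      (fun r h => by rw [nestLoop_writesReg] at h; simp at h; omega)
      (fun a h => by rw [nestLoop_writesMem] at h; simp at h)
    have haddr : (address id m).eval τ = code x :=
      address_eval hτ fun i => (hreg i i.2).trans (hx i)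
    have hmem : τ.mem 6 = σ.mem 6 := by
      rw [hF.mem 6 (by rw [nestLoop_writesMem]; simp)]; simp
    have hstep : (∃ x' ∈ current I m σ, code x' < digitSum (I.numVars * d) m y + 1) ↔
        (∃ x' ∈ current I m σ, code x' < digitSum (I.numVars * d) m y) ∨ x ∈ current I m σ := by
      constructor
      · rintro ⟨x', hx', hlt⟩
        rcases eq_or_ne x' x with rfl | hne
        · exact .inr hx'
        · have hc : code x' ≠ code x := fun h => hne (code_injective h)
          exact .inl ⟨x', hx', by omega⟩
      · rintro (⟨x', hx', hlt⟩ | hx')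
        · exact ⟨x', hx', by omega⟩
        · exact ⟨x, hx', by omega⟩
    rw [hstep, ← or_assoc, ← g2, mem_current, ← hmem, ← haddr]
    refine Runs.weaken (Runs.ite (T := 2) (fun h => .assign (by simp) ?_)
      fun h => .skip (by omega) ?_) (by simp; omega) fun _ _ h => h
    · rw [eval] at h
      simp [h]
    · rw [eval] at h
      exact ⟨g1, by simp [h]⟩

/-- Decide whether an instance has a solution. -/
def decideProg (m : ℕ) : RamProg :=
  seq loadHeader <| seq pairTables <| seq (powerTables m) <|
    seq (nestLoop 100 22 (initAssignment m) m) <| seq (refineLoop m) (answer m)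

/-- A bound for the number of steps of `decideProg`. -/
def decideCost (I : AutCSPInstance d) (m : ℕ) : ℕ :=
  31 + ((I.numVars * (d * 22 + 14) + 6) + ((2 + m * (I.numVars * d * 16 + 10)) +
    (nestCost (I.numVars * d) (initAssignmentCost I m) m + (refineLoopCost I m + answerCost I m))))

theorem runs_decideProg (I : AutCSPInstance d) (m : ℕ) :
    Runs (decideProg m) (RamState.initial I.encode) (decideCost I m) fun τ =>
      ∃ H, IsStrategy (I.localAssignments m) H ∧
        (∀ H', IsStrategy (I.localAssignments m) H' → H' ⊆ H) ∧
        (τ.mem 1 0 = 0 ∨ τ.mem 1 0 = 1) ∧ (τ.mem 1 0 = 1 ↔ I.numVars = 0 ∨ H.Nonempty) := by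
  refine (runs_loadHeader I).seq fun σ₁ hF₁ hL₁ => ?_
  have h22 : σ₁.reg 22 = 0 := by
    rw [hF₁.reg 22 (by simp [loadHeader])]
    simp [RamState.initial]
  have h3 : σ₁.mem 3 = fun _ => 0 := by
    rw [hF₁.mem 3 (by simp [loadHeader])]
    simp [RamState.initial]
  refine (runs_pairTables hL₁ h22).seq fun σ₂ hF₂ h₂ => ?_
  have hL₂ := hL₁.of_frame hF₂ (by simp [pairTables]; omega) (by simp [pairTables])
  refine (runs_powerTables m h₂.1).seq fun σ₃ hF₃ h₃ => ?_
  have hL₃ := hL₂.of_frame hF₃ (fun r hr h => by have := powerTables_writesReg h; omega)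
    (fun h => by have := powerTables_writesMem h; omega)
  have hR₃ : Ready I m σ₃ := ⟨hL₃, by
    rw [hF₃.reg 22 (fun h => by have := powerTables_writesReg h; omega), h₂.1], fun y hy => by
    rw [hF₃.mem 7 (fun h => by have := powerTables_writesMem h; omega),
      hF₃.mem 8 (fun h => by have := powerTables_writesMem h; omega)]
    exact h₂.2 y hy, h₃.2⟩
  have hs₃ : I.StateSet σ₃ 3 ∅ := by
    intro q
    rw [hF₃.mem 3 (fun h => by have := powerTables_writesMem h; omega),
      hF₂.mem 3 (by simp [pairTables]), h3]
    simp
  refine (runs_initAssignments hR₃ hs₃).seq fun σ₄ hF₄ h₄ => ?_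
  have hR₄ : Ready I m σ₄ := hR₃.of_frame hF₄
    (fun r h => by rw [nestLoop_writesReg, initAssignment_writesReg] at h; omega)
    (fun a h => by rw [nestLoop_writesMem, initAssignment_writesMem] at h; omega)
  refine (runs_refineLoop hR₄ h₄).seq fun σ₅ _ ⟨hR₅, h₅, h₅'⟩ => ?_
  exact (runs_answer hR₅).weaken le_rfl fun τ _ h => ⟨_, h₅, h₅', h⟩

/-! ## Polynomial bounds -/

/-- The function of instances is bounded by a polynomial in the size of the instance. -/
def PolyBounded (f : ∀ d, AutCSPInstance d → ℕ) : Prop :=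
  ∃ Q : Polynomial ℕ, ∀ d (I : AutCSPInstance d),
    f d I ≤ Q.eval (I.numVars + I.constraintSize + I.aut.size + d)

namespace PolyBounded

variable {f f' : ∀ d, AutCSPInstance d → ℕ}

theorem const (c : ℕ) : PolyBounded fun _ _ => c := ⟨Polynomial.C c, fun _ _ => by simp⟩

theorem of_le (h : ∀ d (I : AutCSPInstance d),
    f d I ≤ I.numVars + I.constraintSize + I.aut.size + d) : PolyBounded f :=
  ⟨Polynomial.X, fun d I => by simpa using h d I⟩

theorem numVars : PolyBounded fun _ I => I.numVars := of_le fun _ _ => by omega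

theorem constraintSize : PolyBounded fun _ I => I.constraintSize := of_le fun _ _ => by omega

theorem autSize : PolyBounded fun _ I => I.aut.size := of_le fun _ _ => by omega

theorem domain : PolyBounded fun d _ => d := of_le fun _ _ => by omega

theorem add (h : PolyBounded f) (h' : PolyBounded f') : PolyBounded fun d I => f d I + f' d I := by
  obtain ⟨Q, hQ⟩ := h
  obtain ⟨Q', hQ'⟩ := h'
  exact ⟨Q + Q', fun d I => by rw [Polynomial.eval_add]; exact Nat.add_le_add (hQ d I) (hQ' d I)⟩

theorem mul (h : PolyBounded f) (h' : PolyBounded f') : PolyBounded fun d I => f d I * f' d I := by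
  obtain ⟨Q, hQ⟩ := h
  obtain ⟨Q', hQ'⟩ := h'
  exact ⟨Q * Q', fun d I => by rw [Polynomial.eval_mul]; exact Nat.mul_le_mul (hQ d I) (hQ' d I)⟩

theorem pow (h : PolyBounded f) (m : ℕ) : PolyBounded fun d I => f d I ^ m := by
  obtain ⟨Q, hQ⟩ := h
  exact ⟨Q ^ m, fun d I => by rw [Polynomial.eval_pow]; exact Nat.pow_le_pow_left (hQ d I) m⟩

theorem nestCost (h : PolyBounded f) (h' : PolyBounded f') (m : ℕ) :
    PolyBounded fun d I => RamProg.nestCost (f d I) (f' d I) m := by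
  induction m with
  | zero => exact h'
  | succ m ih => exact (h.mul (ih.add (const 8))).add (const 6)

end PolyBounded

/-- Follows the structure of the cost functions. The leaves `const _` are numerals, costs of
expressions and the fixed `m`, all independent of the instance. -/
theorem polyBounded_decideCost (m : ℕ) : PolyBounded fun _ I => decideCost I m := by
  have hN : PolyBounded fun d I => I.numVars * d := .mul .numVars .domain
  have h1 : PolyBounded fun _ I => initAssignmentCost I m :=
    .add (.mul .constraintSize (.mul .autSize (.const _))) (.const _)
  have h2 : PolyBounded fun _ I => refineAssignmentCost I m :=
    .add (.const _) (.mul .numVars (.add (.add (.const _) (.mul hN (.const _))) (.const _)))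
  have h3 : PolyBounded fun _ I => refineLoopCost I m :=
    .add (.const _) (.add (.mul (.add (hN.pow m) (.const _)) (.add (.const _) (.add (.const _)
      (hN.nestCost h2 m)))) (.const _))
  have h4 : PolyBounded fun _ I => answerCost I m :=
    .add (.const _) (.add (hN.nestCost (.const _) m) (.const _))
  exact .add (.const _) (.add (.add (.mul .numVars (.add (.mul .domain (.const _)) (.const _)))
    (.const _)) (.add (.add (.const _) (.mul (.const _) (.add (.mul hN (.const _)) (.const _))))
    (.add (hN.nestCost h1 m) (.add h3 h4))))

end RamProg

/-- The algorithm for the decision whether an instance has a solution. -/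
theorem exists_decision (k : ℕ) (hk : 1 ≤ k) :
    ∃ (p : RamProg) (Q : Polynomial ℕ), ∀ (d : ℕ), 0 < d →
      ∀ g : (Fin k → Fin d) → Fin d, IsNearUnanimity g →
      ∀ I : AutCSPInstance d, I.aut ∈ FinAutomaton.classK g →
        ∃ (b t : ℕ),
          p.Computes I.encode [b] t ∧
          t ≤ Q.eval (I.numVars + I.constraintSize + I.aut.size + d) ∧
          (b = 0 ∨ b = 1) ∧
          (b = 1 ↔ ∃ ψ : Fin I.numVars → Fin d, IsSolution ψ I.constraints) := by
  obtain ⟨Q, hQ⟩ := RamProg.polyBounded_decideCost (k - 1)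
  refine ⟨RamProg.decideProg (k - 1), Q, fun d hd g hg I hI => ?_⟩
  obtain ⟨t, σ, hE, ht, H, hH, hmax, h01, hiff⟩ := RamProg.runs_decideProg I (k - 1)
  refine ⟨σ.mem 1 0, t, ⟨σ, hE, fun i hi => ?_⟩, ht.trans (hQ d I), h01, ?_⟩
  · obtain rfl : i = 0 := by simpa using hi
    rfl
  -- The program has computed the greatest strategy, so its answer is the criterion for solvability.
  · rw [hiff, AutCSPInstance.exists_isSolution_iff hd hk hg hI hH hmax]

theorem mainTheorem8 (k : ℕ) (hk : 1 ≤ k) :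
    (∃ (p : RamProg) (c : ℕ), ∀ (d : ℕ), 0 < d →
      ∀ g : (Fin k → Fin d) → Fin d, IsNearUnanimity g →
      ∀ I : AutCSPInstance d, I.aut ∈ FinAutomaton.classK g →
        ∃ (L : List (ExplicitConstraint I.numVars d (k - 1))) (t : ℕ),
          p.Computes I.encode (ExplicitConstraint.encodeInstance L) t ∧
          t ≤ c * (I.constraintSize ^ k * I.aut.size * d ^ (k - 1) + 1) ∧
          (L.map ExplicitConstraint.scope).Nodup ∧
          (∀ u : Fin (k - 1) → Fin I.numVars,
            u ∈ L.map ExplicitConstraint.scope ↔ ∀ j, I.Occurs (u j)) ∧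
          (∀ P ∈ L, P.rel ∈ InvRel g (k - 1)) ∧
          (∀ ψ : Fin I.numVars → Fin d,
            IsSolution ψ I.constraints ↔
              IsSolution ψ {P | ∃ P' ∈ L, P = P'.toConstraint})) ∧
    (∃ (p : RamProg) (Q : Polynomial ℕ), ∀ (d : ℕ), 0 < d →
      ∀ g : (Fin k → Fin d) → Fin d, IsNearUnanimity g →
      ∀ I : AutCSPInstance d, I.aut ∈ FinAutomaton.classK g →
        ∃ (b t : ℕ),
          p.Computes I.encode [b] t ∧
          t ≤ Q.eval (I.numVars + I.constraintSize + I.aut.size + d) ∧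
          (b = 0 ∨ b = 1) ∧
          (b = 1 ↔ ∃ ψ : Fin I.numVars → Fin d, IsSolution ψ I.constraints)) :=
  ⟨exists_decomposition k hk, exists_decision k hk⟩
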